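/- For a group $L$ and an automorphism $x\in\operatorname{Aut}(L)$, let $\alpha(x,L)$ denote the least number $m$ such that some $m$ conjugates of $x$ in the group $G=\langle \operatorname{Inn}(L),x\rangle$ generate $G$; an element $x\in L$ is identified with the inner automorphism it induces. Let $L={}^2F_4(2)'$ be the Tits group, i.e. the derived subgroup of the Ree group ${}^2F_4(2)$. Then $|L|=17971200$, and for every $x\in L$: if $x$ has order greater than $2$, then $\alpha(x,L)=2$; if $x$ has order $2$, then $\alpha(x,L)=3$. -/

import Mathlib

/-! ### The root system of type `F₄` -/

namespace F4

/-- The root lattice of type `F₄`, in coordinates with respect to the simple roots `p₀, p₁, p₂, p₃`,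
where the Dynkin diagram is `p₀ — p₁ ⇒ p₂ — p₃` with `p₀, p₁` long and `p₂, p₃` short. -/
abbrev Lat : Type := Fin 4 → ℤ

/-- Gram matrix of the simple roots; long roots have squared length `4`, short roots `2`. -/
def gram : Matrix (Fin 4) (Fin 4) ℤ :=
  !![4, -2, 0, 0; -2, 4, -2, 0; 0, -2, 2, -1; 0, 0, -1, 2]

/-- The inner product on the root lattice. -/
def ip (v w : Lat) : ℤ := v ⬝ᵥ gram.mulVec w

/-- The roots of type `F₄` are exactly the lattice vectors of squared length `2` (the `24` short
roots) or `4` (the `24` long roots). -/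
def IsRoot (v : Lat) : Prop := ip v v = 2 ∨ ip v v = 4

instance (v : Lat) : Decidable (IsRoot v) := by unfold IsRoot; infer_instance

/-- The simple root `pᵢ`. -/
def simple (i : Fin 4) : Lat := Pi.single i 1

/-- The Cartan integer `A_{s r} = 2 (s, r) / (s, s)`; the division is exact when `s` and `r` are
roots. -/
def cartan (s r : Lat) : ℤ := 2 * ip s r / ip s s

lemma ip_eq (v w : Lat) : ip v w =
    4 * v 0 * w 0 - 2 * v 0 * w 1 - 2 * v 1 * w 0 + 4 * v 1 * w 1 - 2 * v 1 * w 2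
      - 2 * v 2 * w 1 + 2 * v 2 * w 2 - v 2 * w 3 - v 3 * w 2 + 2 * v 3 * w 3 := by
  simp [ip, gram, dotProduct, Matrix.mulVec, Fin.sum_univ_four]
  ring

lemma even_of_long {v : Lat} (h : ip v v = 4) : 2 ∣ v 2 ∧ 2 ∣ v 3 := by
  have h2 : (v 2 * v 2 - v 2 * v 3 + v 3 * v 3) % 2 = 0 := by
    rw [ip_eq] at h
    have : v 2 * v 2 - v 2 * v 3 + v 3 * v 3
        = 2 * (1 - (v 0 * v 0 - v 0 * v 1 + v 1 * v 1 - v 1 * v 2)) := by linarith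
    rw [this]
    simp
  rcases Int.emod_two_eq_zero_or_one (v 2) with a | a <;>
    rcases Int.emod_two_eq_zero_or_one (v 3) with b | b <;>
    simp [Int.add_emod, Int.sub_emod, Int.mul_emod, a, b] at h2
  omega

/-- The length-changing symmetry `r ↦ r̄` of the root system. It is, up to a positive factor on each
root, the restriction of the linear map `p₀ ↦ 2 p₃, p₁ ↦ 2 p₂, p₂ ↦ p₁, p₃ ↦ p₀`, it interchanges
long and short roots, and it induces the symmetry `p₀ ↔ p₃, p₁ ↔ p₂` of the Dynkin diagram. -/
def barLat (r : Lat) : Lat :=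
  if ip r r = 2 then ![r 3, r 2, 2 * r 1, 2 * r 0] else ![r 3 / 2, r 2 / 2, r 1, r 0]

lemma isRoot_barLat {r : Lat} (hr : IsRoot r) : IsRoot (barLat r) := by
  unfold barLat
  split_ifs with h
  · right
    rw [ip_eq] at h ⊢
    simp
    linarith
  · left
    have h4 : ip r r = 4 := hr.resolve_left h
    obtain ⟨⟨a, ha⟩, ⟨b, hb⟩⟩ := even_of_long h4
    rw [ip_eq] at h4 ⊢
    simp [ha, hb] at h4 ⊢
    linarith

/-- The set of roots, as a type. -/
abbrev Root : Type := {v : Lat // IsRoot v}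

/-- The map `r ↦ r̄` on roots. -/
def bar (r : Root) : Root := ⟨barLat r, isRoot_barLat r.2⟩

/-- Positive roots: all coordinates with respect to the simple roots are nonnegative. -/
def positiveRoots : Set Root := {r | ∀ i, 0 ≤ r.1 i}

/-- Negative roots: all coordinates with respect to the simple roots are nonpositive. -/
def negativeRoots : Set Root := {r | ∀ i, r.1 i ≤ 0}

/-! ### The Chevalley group `F₄(2)`, generated by the root elements `x_r(1)` -/

/-- The underlying space of the Lie algebra of type `F₄` over the field of two elements: it has a
Chevalley basis formed by `hᵢ` (for the simple roots) and `e_r` (for all roots); its dimension is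
`52`. -/
abbrev LieF4 : Type := (Fin 4 ⊕ Root) →₀ ZMod 2

/-- The basis vector `hᵢ`. -/
noncomputable def h (i : Fin 4) : LieF4 := Finsupp.single (Sum.inl i) 1

/-- The basis vector `e_v` if `v` is a root, and `0` otherwise. -/
noncomputable def e (v : Lat) : LieF4 :=
  if hv : IsRoot v then Finsupp.single (Sum.inr ⟨v, hv⟩) 1 else 0

/-- `h_r`, the vector of the coroot of `r`: it is `∑ᵢ nᵢ ((pᵢ, pᵢ) / (r, r)) hᵢ` for a root
`r = ∑ᵢ nᵢ pᵢ` (these coefficients are integers). -/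
noncomputable def coroot (r : Lat) : LieF4 :=
  ∑ i, ((r i * ip (simple i) (simple i) / ip r r : ℤ) : ZMod 2) • h i

/-- For roots `s ≠ ± r`, the largest `p` such that `s - p r` is a root (in type `F₄`, `p ≤ 2`). -/
def down (r s : Lat) : ℕ :=
  if IsRoot (s - 2 • r) then 2 else if IsRoot (s - r) then 1 else 0

/-- The linear map `x_r(1) = exp (ad e_r)` of the Lie algebra of type `F₄` over the field of two
elements, given on the Chevalley basis by the usual formulas
`hᵢ ↦ hᵢ - A_{pᵢ r} e_r`, `e_r ↦ e_r`, `e_{-r} ↦ e_{-r} + h_r - e_r`, and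
`e_s ↦ ∑ᵢ ± (p + i choose i) e_{s + i r}` for `s ≠ ± r`, where `s - p r, …, s` is the part of the
`r`-string through `s` below `s`. The signs do not matter in characteristic two. Strings in type
`F₄` have at most three roots, hence `i ≤ 2`. -/
noncomputable def xMap (r : Lat) : LieF4 →ₗ[ZMod 2] LieF4 :=
  Finsupp.linearCombination (ZMod 2) (Sum.elim
    (fun i : Fin 4 => h i - (cartan (simple i) r : ZMod 2) • e r)
    (fun s : Root =>
      if s.1 = r then e r
      else if s.1 = -r then e (-r) + coroot r - e r
      else ∑ i ∈ Finset.range 3, ((down r s + i).choose i : ZMod 2) • e (s.1 + i • r)))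

lemma xMap_h (r : Lat) (i : Fin 4) :
    xMap r (h i) = h i - (cartan (simple i) r : ZMod 2) • e r := by
  simp [xMap, h]

lemma xMap_e_self {r : Lat} (hr : IsRoot r) : xMap r (e r) = e r := by
  conv_lhs => rw [e, dif_pos hr]
  simp [xMap]

lemma ip_neg (r : Lat) : ip (-r) (-r) = ip r r := by simp [ip_eq]

lemma isRoot_neg {r : Lat} (hr : IsRoot r) : IsRoot (-r) := by
  simpa [IsRoot, ip_neg] using hr

lemma ne_zero_of_isRoot {r : Lat} (hr : IsRoot r) : r ≠ 0 := by
  rintro rfl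
  simp [IsRoot, ip] at hr

lemma neg_ne {r : Lat} (hr : IsRoot r) : -r ≠ r := by
  intro h0
  apply ne_zero_of_isRoot hr
  funext i
  have := congrFun h0 i
  simp at this ⊢
  omega

lemma xMap_e_neg {r : Lat} (hr : IsRoot r) :
    xMap r (e (-r)) = e (-r) + coroot r - e r := by
  conv_lhs => rw [e, dif_pos (isRoot_neg hr)]
  simp [xMap, neg_ne hr]

lemma xMap_e {r s : Lat} (hs : IsRoot s) (h1 : s ≠ r) (h2 : s ≠ -r) :
    xMap r (e s) =
      ∑ i ∈ Finset.range 3, ((down r s + i).choose i : ZMod 2) • e (s + i • r) := by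
  conv_lhs => rw [e, dif_pos hs]
  simp [xMap, h1, h2]

lemma e_of_not {v : Lat} (hv : ¬ IsRoot v) : e v = 0 := by simp [e, hv]

lemma eq_zero_of_ip_nonpos {v : Lat} (hv : ip v v ≤ 0) : v = 0 := by
  rw [ip_eq] at hv
  have key : 6 * (2 * v 0 - v 1) ^ 2 + 2 * (3 * v 1 - 2 * v 2) ^ 2
      + (2 * v 2 - 3 * v 3) ^ 2 + 3 * v 3 ^ 2 ≤ 0 := by nlinarith
  have h3 : v 3 = 0 := by
    have : v 3 ^ 2 = 0 := by
      nlinarith [sq_nonneg (2 * v 0 - v 1), sq_nonneg (3 * v 1 - 2 * v 2),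
        sq_nonneg (2 * v 2 - 3 * v 3), sq_nonneg (v 3)]
    exact (pow_eq_zero_iff two_ne_zero).1 this
  have h2 : v 2 = 0 := by
    have : (2 * v 2 - 3 * v 3) ^ 2 = 0 := by
      nlinarith [sq_nonneg (2 * v 0 - v 1), sq_nonneg (3 * v 1 - 2 * v 2),
        sq_nonneg (2 * v 2 - 3 * v 3), sq_nonneg (v 3)]
    have := (pow_eq_zero_iff two_ne_zero).1 this
    omega
  have h1 : v 1 = 0 := by
    have : (3 * v 1 - 2 * v 2) ^ 2 = 0 := by
      nlinarith [sq_nonneg (2 * v 0 - v 1), sq_nonneg (3 * v 1 - 2 * v 2),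
        sq_nonneg (2 * v 2 - 3 * v 3), sq_nonneg (v 3)]
    have := (pow_eq_zero_iff two_ne_zero).1 this
    omega
  have h0 : v 0 = 0 := by
    have : (2 * v 0 - v 1) ^ 2 = 0 := by
      nlinarith [sq_nonneg (2 * v 0 - v 1), sq_nonneg (3 * v 1 - 2 * v 2),
        sq_nonneg (2 * v 2 - 3 * v 3), sq_nonneg (v 3)]
    have := (pow_eq_zero_iff two_ne_zero).1 this
    omega
  funext i
  fin_cases i <;> assumption

lemma ip_add_smul (s r : Lat) (k : ℤ) :
    ip (s + k • r) (s + k • r) = ip s s + 2 * k * ip s r + k ^ 2 * ip r r := by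
  simp [ip_eq]
  ring

lemma even_ip_left {v : Lat} (hv : ip v v = 4) (w : Lat) : 2 ∣ ip v w := by
  obtain ⟨⟨a, ha⟩, ⟨b, hb⟩⟩ := even_of_long hv
  rw [ip_eq, ha, hb]
  exact ⟨2 * v 0 * w 0 - v 0 * w 1 - v 1 * w 0 + 2 * v 1 * w 1 - v 1 * w 2
      - 2 * a * w 1 + 2 * a * w 2 - a * w 3 - b * w 2 + 2 * b * w 3, by ring⟩

lemma ip_comm (v w : Lat) : ip v w = ip w v := by
  rw [ip_eq, ip_eq]
  ring

lemma add_self_eq_zero (v : LieF4) : v + v = 0 := ZModModule.add_self v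

lemma add_smul_ne {r s : Lat} (hr : IsRoot r) (hs : IsRoot s) (h1 : s ≠ r) (h2 : s ≠ -r) (k : ℤ) :
    s ≠ k • r := by
  rintro rfl
  have hk : ip (k • r) (k • r) = k ^ 2 * ip r r := by simpa [ip] using ip_add_smul 0 r k
  have hlt : k ^ 2 < 4 := by
    rcases hr with a | a <;> rcases hs with b | b <;> rw [hk, a] at b <;> omega
  have hk1 : k < 2 := by nlinarith
  have hk2 : -2 < k := by nlinarith
  obtain rfl | rfl | rfl : k = -1 ∨ k = 0 ∨ k = 1 := by omega
  · simp at h2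
  · exact ne_zero_of_isRoot hs (zero_smul _ _)
  · simp at h1

/-- The action of `x_r(1)` along the `r`-string through `s ≠ ± r`. -/
lemma xMap_e_add {r s : Lat} (hr : IsRoot r) (hs : IsRoot s) (h1 : s ≠ r) (h2 : s ≠ -r) (k : ℤ)
    (hk : IsRoot (s + k • r)) :
    xMap r (e (s + k • r)) = ∑ i ∈ Finset.range 3,
      (((if IsRoot (s + (k - 2) • r) then 2 else if IsRoot (s + (k - 1) • r) then 1 else 0)
        + i).choose i : ZMod 2) • e (s + (k + i) • r) := by
  have n1 : s + k • r ≠ r := fun h0 => add_smul_ne hr hs h1 h2 (1 - k) (by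
    rw [sub_smul, one_smul]; exact eq_sub_of_add_eq h0)
  have n2 : s + k • r ≠ -r := fun h0 => add_smul_ne hr hs h1 h2 (-1 - k) (by
    rw [sub_smul, neg_smul, one_smul]; exact eq_sub_of_add_eq h0)
  have e2 : s + k • r - 2 • r = s + (k - 2) • r := by module
  have e1 : s + k • r - r = s + (k - 1) • r := by module
  have e3 : ∀ i : ℕ, s + k • r + i • r = s + (k + i) • r := fun i => by module
  rw [xMap_e hk n1 n2]
  simp only [down, e2, e1, e3]

/-- The inner products of two roots `r ≠ ± s`. -/
lemma ip_cases {r s : Lat} (hr : IsRoot r) (hs : IsRoot s) (h1 : s ≠ r) (h2 : s ≠ -r) :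
    (ip s s = 2 ∧ ip r r = 2 ∧ (ip s r = -1 ∨ ip s r = 0 ∨ ip s r = 1)) ∨
    (ip s s = 2 ∧ ip r r = 4 ∧ (ip s r = -2 ∨ ip s r = 0 ∨ ip s r = 2)) ∨
    (ip s s = 4 ∧ ip r r = 2 ∧ (ip s r = -2 ∨ ip s r = 0 ∨ ip s r = 2)) ∨
    (ip s s = 4 ∧ ip r r = 4 ∧ (ip s r = -2 ∨ ip s r = 0 ∨ ip s r = 2)) := by
  have p1 : 0 < ip s s + 2 * 1 * ip s r + 1 ^ 2 * ip r r := by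
    rw [← ip_add_smul]
    by_contra! h0
    exact h2 (by simpa using eq_neg_of_add_eq_zero_left (eq_zero_of_ip_nonpos h0))
  have p2 : 0 < ip s s + 2 * (-1) * ip s r + (-1) ^ 2 * ip r r := by
    rw [← ip_add_smul]
    by_contra! h0
    exact h1 (by simpa using eq_neg_of_add_eq_zero_left (eq_zero_of_ip_nonpos h0))
  have d1 : ip s s = 4 → 2 ∣ ip s r := fun h0 => even_ip_left h0 r
  have d2 : ip r r = 4 → 2 ∣ ip s r := fun h0 => ip_comm r s ▸ even_ip_left h0 s
  rcases hr with a | a <;> rcases hs with b | b <;> omega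

lemma xMap_coroot {r : Lat} (hr : IsRoot r) : xMap r (coroot r) = coroot r := by
  have key : ∑ i, ((r i * ip (simple i) (simple i) / ip r r : ℤ) : ZMod 2) *
      (cartan (simple i) r : ZMod 2) = 0 := by
    have n0 : ip (simple 0) (simple 0) = 4 := by simp [ip_eq, simple]
    have n1 : ip (simple 1) (simple 1) = 4 := by simp [ip_eq, simple]
    have n2 : ip (simple 2) (simple 2) = 2 := by simp [ip_eq, simple]
    have n3 : ip (simple 3) (simple 3) = 2 := by simp [ip_eq, simple]
    have c0 : cartan (simple 0) r = 2 * r 0 - r 1 := by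
      rw [cartan, n0, ip_eq]; simp [simple]; omega
    have c1 : cartan (simple 1) r = - r 0 + 2 * r 1 - r 2 := by
      rw [cartan, n1, ip_eq]; simp [simple]; omega
    have c2 : cartan (simple 2) r = -(2 * r 1) + 2 * r 2 - r 3 := by
      rw [cartan, n2, ip_eq]; simp [simple]
    have c3 : cartan (simple 3) r = - r 2 + 2 * r 3 := by
      rw [cartan, n3, ip_eq]; simp [simple]
    rw [Fin.sum_univ_four, n0, n1, n2, n3, c0, c1, c2, c3]
    norm_cast
    rw [ZMod.intCast_zmod_eq_zero_iff_dvd]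
    rcases hr with a | a
    · have f0 : r 0 * 4 / 2 = 2 * r 0 := by omega
      have f1 : r 1 * 4 / 2 = 2 * r 1 := by omega
      have f2 : r 2 * 2 / 2 = r 2 := by omega
      have f3 : r 3 * 2 / 2 = r 3 := by omega
      rw [a, f0, f1, f2, f3]
      exact ⟨(r 0 * (2 * r 0 - r 1) + r 1 * (- r 0 + 2 * r 1 - r 2)
        + r 2 * (r 2 - r 1) + r 3 * (r 3 - r 2)), by push_cast; ring⟩
    · obtain ⟨⟨u, hu⟩, ⟨w, hw⟩⟩ := even_of_long a
      have f0 : r 0 * 4 / 4 = r 0 := by omega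
      have f1 : r 1 * 4 / 4 = r 1 := by omega
      have f2 : r 2 * 2 / 4 = u := by omega
      have f3 : r 3 * 2 / 4 = w := by omega
      rw [a, f0, f1, f2, f3, hu, hw]
      exact ⟨(r 0 ^ 2 - r 0 * r 1 + r 1 ^ 2 - r 1 * u
        + u * (- r 1 + 2 * u - w) + w * (- u + 2 * w)), by push_cast; ring⟩
  simp only [coroot, map_sum, map_smul, xMap_h, smul_sub, Finset.sum_sub_distrib, smul_smul]
  rw [← Finset.sum_smul, key, zero_smul, sub_zero]

lemma xMap_xMap_e {r s : Lat} (hr : IsRoot r) (hs : IsRoot s) :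
    xMap r (xMap r (e s)) = e s := by
  by_cases h1 : s = r
  · subst h1
    rw [xMap_e_self hs, xMap_e_self hs]
  by_cases h2 : s = -r
  · subst h2
    simp only [xMap_e_neg hr, map_sub, map_add, xMap_coroot hr, xMap_e_self hr]
    have := add_self_eq_zero (coroot r)
    have := add_self_eq_zero (e r)
    calc e (-r) + coroot r - e r + coroot r - e r
        = e (-r) + (coroot r + coroot r) - (e r + e r) := by abel
      _ = e (-r) := by simp [add_self_eq_zero]
  have R : ∀ k : ℤ, IsRoot (s + k • r) ↔
      (ip s s + 2 * k * ip s r + k ^ 2 * ip r r = 2 ∨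
        ip s s + 2 * k * ip s r + k ^ 2 * ip r r = 4) := fun k => by
    rw [IsRoot, ip_add_smul]
  have X := xMap_e_add hr hs h1 h2
  have Z : ∀ k : ℤ, ¬ IsRoot (s + k • r) → e (s + k • r) = 0 := fun k => e_of_not
  have E0 : e s = e (s + (0 : ℤ) • r) := by simp
  rw [E0]
  generalize hE : (fun k : ℤ => e (s + k • r)) = E at *
  have hE' : ∀ k : ℤ, e (s + k • r) = E k := fun k => by rw [← hE]
  simp only [R, hE'] at X Z ⊢
  have y1 : ∀ a b : LieF4, a + b + b = a := fun a b => by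
    rw [add_assoc, add_self_eq_zero, add_zero]
  have y2 : ∀ a b c : LieF4, a + b + c + b + c = a := fun a b c => by
    rw [add_right_comm (a + b), y1, y1]
  have hz : (3 : ZMod 2) = 1 := rfl
  have hz2 : (2 : ZMod 2) = 0 := rfl
  have hz6 : (6 : ZMod 2) = 0 := rfl
  have hc : Nat.choose 4 2 = 6 := rfl
  rcases ip_cases hr hs h1 h2 with ⟨a, b, c | c | c⟩ | ⟨a, b, c | c | c⟩ | ⟨a, b, c | c | c⟩ |
    ⟨a, b, c | c | c⟩ <;>
  simp [a, b, c] at X Z <;>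
  simp [X, Z, Finset.sum_range_succ, hz, hz2, hz6, hc, y1, y2]

lemma xMap_xMap_h {r : Lat} (hr : IsRoot r) (i : Fin 4) : xMap r (xMap r (h i)) = h i := by
  simp only [xMap_h, map_sub, map_smul, xMap_e_self hr, sub_sub, add_self_eq_zero, sub_zero]

lemma xMap_comp {r : Lat} (hr : IsRoot r) : xMap r ∘ₗ xMap r = LinearMap.id := by
  refine Finsupp.lhom_ext' fun j => LinearMap.ext_ring ?_
  rcases j with i | s
  · exact xMap_xMap_h hr i
  · have := xMap_xMap_e hr s.2
    simpa [e, s.2] using this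

/-- The root element `x_r(1)`, as an invertible linear map. -/
noncomputable def x (r : Root) : LieF4 ≃ₗ[ZMod 2] LieF4 :=
  LinearEquiv.ofLinearMap (xMap r) (xMap r) (xMap_comp r.2) (xMap_comp r.2)

/-! ### The Ree group `²F₄(2)` and the Tits group -/

/-- The graph (as a set of pairs) of the restriction of the graph automorphism
`σ : x_r(1) ↦ x_{r̄}(1)` of `F₄(2)` to the subgroup generated by the `x_r(1)` with `r ∈ S`. -/
noncomputable def sigmaGraph (S : Set Root) :
    Subgroup ((LieF4 ≃ₗ[ZMod 2] LieF4) × (LieF4 ≃ₗ[ZMod 2] LieF4)) :=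
  Subgroup.closure ((fun r => (x r, x (bar r))) '' S)

/-- The subgroup of all elements `u` of `⟨x_r(1) | r ∈ S⟩` such that `σ u = u`, where `σ` is the
graph automorphism `x_r(1) ↦ x_{r̄}(1)` of `F₄(2)`. -/
noncomputable def sigmaFixed (S : Set Root) : Subgroup (LieF4 ≃ₗ[ZMod 2] LieF4) :=
  (sigmaGraph S).comap ((MonoidHom.id _).prod (MonoidHom.id _))

/-- The Ree group `²F₄(2)`: the twisted subgroup `⟨U¹, V¹⟩` of `F₄(2)`, where `U` and `V` are the
subgroups generated by the positive and by the negative root elements, and `U¹`, `V¹` are the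
subgroups of their elements fixed by `σ`. (Over the field of two elements no field automorphism
is involved in `σ`.) -/
noncomputable def reeGroup : Subgroup (LieF4 ≃ₗ[ZMod 2] LieF4) :=
  sigmaFixed positiveRoots ⊔ sigmaFixed negativeRoots

/-- The Tits group `²F₄(2)'`, the derived subgroup of `²F₄(2)`. -/
abbrev TitsGroup : Type := ↥⁅reeGroup, reeGroup⁆

end F4

/-- For a group `L` and an automorphism `x` of `L`, `alpha x` is the least number `m` such that some
`m` conjugates of `x` in the group `G = ⟨Inn L, x⟩` generate `G` (and `0` if there is no such
`m`). -/
noncomputable def alpha {L : Type*} [Group L] (x : MulAut L) : ℕ :=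
  sInf {m : ℕ | ∃ g : Fin m → MulAut L,
    (∀ i, g i ∈ (MulAut.conj : L →* MulAut L).range ⊔ Subgroup.zpowers x) ∧
    Subgroup.closure (Set.range fun i => g i * x * (g i)⁻¹) =
      (MulAut.conj : L →* MulAut L).range ⊔ Subgroup.zpowers x}

/-! The order of L. Working down through the root subgroups, one finds that the σ-fixed elements of
the positive unipotent group are generated by twelve elements `R 0`, …, `R 11`
(`mem_tail_R_of_mem_tail`). The negative ones are their conjugates under the longest Weyl element,
so the Ree group is generated by these twelve elements and two involutions (`reeGroup_eq`). A Bruhat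
decomposition with dihedral Weyl group of order 16 and root groups of orders at most 2 and 4
(`DihedralBN.Data.card_le`) bounds the order by 8775 · 2 ^ 12 = 35942400. This bound is proved for a
lift in which every generator carries a parity. The even part of the lift has index at least 2 and
maps onto a group containing all commutators, so |L| ≤ 17971200. Conversely, the subgroup `tits` of
L, generated by explicit elements, contains subgroups of orders 2 ^ 11, 3 ^ 3, 5 ^ 2 and 13, and the
product of these numbers is 17971200. Hence `tits` is L, and these subgroups are Sylow subgroups.

Upper bounds for α. If m conjugates of a power of x generate L, then so do m conjugates of x. It is
therefore enough to treat elements of order 3, 5, 13 and 4, together with the involutions. By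
Sylow's theorem they may be taken in the known Sylow subgroups. Enumerating these shows that each
such element, or a power of it, is conjugate to one of eight representatives (`check_fusion`,
`check_fusion_two`). For each representative, explicit conjugates and words in them certify
generation (`Cert.genBy`).

Lower bounds for α. One element generates a cyclic group and two involutions generate a dihedral
group; in both, any two squares commute (`sq_mul_sq_comm`). But L has two squares whose commutator
is not central (`sq_mul_sq_not_central`), so Inn L is neither cyclic nor generated by two
involutions.

All identities between linear maps of the 52-dimensional Lie algebra are decided by coding matrices
over the field of two elements as natural numbers (`Codes.eq_iff`), so that a matrix product becomes
a few shifts, multiplications and xors. -/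

set_option exponentiation.threshold 3000

namespace BitMat

/-! ### Square matrices of size `52` over the field of two elements, coded as natural numbers

Column `j` of the matrix is digit `j` in base `2 ^ 52`; entry `i` of a column is bit `i`. -/

/-- Column `j` of the matrix coded by `M`. -/
def col (M j : ℕ) : ℕ := Nat.mod (Nat.shiftRight M (Nat.mul 52 j)) 4503599627370496

/-- The number with bits at the multiples of `52` below `52 * 52`. -/
def mask : ℕ :=
  0x1000000000000100000000000010000000000001000000000000100000000000010000000000001000000000000100000000000010000000000001000000000000100000000000010000000000001000000000000100000000000010000000000001000000000000100000000000010000000000001000000000000100000000000010000000000001000000000000100000000000010000000000001000000000000100000000000010000000000001000000000000100000000000010000000000001000000000000100000000000010000000000001000000000000100000000000010000000000001000000000000100000000000010000000000001000000000000100000000000010000000000001000000000000100000000000010000000000001000000000000100000000000010000000000001000000000000100000000000010000000000001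

/-- The contribution of column `k` of `M` to the product of `M` and `N`. -/
def outer (m M N k : ℕ) : ℕ := Nat.mul (Nat.land (Nat.shiftRight N k) m) (col M k)

/-- The sum of the contributions of the first `k` columns of `M` to the product of `M` and `N`. -/
def mulAux (m M N : ℕ) : ℕ → ℕ
  | 0 => 0
  | k + 1 => Nat.xor (outer m M N k) (mulAux m M N k)

/-- `force n k = k n`, with `n` evaluated before it is passed to `k`. -/
def force {α : Sort*} (n : ℕ) (k : ℕ → α) : α :=
  match n with
  | 0 => k 0
  | n + 1 => k (n + 1)

theorem force_eq {α : Sort*} (n : ℕ) (k : ℕ → α) : force n k = k n := by cases n <;> rfl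

/-- `mulAux m M N 1`. -/
def mul1 (m c M N : ℕ) : ℕ := Nat.mul (Nat.land N m) (Nat.land M c)

/-- `mulAux m M N 2`. -/
def mul2 (m c M N : ℕ) : ℕ :=
  Nat.xor (mul1 m c M N) (mul1 m c (Nat.shiftRight M 52) (Nat.shiftRight N 1))

/-- `mulAux m M N 4`. -/
def mul4 (m c M N : ℕ) : ℕ :=
  Nat.xor (mul2 m c M N) (mul2 m c (Nat.shiftRight M 104) (Nat.shiftRight N 2))

/-- `mulAux m M N 8`. -/
def mul8 (m c M N : ℕ) : ℕ :=
  Nat.xor (mul4 m c M N) (mul4 m c (Nat.shiftRight M 208) (Nat.shiftRight N 4))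

/-- `mulAux m M N 16`. -/
def mul16 (m c M N : ℕ) : ℕ :=
  Nat.xor (mul8 m c M N) (mul8 m c (Nat.shiftRight M 416) (Nat.shiftRight N 8))

/-- `mulAux m M N 52`. -/
def mul52 (m c M N : ℕ) : ℕ :=
  Nat.xor
    (Nat.xor (mul16 m c M N) (mul16 m c (Nat.shiftRight M 832) (Nat.shiftRight N 16)))
    (Nat.xor (mul16 m c (Nat.shiftRight M 1664) (Nat.shiftRight N 32))
      (mul4 m c (Nat.shiftRight M 2496) (Nat.shiftRight N 48)))

/-- The product of two matrices. -/
def mul (M N : ℕ) : ℕ :=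
  force mask fun m => force 4503599627370495 fun c => force M fun M => force N fun N =>
    mul52 m c M N

/-- The code of the identity matrix. -/
def one : ℕ :=
  0x8000000000000400000000000020000000000001000000000000080000000000004000000000000200000000000010000000000000800000000000040000000000002000000000000100000000000008000000000000400000000000020000000000001000000000000080000000000004000000000000200000000000010000000000000800000000000040000000000002000000000000100000000000008000000000000400000000000020000000000001000000000000080000000000004000000000000200000000000010000000000000800000000000040000000000002000000000000100000000000008000000000000400000000000020000000000001000000000000080000000000004000000000000200000000000010000000000000800000000000040000000000002000000000000100000000000008000000000000400000000000020000000000001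

theorem col_eq (M j : ℕ) : col M j = (M >>> (52 * j)) % 2 ^ 52 := rfl

theorem col_lt (M j : ℕ) : col M j < 2 ^ 52 := Nat.mod_lt _ (by norm_num)

theorem testBit_col (M j i : ℕ) : (col M j).testBit i = (decide (i < 52) && M.testBit (52 * j + i)) := by
  rw [col_eq, Nat.testBit_mod_two_pow, Nat.testBit_shiftRight]

theorem col_xor (M N j : ℕ) : col (M ^^^ N) j = col M j ^^^ col N j := by
  apply Nat.eq_of_testBit_eq
  intro i
  simp only [testBit_col, Nat.testBit_xor]
  cases decide (i < 52) <;> simp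

theorem mask_testBit : ∀ i < 2704, mask.testBit i = decide (i % 52 = 0) := by decide +kernel

theorem mask_lt : mask < 2 ^ 2704 := by decide +kernel

theorem mask_mul_lt : mask * (2 ^ 52 - 1) < 2 ^ 2704 := by decide +kernel

theorem dvd_of_testBit_mask {i : ℕ} (h : mask.testBit i = true) : 52 ∣ i := by
  have hi : i < 2704 := by
    by_contra! h0
    rw [Nat.testBit_lt_two_pow (mask_lt.trans_le (Nat.pow_le_pow_right (by norm_num) h0))] at h
    simp at h
  rw [mask_testBit i hi] at h
  exact Nat.dvd_of_mod_eq_zero (by simpa using h)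

/-- In base 2 ^ 52 all digits of `x` are 0 or 1, so the product with a single digit `c` has no
carries. The induction on `j` strips the lowest digit. -/
theorem col_mul_sparse {c : ℕ} (hc : c < 2 ^ 52) (j : ℕ) : ∀ x : ℕ,
    (∀ i, x.testBit i = true → 52 ∣ i) →
      col (x * c) j = if x.testBit (52 * j) then c else 0 := by
  have key : ∀ x : ℕ, (∀ i, x.testBit i = true → 52 ∣ i) →
      x * c = x % 2 * c + 2 ^ 52 * (x / 2 ^ 52 * c) ∧ x % 2 * c < 2 ^ 52 := by
    intro x hx
    have h1 : x % 2 ^ 52 = x % 2 := by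
      apply Nat.eq_of_testBit_eq
      intro i
      rw [Nat.testBit_mod_two_pow, show x % 2 = x % 2 ^ 1 by simp, Nat.testBit_mod_two_pow]
      rcases Nat.eq_zero_or_pos i with rfl | hi
      · simp
      · by_cases h52 : i < 52
        · have : x.testBit i = false := by
            by_contra h0
            have := Nat.le_of_dvd hi (hx i (by simpa using h0))
            omega
          simp [this]
        · simp [h52, show ¬ i < 1 by omega]
    constructor
    · conv_lhs => rw [← Nat.mod_add_div x (2 ^ 52), h1]
      ring
    · rcases Nat.mod_two_eq_zero_or_one x with h | h <;> rw [h]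
      · simp
      · rwa [one_mul]
  induction j with
  | zero =>
    intro x hx
    obtain ⟨h1, h2⟩ := key x hx
    rw [col_eq, h1]
    simp only [Nat.mul_zero, Nat.shiftRight_zero, Nat.add_mul_mod_self_left, Nat.mod_eq_of_lt h2,
      Nat.testBit_zero]
    rcases Nat.mod_two_eq_zero_or_one x with h | h <;> simp [h]
  | succ j ih =>
    intro x hx
    obtain ⟨h1, h2⟩ := key x hx
    have h3 : (x * c) / 2 ^ 52 = x / 2 ^ 52 * c := by
      rw [h1, Nat.add_mul_div_left _ _ (by norm_num), Nat.div_eq_of_lt h2, zero_add]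
    have h4 : ∀ i, (x / 2 ^ 52).testBit i = x.testBit (52 + i) := by
      intro i
      rw [← Nat.shiftRight_eq_div_pow, Nat.testBit_shiftRight]
    have := ih (x / 2 ^ 52) (fun i hi => by
      rw [h4] at hi
      have := hx _ hi
      omega)
    rw [h4, ← h3] at this
    rw [show 52 * (j + 1) = 52 + 52 * j by ring, ← this, col_eq, col_eq, Nat.mul_add, mul_one,
      Nat.add_comm, Nat.add_comm 52, Nat.shiftRight_add, ← Nat.shiftRight_eq_div_pow,
      ← Nat.shiftRight_add, ← Nat.shiftRight_add, Nat.add_comm]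

/-- Entry `k` of column `j` of `N` is bit `52 * j + k`, so shifting by `k` and masking isolates row
`k` of `N`. One multiplication then gives the rank one matrix (column `k` of `M`) times (row `k` of
`N`); the matrix product is the sum of these. -/
theorem col_outer (M N k j : ℕ) (hj : j < 52) :
    col (outer mask M N k) j = if N.testBit (52 * j + k) then col M k else 0 := by
  have h : outer mask M N k = ((N >>> k) &&& mask) * col M k := rfl
  rw [h, col_mul_sparse (col_lt M k) j _ (fun i hi => ?_)]
  · rw [Nat.testBit_and, Nat.testBit_shiftRight, mask_testBit _ (by omega), Nat.add_comm k]
    simp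
  · rw [Nat.testBit_and, Bool.and_eq_true] at hi
    exact dvd_of_testBit_mask hi.2

theorem outer_lt (M N k : ℕ) : outer mask M N k < 2 ^ 2704 := by
  have h : outer mask M N k = ((N >>> k) &&& mask) * col M k := rfl
  rw [h]
  calc ((N >>> k) &&& mask) * col M k ≤ mask * (2 ^ 52 - 1) :=
        Nat.mul_le_mul Nat.and_le_right (Nat.le_sub_one_of_lt (col_lt M k))
    _ < 2 ^ 2704 := mask_mul_lt

theorem mulAux_lt (M N : ℕ) : ∀ k, mulAux mask M N k < 2 ^ 2704
  | 0 => by positivity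
  | k + 1 => Nat.xor_lt_two_pow (outer_lt M N k) (mulAux_lt M N k)

/-- Dropping the first `a` columns of `M` and the first `a` rows of `N` amounts to two shifts.
Repeated halving of the sum therefore identifies the unrolled functions `mul1`, …, `mul52` with the
recursive `mulAux`. -/
theorem mulAux_add (m M N a b : ℕ) :
    mulAux m M N (a + b) = mulAux m M N a ^^^ mulAux m (M >>> (52 * a)) (N >>> a) b := by
  induction b with
  | zero => exact (Nat.xor_zero _).symm
  | succ b ih =>
    have h1 : mulAux m M N (a + b + 1) = outer m M N (a + b) ^^^ mulAux m M N (a + b) := rfl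
    have h2 : ∀ M N, mulAux m M N (b + 1) = outer m M N b ^^^ mulAux m M N b := fun _ _ => rfl
    have h3 : outer m M N (a + b) = outer m (M >>> (52 * a)) (N >>> a) b := by
      change ((N >>> (a + b)) &&& m) * col M (a + b) =
        ((N >>> a >>> b) &&& m) * col (M >>> (52 * a)) b
      rw [col_eq, col_eq, Nat.shiftRight_add, Nat.mul_add, Nat.shiftRight_add M]
    rw [← add_assoc, h1, ih, h2, h3, ← Nat.xor_assoc, ← Nat.xor_assoc,
      Nat.xor_comm (outer _ _ _ _)]

theorem mul1_eq (m M N : ℕ) : mul1 m 4503599627370495 M N = mulAux m M N 1 := by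
  have h : mulAux m M N 1 = (((N >>> 0) &&& m) * ((M >>> (52 * 0)) % 2 ^ 52)) ^^^ 0 := rfl
  rw [h, Nat.xor_zero, Nat.mul_zero, Nat.shiftRight_zero, Nat.shiftRight_zero,
    ← Nat.and_two_pow_sub_one_eq_mod]
  rfl

theorem mul2_eq (m M N : ℕ) : mul2 m 4503599627370495 M N = mulAux m M N 2 := by
  rw [mulAux_add m M N 1 1, ← mul1_eq, ← mul1_eq]
  rfl

theorem mul4_eq (m M N : ℕ) : mul4 m 4503599627370495 M N = mulAux m M N 4 := by
  rw [mulAux_add m M N 2 2, ← mul2_eq, ← mul2_eq]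
  rfl

theorem mul8_eq (m M N : ℕ) : mul8 m 4503599627370495 M N = mulAux m M N 8 := by
  rw [mulAux_add m M N 4 4, ← mul4_eq, ← mul4_eq]
  rfl

theorem mul16_eq (m M N : ℕ) : mul16 m 4503599627370495 M N = mulAux m M N 16 := by
  rw [mulAux_add m M N 8 8, ← mul8_eq, ← mul8_eq]
  rfl

theorem mul52_eq (m M N : ℕ) : mul52 m 4503599627370495 M N = mulAux m M N 52 := by
  -- The splitting is 52 = (16 + 16) + (16 + 4).
  rw [mulAux_add m M N 32 20, mulAux_add m M N 16 16,
    mulAux_add m (M >>> (52 * 32)) (N >>> 32) 16 4, ← mul16_eq, ← mul16_eq, ← mul16_eq, ← mul4_eq,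
    ← Nat.shiftRight_add, ← Nat.shiftRight_add]
  rfl

theorem mul_eq (M N : ℕ) : mul M N = mulAux mask M N 52 := by
  rw [mul, force_eq, force_eq, force_eq, force_eq, mul52_eq]

theorem mul_lt (M N : ℕ) : mul M N < 2 ^ 2704 := mul_eq M N ▸ mulAux_lt M N 52

theorem one_lt : one < 2 ^ 2704 := by decide +kernel

theorem col_one : ∀ j < 52, col one j = 2 ^ j := by decide +kernel

theorem eq_of_col_eq {M N : ℕ} (hM : M < 2 ^ 2704) (hN : N < 2 ^ 2704)
    (h : ∀ j < 52, col M j = col N j) : M = N := by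
  apply Nat.eq_of_testBit_eq
  intro i
  by_cases hi : i < 2704
  · have := congrArg (fun c => c.testBit (i % 52)) (h (i / 52) (by omega))
    simpa [testBit_col, Nat.mod_lt, Nat.div_add_mod] using this
  · have h2 : 2 ^ 2704 ≤ 2 ^ i := Nat.pow_le_pow_right (by norm_num) (by omega)
    rw [Nat.testBit_lt_two_pow (hM.trans_le h2), Nat.testBit_lt_two_pow (hN.trans_le h2)]

-- This only restrains the elaborator; the kernel ignores the attribute and still evaluates these
-- constants in `decide +kernel`.
attribute [irreducible] one mask mul

/-! ### Vectors and linear maps coded by natural numbers -/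

section Linear

variable {V : Type*} [AddCommGroup V] [Module (ZMod 2) V] (b : Module.Basis (Fin 52) (ZMod 2) V)

/-- The vector whose coordinates are the bits of `n`. -/
noncomputable def vec (n : ℕ) : V := ∑ i : Fin 52, if n.testBit i then b i else 0

theorem vec_zero : vec b 0 = 0 := by simp [vec]

theorem vec_xor (m n : ℕ) : vec b (m ^^^ n) = vec b m + vec b n := by
  rw [vec, vec, vec, ← Finset.sum_add_distrib]
  refine Finset.sum_congr rfl fun i _ => ?_
  rw [Nat.testBit_xor]
  cases m.testBit i <;> cases n.testBit i <;> simp [ZModModule.add_self]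

theorem vec_two_pow (i : Fin 52) : vec b (2 ^ (i : ℕ)) = b i := by
  simp only [vec, Nat.testBit_two_pow, decide_eq_true_eq, Fin.val_inj]
  simp

theorem repr_vec (n : ℕ) (i : Fin 52) : b.repr (vec b n) i = if n.testBit i then 1 else 0 := by
  have h : vec b n = ∑ i : Fin 52, (if n.testBit i then (1 : ZMod 2) else 0) • b i := by
    simp [vec]
  rw [h, b.repr_sum_self]

theorem vec_injOn {m n : ℕ} (hm : m < 2 ^ 52) (hn : n < 2 ^ 52) (h : vec b m = vec b n) : m = n := by
  apply Nat.eq_of_testBit_eq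
  intro i
  by_cases hi : i < 52
  · have := DFunLike.congr_fun (congrArg b.repr h) (⟨i, hi⟩ : Fin 52)
    rw [repr_vec, repr_vec] at this
    revert this
    simp only
    cases m.testBit i <;> cases n.testBit i <;> simp
  · have h2 : 2 ^ 52 ≤ 2 ^ i := Nat.pow_le_pow_right (by norm_num) (by omega)
    rw [Nat.testBit_lt_two_pow (hm.trans_le h2), Nat.testBit_lt_two_pow (hn.trans_le h2)]

/-- The linear map with the matrix coded by `M`. -/
noncomputable def lin (M : ℕ) : V →ₗ[ZMod 2] V := b.constr (ZMod 2) fun j => vec b (col M j)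

theorem lin_basis (M : ℕ) (j : Fin 52) : lin b M (b j) = vec b (col M j) := b.constr_basis ..

theorem lin_one : lin b one = LinearMap.id :=
  b.ext fun j => by rw [lin_basis, col_one j j.2, vec_two_pow]; rfl

theorem vec_col_mulAux (M N : ℕ) (j : Fin 52) (k : ℕ) : vec b (col (mulAux mask M N k) j) =
    ∑ i ∈ Finset.range k, if N.testBit (52 * j + i) then vec b (col M i) else 0 := by
  induction k with
  | zero =>
    have : col (mulAux mask M N 0) j = 0 := by simp [mulAux, col_eq]
    simp [this, vec_zero]
  | succ k ih =>
    have : mulAux mask M N (k + 1) = outer mask M N k ^^^ mulAux mask M N k := rfl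
    rw [this, col_xor, vec_xor, ih, col_outer M N k j j.2, Finset.sum_range_succ, add_comm]
    split_ifs <;> simp [vec_zero]

theorem lin_mul (M N : ℕ) : lin b (mul M N) = lin b M ∘ₗ lin b N := by
  refine b.ext fun j => ?_
  rw [lin_basis, mul_eq, vec_col_mulAux, LinearMap.comp_apply, lin_basis,
    vec, map_sum, Finset.sum_range]
  refine Finset.sum_congr rfl fun i _ => ?_
  rw [testBit_col]
  split_ifs with h1 h2 h2 <;> simp_all [lin_basis]

theorem lin_injOn {M N : ℕ} (hM : M < 2 ^ 2704) (hN : N < 2 ^ 2704) (h : lin b M = lin b N) :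
    M = N := by
  refine eq_of_col_eq hM hN fun j hj => ?_
  have := LinearMap.congr_fun h (b ⟨j, hj⟩)
  rw [lin_basis, lin_basis] at this
  exact vec_injOn b (col_lt _ _) (col_lt _ _) this

/-- The invertible linear map `g` has the matrix coded by `M`. -/
def Codes (g : V ≃ₗ[ZMod 2] V) (M : ℕ) : Prop := (g : V →ₗ[ZMod 2] V) = lin b M ∧ M < 2 ^ 2704

variable {b}

theorem Codes.one : Codes b 1 one := ⟨(lin_one b).symm, one_lt⟩

theorem Codes.mul {g h : V ≃ₗ[ZMod 2] V} {M N : ℕ} (hg : Codes b g M) (hh : Codes b h N) :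
    Codes b (g * h) (mul M N) :=
  ⟨by rw [lin_mul, ← hg.1, ← hh.1]; rfl, mul_lt M N⟩

/-- The bridge between group theory and arithmetic. The bound 2 ^ 2704 in `Codes` excludes stray
bits beyond the 52 columns and so makes the code unique. -/
theorem Codes.eq_iff {g h : V ≃ₗ[ZMod 2] V} {M N : ℕ} (hg : Codes b g M) (hh : Codes b h N) :
    g = h ↔ M = N := by
  constructor
  · rintro rfl
    exact lin_injOn b hg.2 hh.2 (hg.1.symm.trans hh.1)
  · rintro rfl
    exact LinearEquiv.toLinearMap_injective (hg.1.trans hh.1.symm)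

end Linear

end BitMat

namespace F4

open BitMat

/-! ### Matrices of the root elements -/

/-- Lattice vectors as quadruples of integers. -/
abbrev Quad : Type := ℤ × ℤ × ℤ × ℤ

namespace Quad

/-- The lattice vector with the given coordinates. -/
def toLat (q : Quad) : Lat := ![q.1, q.2.1, q.2.2.1, q.2.2.2]

/-- The vector `q + k r`. -/
def addMul (q r : Quad) (k : ℤ) : Quad :=
  (q.1 + k * r.1, q.2.1 + k * r.2.1, q.2.2.1 + k * r.2.2.1, q.2.2.2 + k * r.2.2.2)

/-- The negative of `q`. -/
def neg (q : Quad) : Quad := (-q.1, -q.2.1, -q.2.2.1, -q.2.2.2)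

/-- The inner product. -/
def inner (v w : Quad) : ℤ :=
  4 * v.1 * w.1 - 2 * v.1 * w.2.1 - 2 * v.2.1 * w.1 + 4 * v.2.1 * w.2.1 - 2 * v.2.1 * w.2.2.1
      - 2 * v.2.2.1 * w.2.1 + 2 * v.2.2.1 * w.2.2.1 - v.2.2.1 * w.2.2.2 - v.2.2.2 * w.2.2.1
      + 2 * v.2.2.2 * w.2.2.2

/-- Whether `q` is a root. -/
def isRoot (q : Quad) : Bool :=
  match q.1 * q.1 + (q.1 - q.2.1) * (q.1 - q.2.1) + (q.2.1 - q.2.2.1) * (q.2.1 - q.2.2.1)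
      + q.2.2.2 * (q.2.2.2 - q.2.2.1) with
  | Int.ofNat n => Nat.beq n 1 || Nat.beq n 2
  | Int.negSucc _ => false

theorem toLat_injective : Function.Injective toLat := by
  rintro ⟨a, b, c, d⟩ ⟨a', b', c', d'⟩ h
  have h0 := congrFun h 0
  have h1 := congrFun h 1
  have h2 := congrFun h 2
  have h3 := congrFun h 3
  simp [toLat] at h0 h1 h2 h3
  simp [h0, h1, h2, h3]

theorem toLat_self (v : Lat) : toLat (v 0, v 1, v 2, v 3) = v := by
  funext i
  fin_cases i <;> rfl

theorem toLat_addMul (q r : Quad) (k : ℤ) : toLat (addMul q r k) = toLat q + k • toLat r := by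
  funext i
  fin_cases i <;> simp [toLat, addMul]

theorem toLat_neg (q : Quad) : toLat (neg q) = -toLat q := by
  funext i
  fin_cases i <;> simp [toLat, neg]

theorem inner_eq (v w : Quad) : inner v w = ip (toLat v) (toLat w) := by
  simp [ip_eq, toLat, inner]

theorem isRoot_eq (q : Quad) : isRoot q = true ↔ IsRoot (toLat q) := by
  have h : inner q q = 2 * (q.1 * q.1 + (q.1 - q.2.1) * (q.1 - q.2.1)
      + (q.2.1 - q.2.2.1) * (q.2.1 - q.2.2.1) + q.2.2.2 * (q.2.2.2 - q.2.2.1)) := by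
    rw [inner]
    ring
  rw [isRoot, IsRoot, ← inner_eq, h]
  split
  · next n hn =>
    rw [hn, Bool.or_eq_true, Nat.beq_eq, Nat.beq_eq, Int.ofNat_eq_natCast]
    omega
  · next n hn =>
    rw [hn]
    simp only [Bool.false_eq_true, false_iff]
    omega

end Quad

open Quad

/-- The positive roots; root `2 k + 1` is the image of root `2 k` under the symmetry `bar`. -/
def posQuads : List Quad :=
  [(0, 0, 0, 1), (1, 0, 0, 0), (0, 0, 1, 0), (0, 1, 0, 0), (0, 0, 1, 1), (1, 1, 0, 0),
    (0, 1, 1, 0), (0, 1, 2, 0), (0, 1, 1, 1), (1, 1, 2, 0), (1, 1, 1, 0), (0, 1, 2, 2),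
    (0, 1, 2, 1), (1, 2, 2, 0), (1, 1, 1, 1), (1, 1, 2, 2), (1, 1, 2, 1), (1, 2, 2, 2),
    (1, 2, 2, 1), (1, 2, 4, 2), (1, 2, 3, 1), (1, 3, 4, 2), (1, 2, 3, 2), (2, 3, 4, 2)]

/-- The roots: the positive roots, and their negatives in the same order. -/
def rootQuads : List Quad := posQuads ++ posQuads.map neg

/-- Root number `i`. -/
def quad (i : ℕ) : Quad := rootQuads.getD i (0, 0, 0, 0)

theorem isRoot_quad : ∀ i < 48, isRoot (quad i) = true := by decide +kernel

theorem quad_injOn : ∀ i < 48, ∀ j < 48, quad i = quad j → i = j := by decide +kernel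

/-- The box is |v 0| ≤ 3, |v 1| ≤ 4, |v 2| ≤ 5, |v 3| ≤ 2. It contains all vectors of squared length
at most 4, so the list of 48 roots is complete. -/
theorem mem_rootQuads_of_box : ∀ a < 7, ∀ b < 9, ∀ c < 11, ∀ d < 5,
    (!isRoot (Int.subNatNat a 3, Int.subNatNat b 4, Int.subNatNat c 5, Int.subNatNat d 2) ||
      decide ((Int.subNatNat a 3, Int.subNatNat b 4, Int.subNatNat c 5, Int.subNatNat d 2) ∈
        rootQuads)) = true := by
  decide +kernel

theorem exists_quad {v : Lat} (hv : IsRoot v) : ∃ i < 48, toLat (quad i) = v := by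
  have h4 : ip v v ≤ 4 := by rcases hv with h | h <;> omega
  rw [ip_eq] at h4
  -- The left side is 6 · `ip v v` with completed squares. Each square is then bounded, and the
  -- coordinates are bounded in the order `v 3`, `v 2`, `v 1`, `v 0`.
  have key : 6 * (2 * v 0 - v 1) ^ 2 + 2 * (3 * v 1 - 2 * v 2) ^ 2
      + (2 * v 2 - 3 * v 3) ^ 2 + 3 * v 3 ^ 2 ≤ 24 := by nlinarith
  have k0 := sq_nonneg (2 * v 0 - v 1)
  have k1 := sq_nonneg (3 * v 1 - 2 * v 2)
  have k2 := sq_nonneg (2 * v 2 - 3 * v 3)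
  have k3 := sq_nonneg (v 3)
  obtain ⟨a3, b3⟩ := abs_lt_of_sq_lt_sq' (a := v 3) (b := 3) (by omega) (by norm_num)
  obtain ⟨a2, b2⟩ := abs_lt_of_sq_lt_sq' (a := 2 * v 2 - 3 * v 3) (b := 5) (by omega) (by norm_num)
  obtain ⟨a1, b1⟩ := abs_lt_of_sq_lt_sq' (a := 3 * v 1 - 2 * v 2) (b := 4) (by omega) (by norm_num)
  obtain ⟨a0, b0⟩ := abs_lt_of_sq_lt_sq' (a := 2 * v 0 - v 1) (b := 3) (by omega) (by norm_num)
  have hmem : (v 0, v 1, v 2, v 3) ∈ rootQuads := by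
    have := mem_rootQuads_of_box (v 0 + (3 : ℕ)).toNat (by omega) (v 1 + (4 : ℕ)).toNat (by omega)
      (v 2 + (5 : ℕ)).toNat (by omega) (v 3 + (2 : ℕ)).toNat (by omega)
    have h0 : ∀ (z : ℤ) (n : ℕ), 0 ≤ z + n → Int.subNatNat (z + n).toNat n = z := fun z n hz => by
      rw [Int.subNatNat_eq_coe, Int.toNat_of_nonneg hz, add_sub_cancel_right]
    rw [h0 _ 3 (by push_cast; omega), h0 _ 4 (by push_cast; omega), h0 _ 5 (by push_cast; omega),
      h0 _ 2 (by push_cast; omega)] at this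
    rw [(isRoot_eq _).2 (by rwa [toLat_self])] at this
    simpa using this
  obtain ⟨i, hi, h⟩ := List.getElem_of_mem hmem
  refine ⟨i, hi, ?_⟩
  rw [quad, List.getD_eq_getElem _ _ hi, h, toLat_self]

/-- Root number `i`, as an element of the root system. -/
def root (i : Fin 48) : Root := ⟨toLat (quad i), (isRoot_eq _).1 (isRoot_quad i i.2)⟩

theorem root_bijective : Function.Bijective root := by
  refine ⟨fun i j h => ?_, fun r => ?_⟩
  · exact Fin.ext (quad_injOn i i.2 j j.2 (toLat_injective (congrArg Subtype.val h)))
  · obtain ⟨i, hi, h⟩ := exists_quad r.2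
    exact ⟨⟨i, hi⟩, Subtype.ext h⟩

/-- The Chevalley basis, in the order `e_r` (`48` vectors), `hᵢ` (`4` vectors). -/
noncomputable def basis : Module.Basis (Fin 52) (ZMod 2) LieF4 :=
  Finsupp.basisSingleOne.reindex ((Equiv.sumComm _ _).trans
    (((Equiv.ofBijective root root_bijective).symm.sumCongr (Equiv.refl _)).trans finSumFinEquiv))

theorem basis_castAdd (i : Fin 48) : basis (Fin.castAdd 4 i) = e (toLat (quad i)) := by
  have : IsRoot (toLat (quad i)) := (root i).2
  rw [e, dif_pos this]
  simp only [basis, Module.Basis.reindex_apply, Finsupp.coe_basisSingleOne, Equiv.symm_trans_apply]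
  rw [finSumFinEquiv_symm_apply_castAdd]
  rfl

theorem basis_natAdd (i : Fin 4) : basis (Fin.natAdd 48 i) = h i := by
  rw [h]
  simp only [basis, Module.Basis.reindex_apply, Finsupp.coe_basisSingleOne, Equiv.symm_trans_apply]
  rw [finSumFinEquiv_symm_apply_natAdd]
  rfl

/-- A number which determines a root. -/
def key (q : Quad) : ℕ :=
  (q.1 + 4).toNat + 16 * ((q.2.1 + 4).toNat + 16 * ((q.2.2.1 + 4).toNat + 16 * (q.2.2.2 + 4).toNat))

/-- `2 ^ i` if `n` is entry `i` of the list, and `0` if it is not in the list. -/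
def lookup (n : ℕ) : List ℕ → ℕ
  | [] => 0
  | m :: l => bif Nat.beq n m then 1 else Nat.mul 2 (lookup n l)

/-- The keys of the roots. -/
def keys : List ℕ :=
  [21572, 17477, 17732, 17492, 21828, 17493, 17748, 18004, 21844, 18005, 17749, 26196, 22100,
    18021, 21845, 26197, 22101, 26213, 22117, 26725, 22373, 26741, 26469, 26742, 13380, 17475,
    17220, 17460, 13124, 17459, 17204, 16948, 13108, 16947, 17203, 8756, 12852, 16931, 13107,
    8755, 12851, 8739, 12835, 8227, 12579, 8211, 8483, 8210]

/-- The code of `e_q`. -/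
def eCode (q : Quad) : ℕ := bif isRoot q then force (key q) fun n => lookup n keys else 0

theorem eCode_quad : ∀ i < 48, eCode (quad i) = 2 ^ i := by decide +kernel

theorem vec_eCode (q : Quad) : vec basis (eCode q) = e (toLat q) := by
  by_cases hq : IsRoot (toLat q)
  · obtain ⟨i, hi, h⟩ := exists_quad hq
    rw [← h, ← toLat_injective h, eCode_quad i hi, ← basis_castAdd ⟨i, hi⟩, ← vec_two_pow]
    rfl
  · rw [eCode, Bool.eq_false_of_not_eq_true (mt (isRoot_eq q).1 hq), cond_false, vec_zero, e_of_not hq]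

/-- The code of `hᵢ`. -/
def hCode (i : ℕ) : ℕ := 2 ^ (48 + i)

theorem vec_hCode (i : Fin 4) : vec basis (hCode i) = h i := by
  rw [← basis_natAdd, ← vec_two_pow]
  rfl

/-- `n` if `c` is odd, and `0` otherwise. -/
def smulCode (c : ℤ) (n : ℕ) : ℕ := if c % 2 = 0 then 0 else n

theorem vec_smulCode (c : ℤ) (n : ℕ) : vec basis (smulCode c n) = (c : ZMod 2) • vec basis n := by
  rw [smulCode]
  split_ifs with h
  · rw [(ZMod.intCast_zmod_eq_zero_iff_dvd c 2).2 (by exact_mod_cast Int.dvd_of_emod_eq_zero h),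
      zero_smul, vec_zero]
  · have h1 : ((c - 1 : ℤ) : ZMod 2) = 0 :=
      (ZMod.intCast_zmod_eq_zero_iff_dvd _ 2).2 (by push_cast; omega)
    have : (c : ZMod 2) = 1 := by
      push_cast at h1
      exact sub_eq_zero.1 h1
    rw [this, one_smul]

/-- The simple root `pᵢ`. -/
def simpleQuad : ℕ → Quad
  | 0 => (1, 0, 0, 0)
  | 1 => (0, 1, 0, 0)
  | 2 => (0, 0, 1, 0)
  | _ => (0, 0, 0, 1)

theorem toLat_simpleQuad (i : Fin 4) : toLat (simpleQuad i) = simple i := by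
  funext j
  fin_cases i <;> fin_cases j <;> rfl

/-- The code of the image of `hᵢ` under `x_r(1)`. -/
def hColumn (r : Quad) (i : ℕ) : ℕ :=
  hCode i ^^^ smulCode (2 * inner (simpleQuad i) r / inner (simpleQuad i) (simpleQuad i)) (eCode r)

theorem sub_eq_add (v w : LieF4) : v - w = v + w := ZModModule.sub_eq_add v w

theorem vec_hColumn (r : Quad) (i : Fin 4) : vec basis (hColumn r i) = xMap (toLat r) (h i) := by
  rw [hColumn, vec_xor, vec_hCode, vec_smulCode, vec_eCode, xMap_h, sub_eq_add, cartan, inner_eq,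
    inner_eq, toLat_simpleQuad]

/-- The code of the coroot of `r`. -/
def corootCode (r : Quad) : ℕ :=
  let c (i : ℕ) (n : ℤ) := smulCode (n * inner (simpleQuad i) (simpleQuad i) / inner r r) (hCode i)
  c 0 r.1 ^^^ c 1 r.2.1 ^^^ c 2 r.2.2.1 ^^^ c 3 r.2.2.2

theorem vec_corootCode (r : Quad) : vec basis (corootCode r) = coroot (toLat r) := by
  simp only [corootCode, vec_xor, vec_smulCode, coroot, Fin.sum_univ_four, inner_eq]
  have h0 := vec_hCode 0
  have h1 := vec_hCode 1
  have h2 := vec_hCode 2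
  have h3 := vec_hCode 3
  have t0 := toLat_simpleQuad 0
  have t1 := toLat_simpleQuad 1
  have t2 := toLat_simpleQuad 2
  have t3 := toLat_simpleQuad 3
  simp only [Fin.val_zero, Fin.val_one, Fin.val_two, show ((3 : Fin 4) : ℕ) = 3 from rfl] at *
  rw [h0, h1, h2, h3, t0, t1, t2, t3]
  rfl

/-- The code of the image of `e_s` under `x_r(1)`. -/
def eColumn (r s : Quad) : ℕ :=
  if s = r then eCode r
  else if s = neg r then eCode s ^^^ corootCode r ^^^ eCode r
  else force (if isRoot (addMul s r (-2)) then 2 else if isRoot (addMul s r (-1)) then 1 else 0)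
    fun d => smulCode (Nat.choose d 0) (eCode s) ^^^
      smulCode (Nat.choose (d + 1) 1) (eCode (addMul s r 1)) ^^^
      smulCode (Nat.choose (d + 2) 2) (eCode (addMul s r 2))

/-- The three cases follow the three formulas for `xMap`. Modulo two subtraction is addition, hence
xor of codes, and only the parity of a binomial coefficient matters. -/
theorem vec_eColumn {r s : Quad} (hr : isRoot r = true) (hs : isRoot s = true) :
    vec basis (eColumn r s) = xMap (toLat r) (e (toLat s)) := by
  rw [isRoot_eq] at hr hs
  rw [eColumn, force_eq]
  by_cases h1 : s = r
  · rw [if_pos h1, h1, vec_eCode, xMap_e_self hr]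
  rw [if_neg h1]
  by_cases h2 : s = neg r
  · rw [if_pos h2, vec_xor, vec_xor, vec_eCode, vec_eCode, vec_corootCode, h2, toLat_neg, xMap_e_neg hr,
      sub_eq_add]
  · rw [if_neg h2]
    have e2 : toLat s - 2 • toLat r = toLat (addMul s r (-2)) := by
      rw [toLat_addMul]; module
    have e3 : toLat s - toLat r = toLat (addMul s r (-1)) := by
      rw [toLat_addMul]; module
    have hd : down (toLat r) (toLat s) =
        if isRoot (addMul s r (-2)) then 2 else if isRoot (addMul s r (-1)) then 1 else 0 := by
      simp only [down, e2, e3, ← isRoot_eq]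
    rw [xMap_e hs (fun h => h1 (toLat_injective h))
      (fun h => h2 (toLat_injective (h.trans (toLat_neg r).symm))), hd]
    generalize (if isRoot (addMul s r (-2)) = true then 2
      else if isRoot (addMul s r (-1)) = true then 1 else 0) = d
    simp only [vec_xor, vec_smulCode, vec_eCode, Finset.sum_range_succ, Finset.sum_range_zero,
      zero_add, toLat_addMul, Int.cast_natCast, add_zero, zero_smul, one_smul]
    simp

theorem eCode_lt (q : Quad) : eCode q < 2 ^ 52 := by
  by_cases hq : IsRoot (toLat q)
  · obtain ⟨i, hi, h⟩ := exists_quad hq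
    rw [← toLat_injective h, eCode_quad i hi]
    exact Nat.pow_lt_pow_right (by norm_num) (by omega)
  · rw [eCode, Bool.eq_false_of_not_eq_true (mt (isRoot_eq q).1 hq), cond_false]
    positivity

theorem smulCode_lt {n : ℕ} (c : ℤ) (hn : n < 2 ^ 52) : smulCode c n < 2 ^ 52 := by
  rw [smulCode]
  split_ifs
  · positivity
  · exact hn

theorem hCode_lt {i : ℕ} (hi : i < 4) : hCode i < 2 ^ 52 :=
  Nat.pow_lt_pow_right (by norm_num) (by omega)

theorem hColumn_lt (r : Quad) {i : ℕ} (hi : i < 4) : hColumn r i < 2 ^ 52 :=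
  Nat.xor_lt_two_pow (hCode_lt hi) (smulCode_lt _ (eCode_lt r))

theorem corootCode_lt (r : Quad) : corootCode r < 2 ^ 52 :=
  Nat.xor_lt_two_pow (Nat.xor_lt_two_pow (Nat.xor_lt_two_pow (smulCode_lt _ (hCode_lt (by norm_num)))
    (smulCode_lt _ (hCode_lt (by norm_num)))) (smulCode_lt _ (hCode_lt (by norm_num))))
    (smulCode_lt _ (hCode_lt (by norm_num)))

theorem eColumn_lt (r s : Quad) : eColumn r s < 2 ^ 52 := by
  rw [eColumn, force_eq]
  by_cases h1 : s = r
  · rw [if_pos h1]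
    exact eCode_lt r
  rw [if_neg h1]
  by_cases h2 : s = neg r
  · rw [if_pos h2]
    exact Nat.xor_lt_two_pow (Nat.xor_lt_two_pow (eCode_lt s) (corootCode_lt r)) (eCode_lt r)
  · rw [if_neg h2]
    exact Nat.xor_lt_two_pow (Nat.xor_lt_two_pow (smulCode_lt _ (eCode_lt _))
      (smulCode_lt _ (eCode_lt _))) (smulCode_lt _ (eCode_lt _))

/-- The matrix with the given columns. -/
def ofColumns : List ℕ → ℕ
  | [] => 0
  | c :: l => c + 2 ^ 52 * ofColumns l

theorem col_ofColumns : ∀ (l : List ℕ), (∀ c ∈ l, c < 2 ^ 52) → ∀ j, col (ofColumns l) j = l.getD j 0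
  | [], _, j => by simp [ofColumns, col_eq]
  | c :: l, hl, j => by
    have hc : c < 2 ^ 52 := hl c (by simp)
    cases j with
    | zero => rw [ofColumns, col_eq, Nat.mul_zero, Nat.shiftRight_zero, Nat.add_mul_mod_self_left,
        Nat.mod_eq_of_lt hc, List.getD_cons_zero]
    | succ j =>
      have ih := col_ofColumns l (fun c hc => hl c (by simp [hc])) j
      rw [List.getD_cons_succ, ← ih, col_eq, col_eq, ofColumns, Nat.mul_add, mul_one,
        Nat.add_comm (52 * j), Nat.shiftRight_add, Nat.shiftRight_eq_div_pow _ 52,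
        Nat.add_mul_div_left _ _ (by norm_num), Nat.div_eq_of_lt hc, zero_add]

theorem ofColumns_lt : ∀ (l : List ℕ), (∀ c ∈ l, c < 2 ^ 52) → ofColumns l < 2 ^ (52 * l.length)
  | [], _ => by simp [ofColumns]
  | c :: l, hl => by
    have hc : c < 2 ^ 52 := hl c (by simp)
    have ih := ofColumns_lt l fun c hc => hl c (by simp [hc])
    rw [ofColumns, List.length_cons, Nat.mul_add, pow_add, mul_one, Nat.mul_comm (2 ^ (52 * _))]
    calc c + 2 ^ 52 * ofColumns l < 2 ^ 52 + 2 ^ 52 * ofColumns l := by omega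
      _ = 2 ^ 52 * (ofColumns l + 1) := by ring
      _ ≤ _ := Nat.mul_le_mul_left _ ih

/-- The code of `x_r(1)`. -/
def xCode (r : Quad) : ℕ :=
  ofColumns (rootQuads.map (eColumn r) ++ (List.range 4).map (hColumn r))

theorem xCode_columns_lt (r : Quad) :
    ∀ c ∈ rootQuads.map (eColumn r) ++ (List.range 4).map (hColumn r), c < 2 ^ 52 := by
  intro c hc
  rw [List.mem_append, List.mem_map, List.mem_map] at hc
  rcases hc with ⟨s, -, rfl⟩ | ⟨i, hi, rfl⟩
  · exact eColumn_lt r s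
  · exact hColumn_lt r (List.mem_range.1 hi)

/-- The root element of root number `i`. -/
noncomputable def X (i : ℕ) : LieF4 ≃ₗ[ZMod 2] LieF4 :=
  if hi : i < 48 then x (root ⟨i, hi⟩) else 1

/-- Both sides are compared on the basis: the first 48 columns are the images of the root vectors,
the last 4 those of the `hᵢ`. -/
theorem codes_X {i : ℕ} (hi : i < 48) : Codes basis (X i) (xCode (quad i)) := by
  have hlen : rootQuads.length = 48 := rfl
  refine ⟨basis.ext fun j => ?_, ?_⟩
  · rw [lin_basis, xCode, col_ofColumns _ (xCode_columns_lt _), X, dif_pos hi]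
    change xMap (toLat (quad i)) (basis j) = _
    induction j using Fin.addCases (m := 48) (n := 4) with
    | left j =>
      rw [basis_castAdd, Fin.val_castAdd, List.getD_append _ _ _ _ (by simp [hlen]),
        List.getD_eq_getElem _ _ (by simp [hlen]), List.getElem_map,
        vec_eColumn (isRoot_quad i hi)]
      · congr 2
        rw [quad, List.getD_eq_getElem]
      · rw [← List.getD_eq_getElem rootQuads (0, 0, 0, 0)]
        exact isRoot_quad j j.2
    | right j =>
      rw [basis_natAdd, Fin.val_natAdd, List.getD_append_right _ _ _ _ (by simp [hlen]),
        List.length_map, hlen, Nat.add_sub_cancel_left,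
        List.getD_eq_getElem _ _ (by simp), List.getElem_map, List.getElem_range,
        vec_hColumn]
  · exact ofColumns_lt _ (xCode_columns_lt _)

/-- Forces the evaluation of the entries of a list before it is passed on. -/
def forceList {α : Sort*} : List ℕ → (List ℕ → α) → α
  | [], k => k []
  | a :: l, k => force a fun a => forceList l fun l => k (a :: l)

theorem forceList_eq {α : Sort*} : ∀ (l : List ℕ) (k : List ℕ → α), forceList l k = k l
  | [], _ => rfl
  | a :: l, k => by rw [forceList, force_eq, forceList_eq]

/-- The codes of the root elements. -/
def xCodes : List ℕ := rootQuads.map xCode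

end F4

open Subgroup

namespace WordGroup

/-! ### Words, and groups with a polycyclic sequence of generators -/

variable {G H : Type*} [Group G] [Group H]

/-- The product of the letters `a i` for the entries `i` of the list. -/
def ev (a : ℕ → G) (w : List ℕ) : G := (w.map a).prod

@[simp] theorem ev_nil (a : ℕ → G) : ev a [] = 1 := rfl

@[simp] theorem ev_cons (a : ℕ → G) (i : ℕ) (w : List ℕ) : ev a (i :: w) = a i * ev a w := by
  simp [ev]

theorem ev_append (a : ℕ → G) (v w : List ℕ) : ev a (v ++ w) = ev a v * ev a w := by simp [ev]

theorem ev_mem {a : ℕ → G} {K : Subgroup G} {w : List ℕ} (h : ∀ i ∈ w, a i ∈ K) : ev a w ∈ K := by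
  refine list_prod_mem fun g hg => ?_
  obtain ⟨i, hi, rfl⟩ := List.mem_map.1 hg
  exact h i hi

theorem map_ev (f : G →* H) (a : ℕ → G) (w : List ℕ) : f (ev a w) = ev (fun i => f (a i)) w := by
  simp [ev, map_list_prod, Function.comp_def]

/-- The subgroup generated by the letters `a i` with `k ≤ i < n`. -/
def tail (a : ℕ → G) (n k : ℕ) : Subgroup G := closure (a '' Set.Ico k n)

theorem mem_tail {a : ℕ → G} {n k i : ℕ} (h1 : k ≤ i) (h2 : i < n) : a i ∈ tail a n k :=
  subset_closure ⟨i, ⟨h1, h2⟩, rfl⟩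

theorem tail_le {a : ℕ → G} {n k : ℕ} {K : Subgroup G} (h : ∀ i, k ≤ i → i < n → a i ∈ K) :
    tail a n k ≤ K := by
  rw [tail, closure_le]
  rintro _ ⟨i, ⟨h1, h2⟩, rfl⟩
  exact h i h1 h2

theorem tail_anti {a : ℕ → G} {n k l : ℕ} (h : k ≤ l) : tail a n l ≤ tail a n k :=
  tail_le fun _ h1 h2 => mem_tail (h.trans h1) h2

theorem tail_self (a : ℕ → G) (n : ℕ) : tail a n n = ⊥ := by simp [tail]

theorem ev_mem_tail {a : ℕ → G} {n k : ℕ} {w : List ℕ} (h : ∀ i ∈ w, k ≤ i ∧ i < n) :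
    ev a w ∈ tail a n k :=
  ev_mem fun i hi => mem_tail (h i hi).1 (h i hi).2

theorem map_tail (f : G →* H) (a : ℕ → G) (n k : ℕ) :
    (tail a n k).map f = tail (fun i => f (a i)) n k := by
  rw [tail, MonoidHom.map_closure, tail, Set.image_image]

/-- The basic step of collection in a polycyclic group. Only conjugation by `g`, not by `g⁻¹`, is
assumed to preserve the subgroup; since `g ^ p` lies in it, `g⁻¹` can be traded for `g ^ (p - 1)`.
-/
theorem exists_mul_pow_of_mem_closure_insert {s : Set G} {g : G} {p : ℕ} (hp : 0 < p)
    (hg : g ^ p ∈ closure s) (hs : ∀ h ∈ s, g * h * g⁻¹ ∈ closure s) {x : G}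
    (hx : x ∈ closure (insert g s)) : ∃ h ∈ closure s, ∃ k < p, x = h * g ^ k := by
  have conj1 : ∀ h ∈ closure s, g * h * g⁻¹ ∈ closure s := by
    have : closure s ≤ (closure s).comap (MulAut.conj g).toMonoidHom := by
      rw [closure_le]
      intro h hh
      simpa using hs h hh
    intro h hh
    simpa using this hh
  have conjn : ∀ n : ℕ, ∀ h ∈ closure s, g ^ n * h * (g ^ n)⁻¹ ∈ closure s := by
    intro n
    induction n with
    | zero => simp
    | succ n ih =>
      intro h hh
      have := conj1 _ (ih h hh)
      rw [pow_succ']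
      convert this using 1
      group
  have key : ∃ h ∈ closure s, ∃ k : ℕ, x = h * g ^ k := by
    induction hx using closure_induction_left with
    | one => exact ⟨1, one_mem _, 0, by simp⟩
    | mul_left y hy z _ ih =>
      obtain ⟨h, hh, k, rfl⟩ := ih
      rcases hy with rfl | hy
      · refine ⟨y * h * y⁻¹, conj1 h hh, k + 1, ?_⟩
        rw [pow_succ']
        group
      · exact ⟨y * h, mul_mem (subset_closure hy) hh, k, by rw [mul_assoc]⟩
    | inv_mul_cancel y hy z _ ih =>
      obtain ⟨h, hh, k, rfl⟩ := ih
      rcases hy with rfl | hy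
      -- Here y⁻¹ is rewritten as (y ^ p)⁻¹ · y ^ (p - 1).
      · refine ⟨(y ^ p)⁻¹ * (y ^ (p - 1) * h * (y ^ (p - 1))⁻¹), mul_mem (inv_mem hg)
          (conjn _ h hh), (p - 1) + k, ?_⟩
        obtain ⟨q, rfl⟩ := Nat.exists_eq_succ_of_ne_zero hp.ne'
        simp only [Nat.succ_sub_one, Nat.succ_eq_add_one, pow_add, pow_one]
        group
      · exact ⟨y⁻¹ * h, mul_mem (inv_mem (subset_closure hy)) hh, k, by rw [mul_assoc]⟩
  obtain ⟨h, hh, k, rfl⟩ := key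
  refine ⟨h * (g ^ p) ^ (k / p), mul_mem hh (pow_mem hg _), k % p, Nat.mod_lt _ hp, ?_⟩
  rw [mul_assoc, ← pow_mul, ← pow_add, Nat.div_add_mod]

/-- Each letter `a i`, `i < n`, normalizes the group generated by the later letters, and its power
with exponent `p i` is in this group. -/
structure IsPolycyclic (a : ℕ → G) (n : ℕ) (p : ℕ → ℕ) : Prop where
  pos : ∀ i < n, 0 < p i
  pow_mem_tail : ∀ i < n, a i ^ p i ∈ tail a n (i + 1)
  conj_mem_tail : ∀ i j, i < j → j < n → a i * a j * (a i)⁻¹ ∈ tail a n (i + 1)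

theorem tail_eq_insert (a : ℕ → G) {n k : ℕ} (hk : k < n) :
    tail a n k = closure (insert (a k) (a '' Set.Ico (k + 1) n)) := by
  have : Set.Ico k n = insert k (Set.Ico (k + 1) n) := by
    ext i
    simp only [Set.mem_Ico, Set.mem_insert_iff]
    omega
  rw [tail, this, Set.image_insert_eq]

namespace IsPolycyclic

variable {a : ℕ → G} {n : ℕ} {p : ℕ → ℕ}

theorem exists_mul_pow (h : IsPolycyclic a n p) {k : ℕ} (hk : k < n) {x : G} (hx : x ∈ tail a n k) :
    ∃ y ∈ tail a n (k + 1), ∃ e < p k, x = y * a k ^ e := by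
  rw [tail_eq_insert a hk] at hx
  refine exists_mul_pow_of_mem_closure_insert (h.pos k hk) (h.pow_mem_tail k hk) ?_ hx
  rintro _ ⟨j, ⟨h1, h2⟩, rfl⟩
  exact h.conj_mem_tail k j h1 h2

theorem tail_subset (h : IsPolycyclic a n p) {k : ℕ} (hk : k < n) : (tail a n k : Set G) ⊆
    (fun q : tail a n (k + 1) × Fin (p k) => (q.1 : G) * a k ^ (q.2 : ℕ)) '' Set.univ := by
  intro x hx
  obtain ⟨y, hy, e, he, rfl⟩ := h.exists_mul_pow hk hx
  exact ⟨(⟨y, hy⟩, ⟨e, he⟩), trivial, rfl⟩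

theorem finite (h : IsPolycyclic a n p) {k : ℕ} (hk : k ≤ n) : Finite (tail a n k) := by
  induction hk using Nat.decreasingInduction with
  | self =>
    rw [tail_self]
    infer_instance
  | of_succ k hk ih => exact (Set.toFinite _).subset (h.tail_subset hk)

theorem card_le (h : IsPolycyclic a n p) {k : ℕ} (hk : k ≤ n) : Nat.card (tail a n k) ≤ ∏ i ∈ Finset.Ico k n, p i := by
  induction hk using Nat.decreasingInduction with
  | self => simp [tail_self]
  | of_succ k hk ih =>
    have := h.finite (show k + 1 ≤ n from hk)
    have h1 := Set.ncard_le_ncard (h.tail_subset hk) (Set.toFinite _)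
    have h2 := h1.trans (Set.ncard_image_le (Set.toFinite _))
    rw [Set.ncard_univ, Nat.card_prod, Nat.card_eq_fintype_card (α := Fin _), Fintype.card_fin] at h2
    rw [Finset.prod_eq_prod_Ico_succ_bot hk, mul_comm]
    exact h2.trans (Nat.mul_le_mul_right _ ih)

/-- If `a k ^ e` with 0 < e < p were in the next tail, then so would be `a k`, by Bézout's identity
for e and the prime p. Thus the normal forms y · a_k ^ e are pairwise distinct and the upper bound
is attained. -/
theorem card_eq (h : IsPolycyclic a n p) (hp : ∀ i < n, (p i).Prime) (ha : ∀ i < n, a i ∉ tail a n (i + 1)) {k : ℕ}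
    (hk : k ≤ n) : Nat.card (tail a n k) = ∏ i ∈ Finset.Ico k n, p i := by
  induction hk using Nat.decreasingInduction with
  | self => simp [tail_self]
  | of_succ k hk ih =>
    refine le_antisymm (h.card_le hk.le) ?_
    have fin := h.finite hk.le
    have key : ∀ e : ℕ, 0 < e → e < p k → a k ^ e ∉ tail a n (k + 1) := by
      intro e e1 e2 he
      have hc : Nat.Coprime e (p k) :=
        ((hp k hk).coprime_iff_not_dvd.2 fun hd => absurd (Nat.le_of_dvd e1 hd) (by omega)).symm
      apply ha k hk
      have hb := Nat.gcd_eq_gcd_ab e (p k)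
      rw [Nat.Coprime.gcd_eq_one hc] at hb
      rw [Nat.cast_one] at hb
      rw [← zpow_one (a k), hb, zpow_add, zpow_mul, zpow_mul, zpow_natCast,
        zpow_natCast]
      exact mul_mem (zpow_mem he _) (zpow_mem (h.pow_mem_tail k hk) _)
    have inj : Function.Injective (fun q : tail a n (k + 1) × Fin (p k) =>
        (⟨(q.1 : G) * a k ^ (q.2 : ℕ), mul_mem (tail_anti (Nat.le_succ k) q.1.2)
          (pow_mem (mem_tail le_rfl hk) _)⟩ : tail a n k)) := by
      have wlog_aux : ∀ (y z : tail a n (k + 1)) (d e : ℕ), d ≤ e → e < p k →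
          (y : G) * a k ^ d = z * a k ^ e → d = e := by
        intro y z d e hde he hyz
        by_contra hne
        refine key (e - d) (by omega) (by omega) ?_
        have : a k ^ (e - d) = (z : G)⁻¹ * y := by
          rw [pow_sub _ hde, eq_inv_mul_iff_mul_eq, ← mul_assoc, ← hyz]
          group
        rw [this]
        exact mul_mem (inv_mem z.2) y.2
      rintro ⟨y, d⟩ ⟨z, e⟩ hyz
      have hyz' : (y : G) * a k ^ (d : ℕ) = z * a k ^ (e : ℕ) := congrArg Subtype.val hyz
      have hde : (d : ℕ) = e := by
        rcases le_total (d : ℕ) e with hle | hle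
        · exact wlog_aux y z d e hle e.2 hyz'
        · exact (wlog_aux z y e d hle d.2 hyz'.symm).symm
      rw [hde, mul_left_inj] at hyz'
      exact Prod.ext (Subtype.ext hyz') (Fin.ext hde)
    have h2 := Nat.card_le_card_of_injective _ inj
    rw [Nat.card_prod, Nat.card_eq_fintype_card (α := Fin _), Fintype.card_fin, ih] at h2
    rwa [Finset.prod_eq_prod_Ico_succ_bot hk, mul_comm]

end IsPolycyclic

end WordGroup

/-! ### Groups with a split BN-pair of dihedral type of order `16` -/

namespace DihedralBN

variable {G : Type*} [Group G]

/-- The alternating product of length `l` which starts with `n i`. -/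
def word (n : Bool → G) : Bool → ℕ → G
  | _, 0 => 1
  | i, l + 1 => n i * word n (!i) l

/-- A subgroup `U`, factorized in two ways as `A i * H i`, and two involutions `n i` which generate
a dihedral group of order `16` modulo relations in `U`. -/
structure Data (U : Subgroup G) (A H : Bool → Subgroup G) (n : Bool → G) : Prop where
  A_le : ∀ i, A i ≤ U
  H_le : ∀ i, H i ≤ U
  factor : ∀ i, ∀ u ∈ U, ∃ a ∈ A i, ∃ h ∈ H i, u = a * h
  mul_self : ∀ i, n i * n i = 1
  conj_mem : ∀ i, ∀ h ∈ H i, n i * h * n i ∈ H i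
  rank_one : ∀ i, ∀ a ∈ A i, a ≠ 1 → ∃ b ∈ A i, ∃ u ∈ U, n i * a * n i = b * n i * u
  longest : ∀ i, word n i 8 = word n (!i) 8
  word_conj : ∀ i, ∀ l < 8, ∀ a ∈ A i, (word n (!i) l)⁻¹ * a * word n (!i) l ∈ U

/-- The product set `A i * n i * A (!i) * n (!i) * ⋯ * U` with `l` letters `n`. -/
def cell (U : Subgroup G) (A : Bool → Subgroup G) (n : Bool → G) : Bool → ℕ → Set G
  | _, 0 => U
  | i, l + 1 => {x | ∃ a ∈ A i, ∃ d ∈ cell U A n (!i) l, x = a * n i * d}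

namespace Data

variable {U : Subgroup G} {A H : Bool → Subgroup G} {n : Bool → G}

/-- Write u a = b h with b in A_i and h in H_i. As n_i normalizes H_i, the factor h passes to the
right of n_i and is absorbed by the shorter cell. -/
theorem mul_mem_cell (D : Data U A H n) {u : G} (hu : u ∈ U) : ∀ {l : ℕ} {i : Bool} {d : G},
    d ∈ cell U A n i l → u * d ∈ cell U A n i l
  | 0, _, _, hd => mul_mem hu hd
  | l + 1, i, _, ⟨a, ha, d, hd, h0⟩ => by
    obtain ⟨b, hb, h, hh, hbh⟩ := D.factor i (u * a) (mul_mem hu (D.A_le i ha))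
    refine ⟨b, hb, n i * h * n i * d, D.mul_mem_cell (u := n i * h * n i)
      (D.H_le i (D.conj_mem i h hh)) hd, ?_⟩
    have : u * (a * n i * d) = u * a * n i * d := by group
    rw [h0, this, hbh]
    have : b * n i * (n i * h * n i * d) = b * (n i * n i) * h * n i * d := by group
    rw [this, D.mul_self, mul_one]

theorem cell_mul_mem (D : Data U A H n) {u : G} (hu : u ∈ U) : ∀ {l : ℕ} {i : Bool} {d : G},
    d ∈ cell U A n i l → d * u ∈ cell U A n i l
  | 0, _, _, hd => mul_mem hd hu
  | l + 1, i, _, ⟨a, ha, d, hd, h0⟩ =>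
    ⟨a, ha, d * u, D.cell_mul_mem hu hd, by rw [h0, mul_assoc]⟩

theorem word_mem_cell (D : Data U A H n) : ∀ (l : ℕ) (i : Bool), word n i l ∈ cell U A n i l
  | 0, _ => one_mem U
  | l + 1, i => ⟨1, one_mem _, _, D.word_mem_cell l (!i), by rw [one_mul, word]⟩

/-- A cell lies in a double coset U w U. The part of U in H_i moves to the left through n_i; the
part in A_i moves to the right through the remaining word, by `word_conj`. -/
theorem exists_word (D : Data U A H n) : ∀ {l : ℕ} {i : Bool} {d : G}, l ≤ 8 → d ∈ cell U A n i l →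
    ∃ u ∈ U, ∃ v ∈ U, d = u * word n i l * v
  | 0, _, d, _, hd => ⟨d, hd, 1, one_mem U, by simp [word]⟩
  | l + 1, i, _, hl, ⟨a, ha, d, hd, h0⟩ => by
    obtain ⟨u, hu, v, hv, rfl⟩ := D.exists_word (by omega) hd
    -- The inverse is factorized because u is needed as an element of H_i followed by one of A_i.
    obtain ⟨b, hb, h, hh, hbh⟩ := D.factor i u⁻¹ (inv_mem hu)
    have hu' : u = h⁻¹ * b⁻¹ := by rw [← mul_inv_rev, ← hbh, inv_inv]
    refine ⟨a * (n i * h⁻¹ * n i), mul_mem (D.A_le i ha)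
      (D.H_le i (D.conj_mem i _ (inv_mem hh))), _,
      mul_mem (D.word_conj i l (by omega) b⁻¹ (inv_mem hb)) hv, ?_⟩
    rw [h0, hu', word]
    have : a * (n i * h⁻¹ * n i) * (n i * word n (!i) l) *
        ((word n (!i) l)⁻¹ * b⁻¹ * word n (!i) l * v) =
        a * n i * h⁻¹ * (n i * n i) * b⁻¹ * word n (!i) l * v := by group
    rw [this, D.mul_self]
    group

/-- The two alternating words of length 8 are the same longest element w, and either cell of length
8 contains U w U. -/
theorem cell_eight (D : Data U A H n) {i : Bool} {d : G} (hd : d ∈ cell U A n i 8) : d ∈ cell U A n (!i) 8 := by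
  obtain ⟨u, hu, v, hv, rfl⟩ := D.exists_word le_rfl hd
  rw [D.longest]
  exact D.cell_mul_mem hv (D.mul_mem_cell hu (D.word_mem_cell 8 (!i)))

/-- This is the BN-pair axiom in rank one: if a ≠ 1, then n_i a n_i lies in A_i n_i U and the length
is kept; if a = 1, the two letters cancel. -/
theorem letter_mul_mem_same (D : Data U A H n) {i : Bool} {l : ℕ} {d : G} (hd : d ∈ cell U A n i (l + 1)) :
    n i * d ∈ cell U A n i (l + 1) ∨ n i * d ∈ cell U A n (!i) l := by
  obtain ⟨a, ha, d, hd, rfl⟩ := hd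
  by_cases h1 : a = 1
  · right
    rw [h1, one_mul, ← mul_assoc, D.mul_self, one_mul]
    exact hd
  · left
    obtain ⟨b, hb, u, hu, h2⟩ := D.rank_one i a ha h1
    refine ⟨b, hb, u * d, D.mul_mem_cell hu hd, ?_⟩
    rw [← mul_assoc (b * n i), ← h2]
    group

/-- A new letter lengthens the cell, except at length 8, where the cell is first rewritten to begin
with that letter. Hence the union of the cells is stable under left multiplication by the
generators. -/
theorem letter_mul_mem (D : Data U A H n) {i j : Bool} {l : ℕ} (hl : l ≤ 8) {d : G} (hd : d ∈ cell U A n i l) :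
    ∃ i', ∃ l' ≤ 8, n j * d ∈ cell U A n i' l' := by
  rcases l with _ | l
  · exact ⟨j, 1, by norm_num, 1, one_mem _, d, hd, by rw [one_mul]⟩
  · by_cases hj : j = i
    · subst hj
      rcases D.letter_mul_mem_same hd with h | h
      · exact ⟨_, _, hl, h⟩
      · exact ⟨_, _, by omega, h⟩
    · obtain rfl : i = !j := by cases i <;> cases j <;> simp_all
      rcases hl.lt_or_eq with h8 | h8
      · exact ⟨j, l + 2, by omega, 1, one_mem _, d, hd, by rw [one_mul]⟩
      · obtain rfl : l = 7 := by omega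
        have := D.cell_eight hd
        rw [Bool.not_not] at this
        rcases D.letter_mul_mem_same this with h | h
        · exact ⟨_, _, hl, h⟩
        · exact ⟨_, _, by omega, h⟩

theorem exists_mem_cell (D : Data U A H n) {x : G} (hx : x ∈ closure ((U : Set G) ∪ Set.range n)) :
    ∃ i, ∃ l ≤ 8, x ∈ cell U A n i l := by
  induction hx using closure_induction_left with
  | one => exact ⟨true, 0, by norm_num, one_mem U⟩
  | mul_left y hy z _ ih =>
    obtain ⟨i, l, hl, hz⟩ := ih
    rcases hy with hy | ⟨j, rfl⟩
    · exact ⟨i, l, hl, D.mul_mem_cell hy hz⟩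
    · exact D.letter_mul_mem hl hz
  | inv_mul_cancel y hy z _ ih =>
    obtain ⟨i, l, hl, hz⟩ := ih
    rcases hy with hy | ⟨j, rfl⟩
    · exact ⟨i, l, hl, D.mul_mem_cell (inv_mem hy) hz⟩
    · rw [inv_eq_of_mul_eq_one_left (D.mul_self j)]
      exact D.letter_mul_mem hl hz

theorem cell_finite [Finite U] [∀ i, Finite (A i)] : ∀ (l : ℕ) (i : Bool),
    (cell U A n i l).Finite
  | 0, _ => Set.toFinite (U : Set G)
  | l + 1, i => by
    refine ((Set.toFinite (A i : Set G)).image2 (fun a d => a * n i * d)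
      (cell_finite l (!i))).subset ?_
    rintro _ ⟨a, ha, d, hd, rfl⟩
    exact ⟨a, ha, d, hd, rfl⟩

theorem ncard_cell_le [Finite U] [∀ i, Finite (A i)] (l : ℕ) (i : Bool) :
    (cell U A n i (l + 1)).ncard ≤ Nat.card (A i) * (cell U A n (!i) l).ncard := by
  have h1 : cell U A n i (l + 1) ⊆
      (fun q : G × G => q.1 * n i * q.2) '' ((A i : Set G) ×ˢ cell U A n (!i) l) := by
    rintro _ ⟨a, ha, d, hd, rfl⟩
    exact ⟨(a, d), ⟨ha, hd⟩, rfl⟩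
  have fin := (Set.toFinite (A i : Set G)).prod (cell_finite (U := U) (A := A) (n := n) l (!i))
  refine (Set.ncard_le_ncard h1 (fin.image _)).trans ((Set.ncard_image_le fin).trans ?_)
  rw [Set.ncard_prod]
  rfl

theorem card_le (D : Data U A H n) [Finite U] [∀ i, Finite (A i)] (h0 : Nat.card (A false) ≤ 2)
    (h1 : Nat.card (A true) ≤ 4) :
    Finite (closure ((U : Set G) ∪ Set.range n)) ∧
      Nat.card (closure ((U : Set G) ∪ Set.range n)) ≤ 8775 * Nat.card U := by
  -- There are 9 + 7 = 16 cells, one for each element of the dihedral group; those of length 0 and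
  -- of length 8 are counted only once.
  have hsub : (closure ((U : Set G) ∪ Set.range n) : Set G) ⊆
      (⋃ l ∈ Finset.range 9, cell U A n false l) ∪ ⋃ l ∈ Finset.Ico 1 8, cell U A n true l := by
    intro x hx
    obtain ⟨i, l, hl, hx⟩ := D.exists_mem_cell hx
    simp only [Set.mem_union, Set.mem_iUnion, Finset.mem_range, Finset.mem_Ico, exists_prop]
    cases i
    · exact Or.inl ⟨l, by omega, hx⟩
    · by_cases hl0 : l = 0
      · subst hl0
        exact Or.inl ⟨0, by omega, hx⟩
      by_cases hl8 : l = 8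
      · subst hl8
        exact Or.inl ⟨8, by omega, D.cell_eight hx⟩
      · exact Or.inr ⟨l, by omega, hx⟩
  have fin : ((⋃ l ∈ Finset.range 9, cell U A n false l) ∪
      ⋃ l ∈ Finset.Ico 1 8, cell U A n true l).Finite :=
    ((Finset.range 9).finite_toSet.biUnion fun l _ => cell_finite l _).union
      ((Finset.Ico 1 8).finite_toSet.biUnion fun l _ => cell_finite l _)
  refine ⟨fin.subset hsub, ?_⟩
  have z : ∀ i, (cell U A n i 0).ncard = Nat.card U := fun i => rfl
  have f : ∀ l, (cell U A n false (l + 1)).ncard ≤ 2 * (cell U A n true l).ncard := fun l =>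
    (ncard_cell_le l false).trans (Nat.mul_le_mul_right _ h0)
  have t : ∀ l, (cell U A n true (l + 1)).ncard ≤ 4 * (cell U A n false l).ncard := fun l =>
    (ncard_cell_le l true).trans (Nat.mul_le_mul_right _ h1)
  refine (Set.ncard_le_ncard hsub fin).trans ((Set.ncard_union_le _ _).trans ?_)
  have b1 := Finset.set_ncard_biUnion_le (Finset.range 9) (cell U A n false)
  have b2 := Finset.set_ncard_biUnion_le (Finset.Ico 1 8) (cell U A n true)
  refine (add_le_add b1 b2).trans ?_
  simp only [Finset.sum_range_succ, Finset.sum_range_zero, Finset.sum_Ico_eq_sum_range,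
    Nat.reduceSub, Nat.reduceAdd, z]
  have := f 0
  have := f 1
  have := f 2
  have := f 3
  have := f 4
  have := f 5
  have := f 6
  have := f 7
  have := t 0
  have := t 1
  have := t 2
  have := t 3
  have := t 4
  have := t 5
  have := t 6
  simp only [zero_add, Nat.reduceAdd, z] at *
  -- The sums are (1 + 2 + 8 + 16 + 64 + 128 + 512 + 1024 + 4096) + (4 + 8 + 32 + 64 + 256 + 512 +
  -- 2048) = 8775.
  omega

end Data

end DihedralBN

namespace BitMat

open WordGroup

variable {V : Type*} [AddCommGroup V] [Module (ZMod 2) V] {b : Module.Basis (Fin 52) (ZMod 2) V}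

/-! ### Evaluation of words -/

/-- The code of a word in matrices with the given codes. -/
def evCode (cs : List ℕ) (w : List ℕ) : ℕ := w.foldr (fun i m => mul (cs.getD i one) m) one

theorem evCode_nil (cs : List ℕ) : evCode cs [] = one := List.foldr_nil

theorem evCode_cons (cs : List ℕ) (i : ℕ) (w : List ℕ) :
    evCode cs (i :: w) = mul (cs.getD i one) (evCode cs w) := List.foldr_cons ..

variable (b) in
/-- The letters `a i` have the given codes. -/
def CodesAll (a : ℕ → V ≃ₗ[ZMod 2] V) (cs : List ℕ) : Prop := ∀ i, Codes b (a i) (cs.getD i one)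

theorem CodesAll.ev {a : ℕ → V ≃ₗ[ZMod 2] V} {cs : List ℕ} (h : CodesAll b a cs) :
    ∀ w : List ℕ, Codes b (WordGroup.ev a w) (evCode cs w)
  | [] => by
    rw [ev_nil, evCode_nil]
    exact Codes.one
  | i :: w => by
    rw [ev_cons, evCode_cons]
    exact (h i).mul (h.ev w)

theorem CodesAll.ev_eq {a : ℕ → V ≃ₗ[ZMod 2] V} {cs : List ℕ} (h : CodesAll b a cs)
    {v w : List ℕ} (hvw : evCode cs v = evCode cs w) : WordGroup.ev a v = WordGroup.ev a w :=
  ((h.ev v).eq_iff (h.ev w)).2 hvw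

/-- Letters which are words in other letters. -/
def derived {G : Type*} [Group G] (a : ℕ → G) (W : List (List ℕ)) (i : ℕ) : G :=
  WordGroup.ev a (W.getD i [])

theorem CodesAll.derived {a : ℕ → V ≃ₗ[ZMod 2] V} {cs : List ℕ} (h : CodesAll b a cs)
    (W : List (List ℕ)) : CodesAll b (derived a W) (W.map (evCode cs)) := by
  intro i
  have : (W.map (evCode cs)).getD i one = evCode cs (W.getD i []) := by
    rw [← evCode_nil cs, List.getD_map]
  rw [this]
  exact h.ev _

theorem derived_mem {G : Type*} [Group G] {a : ℕ → G} {W : List (List ℕ)} {K : Subgroup G}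
    (h : ∀ i, a i ∈ K) (i : ℕ) : BitMat.derived a W i ∈ K :=
  ev_mem fun j _ => h j

/-- A code `v` of a vector is also the code of the matrix with first column `v` and all other
columns zero, so the matrix product also computes images of vectors. -/
theorem Codes.apply {g : V ≃ₗ[ZMod 2] V} {M : ℕ} (h : Codes b g M) {v : ℕ} (hv : v < 2 ^ 52) :
    g (vec b v) = vec b (col (BitMat.mul M v) 0) := by
  have h0 : ∀ N, vec b (col N 0) = lin b N (b 0) := fun N => (lin_basis b N 0).symm
  rw [h0, lin_mul, LinearMap.comp_apply, ← h0, ← h.1, col_eq, Nat.mul_zero, Nat.shiftRight_zero,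
    Nat.mod_eq_of_lt hv]
  rfl

/-- Change of basis: the matrix of g in the basis P b is that of P⁻¹ g P in the basis b. -/
theorem Codes.map {P g : V ≃ₗ[ZMod 2] V} {M : ℕ} (h : Codes b (P⁻¹ * g * P) M) :
    Codes (b.map P) g M := by
  refine ⟨(b.map P).ext fun j => ?_, h.2⟩
  have h1 : ∀ n, vec (b.map P) n = P (vec b n) := fun n => by
    simp only [vec, map_sum, Module.Basis.map_apply]
    exact Finset.sum_congr rfl fun i _ => by split_ifs <;> simp
  have h2 : P⁻¹ (g (P (b j))) = lin b M (b j) := LinearMap.congr_fun h.1 (b j)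
  rw [lin_basis, h1, Module.Basis.map_apply, ← lin_basis, ← h2]
  exact (P.apply_symm_apply _).symm

end BitMat

/-! ### The symmetry of the root numbers, and the modified basis -/

namespace F4

open BitMat WordGroup Subgroup

theorem codesAll_basis : CodesAll basis X xCodes := by
  intro i
  have hlen : rootQuads.length = 48 := rfl
  by_cases hi : i < 48
  · have := codes_X hi
    rw [xCodes, List.getD_eq_getElem _ _ (by simpa [hlen] using hi), List.getElem_map]
    rwa [quad, List.getD_eq_getElem _ _ (by omega)] at this
  · rw [xCodes, List.getD_eq_default _ _ (by simp [hlen]; omega), X, dif_neg hi]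
    exact Codes.one

/-- The index of the image of a root under `bar`. -/
def swap (i : ℕ) : ℕ := bif Nat.beq (i % 2) 0 then i + 1 else i - 1

/-- The map `bar` for quadruples. -/
def barQuad (q : Quad) : Quad :=
  if q.inner q = 2 then (q.2.2.2, q.2.2.1, 2 * q.2.1, 2 * q.1)
  else (q.2.2.2 / 2, q.2.2.1 / 2, q.2.1, q.1)

theorem toLat_barQuad (q : Quad) : (barQuad q).toLat = barLat q.toLat := by
  rw [barQuad, barLat, ← Quad.inner_eq]
  split_ifs <;> rfl

theorem barQuad_quad : ∀ i < 48, barQuad (quad i) = quad (swap i) := by decide +kernel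

theorem swap_lt : ∀ i < 48, swap i < 48 := by decide

theorem bar_root (i : Fin 48) : bar (root i) = root ⟨swap i, swap_lt i i.2⟩ := by
  apply Subtype.ext
  change barLat (quad i).toLat = (quad (swap i)).toLat
  rw [← toLat_barQuad, barQuad_quad i i.2]

theorem X_mul_self (i : ℕ) : X i * X i = 1 := by
  by_cases hi : i < 48
  · rw [X, dif_pos hi]
    exact LinearEquiv.toLinearMap_injective (xMap_comp (root ⟨i, hi⟩).2)
  · rw [X, dif_neg hi, mul_one]

/-- The matrix of the change of basis from `basis` to `shearedBasis`. -/
def shearCode : ℕ := Nat.xor one 0xea4c1b224c086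

theorem shearCode_lt : shearCode < 2 ^ 2704 := by decide +kernel

theorem mul_shearCode : mul shearCode shearCode = one := by decide +kernel

/-- The linear map with matrix `shearCode`. -/
noncomputable def shear : LieF4 ≃ₗ[ZMod 2] LieF4 :=
  LinearEquiv.ofLinearMap (lin basis shearCode) (lin basis shearCode)
    (by rw [← lin_mul, mul_shearCode, lin_one]) (by rw [← lin_mul, mul_shearCode, lin_one])

theorem codes_shear : Codes basis shear shearCode := ⟨rfl, shearCode_lt⟩

theorem shear_inv : shear⁻¹ = shear := rfl

/-- The Chevalley basis, with the first vector modified: with respect to this basis, the first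
column of a matrix distinguishes all elements of the groups in which we compute. -/
noncomputable def shearedBasis : Module.Basis (Fin 52) (ZMod 2) LieF4 := basis.map shear

/-- The codes of the root elements with respect to `shearedBasis`. -/
def shearedCodes : List ℕ :=
  xCodes.map fun c => mul (mul shearCode c) shearCode

theorem codesAll_X : CodesAll shearedBasis X shearedCodes := by
  intro i
  have h : shearedCodes.getD i one =
      mul (mul shearCode (xCodes.getD i one)) shearCode := by
    -- Beyond the list the default entry is `one`; it has to be fixed by the change of basis for
    -- `List.getD_map` to apply.
    have : one = mul (mul shearCode one) shearCode := by decide +kernel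
    rw [shearedCodes, this, List.getD_map, ← this]
  rw [h]
  apply Codes.map
  rw [shear_inv]
  exact (codes_shear.mul (codesAll_basis i)).mul codes_shear

end F4

namespace F4

open BitMat WordGroup Subgroup

/-! ### The generators of the Ree group -/

/-- The generators of the Ree group as words in the root elements: generators `f k`, `k < 12`, of
the fixed points of the graph automorphism in the positive unipotent subgroup, and two involutions
of the Weyl group. -/
def reeWords : List (List ℕ) :=
  [[0, 1], [2, 3, 6], [4, 5, 14], [6, 7], [8, 9, 20], [10, 11, 22], [12, 13], [14, 15], [16, 17],
    [18, 19], [20, 21], [22, 23], [0, 1, 24, 25, 0, 1],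
    [2, 3, 6, 2, 3, 6, 2, 3, 6, 26, 27, 30, 2, 3, 6, 2, 3, 6]]

/-- The generators of the Ree group. -/
noncomputable def R : ℕ → LieF4 ≃ₗ[ZMod 2] LieF4 := derived X reeWords

/-- The codes of the generators of the Ree group. -/
def reeCodes : List ℕ :=
  [0x8000000000000aa4c1b224c087200000000000210000000000000a0000000000005000000000000200000000000010000000000000800000000000040000000000006200000000000110000000000019a80000000000454000000000020000000000001000000000000188000000000004400000000000280000000000014000000000000800000000000040000000000002800000000000140000000000008000000000000400000010000020000026a4c1b324c087000000080000000000004000000000000a0000000000005000000000000080000000000004000000000000200000000000010000000000000800000000000040000000000062000000000001100000000000088000000000004400000000001820000000000041000000000019a80000000000454000000000000200000000000010000000000002800000000000140000000000002f85de3ea55a96,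
    0x80000000000444000000000000200000000004410000000000880800000000000040000000000002a8000000000015400000000004a00000000000050000000000002800000000000140000000000008000000000000400000000000022220000000001111000000000080000000000004000000000000620000000000011000000040000cc0000cc000004400004400000220000000000011000000200000800000840000040000040000002000000000000100000000000008000000000000400000000000020000000000001000000000000280000000000014000000000004a0000000000005000000000002a80000000000154000000000000200000000000010000000000000800000000000040000000000022000000000001100000000000008000000000000400000000000620000000000011000000000000c80000000000044000000000222240b805f2f33bd,
    0x80000000040104000000004010200000000c03010000000080200882080000000044104000000002000000000000100000000000018200000000000410000000000020808000002ea5c5b624c087c00c03000c0300004010004010000208000000000010400000000000908000000000040400000000002000000000000100000000000008000000000000400000003000020000020c0000100000100000008000002ea4c1b624c08700000020208080000001010404000000080000000000004000000000000200000000000010000000000008800000000000440000000000002000000000000100000000000008000000000000400000000001820000000000041000000000002080000000000104000000000000200000000000010000000008820800000000441040000000000c020000000000401000000000009080000000000404000000000000230870a0ca6c29,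
    0x80000000000404000000000000200000000004010000000000c0080000000000004000000000000628000000000011400000000000880000000000044000000000002000000000000100000000000008000000000000400000000000024220000000001011000000000080000000000004000000000000202000000000010100000060000840000c8400004000004400000200000000000010000000000000800008400000040000400000002000000000000100000000000008000000000000400000000000020000000000001000000000000080000000000004000000000002200000000000110000000000068800000000001440000000000002000000000000100000000000008000000000000400000000000020000000000001000000000000080000000000004000000000020200000000001010000000000000800000000000040000000002602642c0057c37c9,
    0x800000010010040000001001002000000300300100000030030008200020000800410001000040c300300300300010010010010000808000020080040400001004002400200000000100010000000008000000000000400000000000020080808000001004040400000081000000800004000000047000200000200c0001000001000000080820002ea4c1f265c087000002000000000000100000000000008000810000000400040000000020000800000001000040000000080000000000004000000000000200000000000010000000000000800000000000040000000000082000000000004100000000000008000000000000400000000000020000000000001000000000008080000000000404000000000300200000000010010000000000000800000000000040000000000002000000000000100000000002008000000000100400000000240020120702814107,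
    0x8000000400400400000000000020000000000001000000c00c004c00c00c00c0004004004004000202000008002eb4d1b22480870080200020020004010001001000200200802000010010040100000800220200000040011010000002040000002ea4d1b224c087e000800000800400040000040000002040000200000100000010000008000000000000400000000000020000204000001000010000000080000000000004000000000000200204000000010010000000000800000000000040000000000002000000000000100000000000008000000000000400000000000020000000000001000000000000080000000000004000000000020200000000001010000000000c0080000000004004000000000080200000000004010000000000000800000000000040000000002002000000000100100000000000008000000000000400000000080024402d03b15b47,
    0x80000000000004000000001000200000000200010000000010000808000000000040400000000002408210000800100410000040009000200000000400010000000020000000000001000000000000080000000000004000000000500200000200080010000010000000801000080000040000004000002000000080000100000004ea4c13200c8a7000004010041000000200000800000010000040000000800020000000040001000000002000000000000100000000000008000000000000400000000000020000000000001000000000000080000000000004000000000000200000000000010000000000080800000000004040000000000002000000000000100000000002008000000000100400000000000020000000000001000000000000080000000000004000000002400200000000100010000000000000800000000000040000000090002ea04992cdf8e2,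
    0x800000000400040000000040002000000008000100000000c0000902080000000040104000000002000000000000100000000000008008000000000400400000000020108000002ea5c1b624c087f00801000c020c004000004010000200000000000010000000000000800000002ea4c5b224c08700002000000000000100000000000008000000000000400000000000020008010000001000400000000080000000000004000000000000202090000000010104000000000800000000000040000000000002000000000000100000000000008000000000000400000000000020000000000001000000000000080000000000004000000000080200000000004010000000000000800000000000040000000000002000000000000100000000098008000000004400400000000000020000000000001000000000200080000000010004000000000000231020d09bc921,
    0x8000000000000400000001000020000000300001000000010000e20c3ba2440870400104004000020008000000001000400000000081000000002ea0c1b224c087d0200000200008010000010000000800184020800040004001040002000000000000100000000000008000000200000400000010ea4c3b2244087000010000400000000800000000000040000000000002000080000000100004000000008008000000000400400000000020810000000001040000000000080000000000004000000000000200000000000010000000000000800000000000040000000000002000000000000100000000000008000000000000400000000000020000000000001000000000000080000000000004000000000800200000000040010000000002000800000000100040000000000002000000000000100000000840008000000040000400000000000020040289aedf0d,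
    0x8000000000000400000004000020000000c000010000000000000810020201008040001010000402010088100200100004400010908000008000080400000400000020001002000001000000100000080000000800004000000040ea4e1b226c08700010000100000000800000200000040000010000002000008000000100000400000008000800000000400040000000020201000000001010000000000088100000000004400000000000200000000000010000000000000800000000000040000000000002000000000000100000000000008000000000000400000000000020000000000001000000000000080000000000004000000000000200000000000010000000000000800000000000040000000000002000000000000100000000000008000000000000400000000800020000000040001000000002000080000000100004000000000000280110288d84e9,
    0x800000010000040000001000002000000200000100000020000008040020000800400001000040b200100300200c1000001001000080010002008004000000100400200000000800010000000040000800000000000040000000000002000080810000100004040000008000020000000400001000000020020010000001001000000000080824000000004041000000000200000000000010000000000000808000000000040400000000002000000000000100000000000008000000000000400000000000020000000000001000000000000080000000000004000000000000200000000000010000000000000800000000000040000000000002000000000000100000000000008000000000000400000000000020000000000001000000000000080000000000004000000000000200000000000010000000000000800000000000040000000800002b004102425285,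
    0x8000000400000400000000000020000000000001000000800000a800400c0080044000004004000200040008002eb4c1b22480870080004020020004000001001000200000802040010000040100000800020204000040001010000002000008000000100000400000008008004000000400400000000020002000000001000100000000080000000000004000000000000200800000000010040000000000800000000000040000000000002200000000000110000000000008000000000000400000000000020000000000001000000000000080000000000004000000000000200000000000010000000000000800000000000040000000000002000000000000100000000000008000000000000400000000000020000000000001000000000000080000000000004000000000000200000000000010000000000000800000000000040000000000002a0004409cb853,
    0x8000000000000c0000000000003000000000000100000000000002000000000000100000000000080000000000004000000000000080000000000004000000000000020000000000001000000000000008000000000000400000000020000000000001000000000000002000000000000100000000000080000000000004000000000008000000000000400000000000000080000000000004000000000002000000000000100000000000000000002ea4c1b224c087000000020000000000001000000000000800000000000040000000000000800000000000040000000000000200000000000010000000000000080000000000004000000000200000000000010000000000000020000000000001000000000000800000000000040000000000080000000000004000000000000000800000000000040000000000020000000000001000000020000007a484cf8480d2,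
    0x800000000000040000000000002000000000000500000000000008000000000000400000000000000800000000000040000000000020000000000001000000000000800000000000040000000000020000000000001000000000000000002000000000000100000000008000000000000400000000000002000000000000100000000000000000080000000000004000002000000000000100000000000000000000800000000000040002000000000000100000000000000008000000000000400000000000000800000000000040000000000020000000000001000000000000800000000000040000000000020000000000001000000000000000002ea4c1b224c08700000000008000000000000400000000000002000000000000100000080000000000004000000000000000002000000000000100000000800000000000040000000000000002000eb1a39431b080]

/-- The longest element of the Weyl group, as a word in the generators of the Ree group. -/
def longWord : List ℕ := [12, 13, 12, 13, 12, 13, 12, 13]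

/-- The index of the first entry equal to `n`. -/
def indexOf (n : ℕ) : List ℕ → ℕ
  | [] => 0
  | m :: l => bif Nat.beq n m then 0 else indexOf n l + 1

/-- A word for `x_i x_j x_i⁻¹` in letters `x_k` with `k > i`, for `i < j < 24`. The root with number
`i` is short if and only if `i` is even. -/
def commWord (i j : ℕ) : List ℕ :=
  let r := quad i
  let s := quad j
  let t := r.addMul s 1
  let index (q : Quad) (k : ℕ → List ℕ) : List ℕ := force (key q) fun n => force (indexOf n keys) k
  if t.isRoot then index t fun k =>
    bif Nat.beq (i % 2) (j % 2) then (bif Nat.ble (k % 2) (i % 2) then [k, j] else [j])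
    else index (t.addMul (bif Nat.beq (i % 2) 0 then r else s) 1) fun l => [k, l, j]
  else [j]

/-- For each `k < 12`, a set of vectors which is stable under `x_i` for `2 k + 2 ≤ i < 24`, but not
under `f k`. -/
def stableVectors : List (List ℕ) :=
  [[2 ^ 20], [2 ^ 18, 2 ^ 18 + 2 ^ 22], [2 ^ 18], [2 ^ 14, 2 ^ 14 + 2 ^ 22], [2 ^ 16],
    [2 ^ 8, 2 ^ 8 + 2 ^ 22], [2 ^ 10], [2 ^ 12], [2 ^ 6], [2 ^ 2], [0xea4c1b224c087], [2 ^ 24]]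

/-- The words of the generators. -/
def wordCheck (xs : List ℕ) : Bool := decide (reeWords.map (evCode xs) = reeCodes)

/-- The commutator relations. -/
def commCheck (xs : List ℕ) : Bool :=
  (List.range 24).all fun j => (List.range j).all fun i => force i fun i => force j fun j =>
    (commWord i j).all (fun k => Nat.ble (i + 1) k && Nat.ble k 23) &&
    Nat.beq (evCode xs [i, j]) (evCode xs (commWord i j ++ [i])) &&
    Nat.beq (evCode xs [swap i, swap j]) (evCode xs ((commWord i j).map swap ++ [swap i]))

/-- The generators `f k` are fixed by the graph automorphism. -/
def fixedCheck (xs : List ℕ) : Bool :=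
  (List.range 12).all fun k =>
    Nat.beq (reeCodes.getD k one) (evCode xs ((reeWords.getD k []).map swap))

/-- The longest element interchanges positive and negative roots. -/
def longCheck (xs : List ℕ) : Bool :=
  force (evCode reeCodes longWord) fun w => (List.range 24).all fun i =>
    Nat.beq (mul w (xs.getD i one)) (mul (xs.getD (i + 24) one) w)

/-- The properties of `stableVectors`. -/
def stableCheck (xs : List ℕ) : Bool :=
  (List.range 12).all fun k =>
    (stableVectors.getD k []).all fun v => Nat.ble v (2 ^ 52 - 1) &&
      ((List.range 24).all fun i => Nat.ble i (2 * k + 1) ||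
        (stableVectors.getD k []).any fun v' => Nat.beq v' (col (mul (xs.getD i one) v) 0)) &&
      !(stableVectors.getD k []).any fun v' => Nat.beq v' (col (mul (reeCodes.getD k one) v) 0)

/-- The checks are evaluated together so that the 48 matrices are computed once and shared. -/
theorem check_shearedCodes : forceList shearedCodes (fun xs => wordCheck xs && commCheck xs &&
    fixedCheck xs && longCheck xs && stableCheck xs) = true := by decide +kernel

end F4

namespace F4

open BitMat WordGroup Subgroup

theorem checks : wordCheck shearedCodes = true ∧ commCheck shearedCodes = true ∧
    fixedCheck shearedCodes = true ∧ longCheck shearedCodes = true ∧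
    stableCheck shearedCodes = true := by
  have h := check_shearedCodes
  rw [forceList_eq] at h
  simpa only [Bool.and_eq_true, and_assoc] using h

theorem codesAll_R : CodesAll shearedBasis R reeCodes := by
  have h := checks.1
  rw [wordCheck, decide_eq_true_eq] at h
  rw [← h]
  exact codesAll_X.derived reeWords

/-! ### The fixed points of the graph automorphism -/

/-- The generators `(x_r, σ x_r)` of the graph of the graph automorphism. -/
noncomputable def graphGen (i : ℕ) : (LieF4 ≃ₗ[ZMod 2] LieF4) × (LieF4 ≃ₗ[ZMod 2] LieF4) :=
  (X i, X (swap i))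

theorem fst_ev_graphGen (w : List ℕ) : (ev graphGen w).1 = ev X w :=
  map_ev (MonoidHom.fst _ _) graphGen w

theorem snd_ev_graphGen (w : List ℕ) : (ev graphGen w).2 = ev X (w.map swap) := by
  refine (map_ev (MonoidHom.snd _ _) graphGen w).trans ?_
  rw [ev, ev, List.map_map]
  rfl

theorem ev_graphGen {v : List ℕ} {g : LieF4 ≃ₗ[ZMod 2] LieF4} (h1 : ev X v = g)
    (h2 : ev X (v.map swap) = g) : ev graphGen v = (g, g) :=
  Prod.ext ((fst_ev_graphGen v).trans h1) ((snd_ev_graphGen v).trans h2)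

theorem graphGen_mul_self (i : ℕ) : graphGen i * graphGen i = 1 :=
  Prod.ext (X_mul_self i) (X_mul_self _)

theorem graphGen_comm {i j : ℕ} (hij : i < j) (hj : j < 24) :
    (∀ k ∈ commWord i j, i + 1 ≤ k ∧ k < 24) ∧
      graphGen i * graphGen j * (graphGen i)⁻¹ = ev graphGen (commWord i j) := by
  have h := checks.2.1
  rw [commCheck, List.all_eq_true] at h
  have h := h j (List.mem_range.2 hj)
  rw [List.all_eq_true] at h
  have h := h i (List.mem_range.2 hij)
  rw [force_eq, force_eq, Bool.and_eq_true, Bool.and_eq_true, List.all_eq_true, Nat.beq_eq,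
    Nat.beq_eq] at h
  obtain ⟨⟨h0, h1⟩, h2⟩ := h
  refine ⟨fun k hk => ?_, ?_⟩
  · have := h0 k hk
    rw [Bool.and_eq_true, Nat.ble_eq, Nat.ble_eq] at this
    omega
  · rw [mul_inv_eq_iff_eq_mul]
    have e1 := codesAll_X.ev_eq h1
    have e2 := codesAll_X.ev_eq h2
    simp only [ev_append, ev_cons, ev_nil, mul_one] at e1 e2
    exact Prod.ext (by rw [Prod.fst_mul, Prod.fst_mul, fst_ev_graphGen]; exact e1)
      (by rw [Prod.snd_mul, Prod.snd_mul, snd_ev_graphGen]; exact e2)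

/-- Each commutator relation is checked for the root elements and for their images under σ. It
therefore holds for the pairs, and the graph of σ is handled without proving that σ is an
automorphism. -/
theorem isPolycyclic_graphGen : IsPolycyclic graphGen 24 fun _ => 2 where
  pos _ _ := two_pos
  pow_mem_tail i _ := by
    rw [pow_two, graphGen_mul_self]
    exact one_mem _
  conj_mem_tail i j hij hj := by
    rw [(graphGen_comm hij hj).2]
    exact ev_mem_tail (graphGen_comm hij hj).1

theorem ev_graphGen_reeWords {k : ℕ} (hk : k < 12) :
    ev graphGen (reeWords.getD k []) = (R k, R k) := by
  refine ev_graphGen rfl ?_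
  have h := checks.2.2.1
  rw [fixedCheck, List.all_eq_true] at h
  have h := h k (List.mem_range.2 hk)
  rw [Nat.beq_eq] at h
  have h1 := codesAll_R k
  rw [h] at h1
  exact ((codesAll_X.ev _).eq_iff h1).2 rfl

/-- All generators of the tail preserve the finite set `stableVectors.getD k []`, hence so does the
tail, whereas `R k` maps its members outside it. -/
theorem R_notMem_tail {k : ℕ} (hk : k < 12) : R k ∉ tail X 24 (2 * k + 2) := by
  have h := checks.2.2.2.2
  rw [stableCheck, List.all_eq_true] at h
  have h := h k (List.mem_range.2 hk)
  rw [List.all_eq_true] at h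
  set S := stableVectors.getD k [] with hS
  obtain ⟨v, hv⟩ : ∃ v, v ∈ S := by
    have : ∀ k < 12, (stableVectors.getD k []) ≠ [] := by decide
    exact List.exists_mem_of_ne_nil _ (this k hk)
  intro hR
  have lt : ∀ v ∈ S, v < 2 ^ 52 := by
    intro v hv
    have := h v hv
    rw [Bool.and_eq_true, Bool.and_eq_true, Nat.ble_eq] at this
    have := this.1.1
    omega
  have stable : ∀ i, 2 * k + 2 ≤ i → i < 24 → ∀ v ∈ S, ∃ v' ∈ S,
      X i (vec shearedBasis v) = vec shearedBasis v' := by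
    intro i h1 h2 v hv
    have := h v hv
    rw [Bool.and_eq_true, Bool.and_eq_true, List.all_eq_true] at this
    have := this.1.2 i (List.mem_range.2 h2)
    rw [Bool.or_eq_true, Nat.ble_eq, List.any_eq_true] at this
    obtain ⟨v', hv', h3⟩ := this.resolve_left (by omega)
    rw [Nat.beq_eq] at h3
    exact ⟨v', hv', by rw [(codesAll_X i).apply (lt v hv), h3]⟩
  have key : ∀ g ∈ tail X 24 (2 * k + 2), ∀ v ∈ S, ∃ v' ∈ S,
      g (vec shearedBasis v) = vec shearedBasis v' := by
    intro g hg
    induction hg using closure_induction_left with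
    | one => exact fun v hv => ⟨v, hv, rfl⟩
    | mul_left y hy z _ ih =>
      obtain ⟨i, ⟨h1, h2⟩, rfl⟩ := hy
      intro v hv
      obtain ⟨v', hv', h3⟩ := ih v hv
      obtain ⟨v'', hv'', h4⟩ := stable i h1 h2 v' hv'
      exact ⟨v'', hv'', by rw [LinearEquiv.mul_apply, h3, h4]⟩
    | inv_mul_cancel y hy z _ ih =>
      obtain ⟨i, ⟨h1, h2⟩, rfl⟩ := hy
      intro v hv
      obtain ⟨v', hv', h3⟩ := ih v hv
      obtain ⟨v'', hv'', h4⟩ := stable i h1 h2 v' hv'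
      rw [inv_eq_of_mul_eq_one_left (X_mul_self i)]
      exact ⟨v'', hv'', by rw [LinearEquiv.mul_apply, h3, h4]⟩
  obtain ⟨v', hv', h1⟩ := key _ hR v hv
  rw [(codesAll_R k).apply (lt v hv)] at h1
  have h2 := vec_injOn shearedBasis (col_lt _ _) (lt v' hv') h1
  have := h v hv
  rw [Bool.and_eq_true, Bool.not_eq_true', List.any_eq_false] at this
  refine this.2 v' hv' ?_
  rw [Nat.beq_eq, h2]

theorem swap_ge : ∀ i < 24, ∀ k < 12, 2 * k + 2 ≤ i → 2 * k + 2 ≤ swap i ∧ swap i < 24 := by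
  decide

theorem swap_two_mul : ∀ k < 12, swap (2 * k) = 2 * k + 1 ∧ swap (2 * k + 1) = 2 * k := by decide

theorem reeWords_eq : ∀ k < 12, reeWords.getD k [] = 2 * k :: (2 * k + 1) ::
    (reeWords.getD k []).drop 2 ∧ ∀ i ∈ (reeWords.getD k []).drop 2, 2 * k + 2 ≤ i ∧ i < 24 := by
  decide

theorem fst_mem_tail {z : (LieF4 ≃ₗ[ZMod 2] LieF4) × (LieF4 ≃ₗ[ZMod 2] LieF4)} {n k : ℕ}
    (hz : z ∈ tail graphGen n k) : z.1 ∈ tail X n k := by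
  have := mem_map_of_mem (MonoidHom.fst _ _) hz
  rwa [map_tail] at this

theorem snd_mem_tail {z : (LieF4 ≃ₗ[ZMod 2] LieF4) × (LieF4 ≃ₗ[ZMod 2] LieF4)} {k : ℕ} (hk : k < 12)
    (hz : z ∈ tail graphGen 24 (2 * k + 2)) : z.2 ∈ tail X 24 (2 * k + 2) := by
  have := mem_map_of_mem (MonoidHom.snd _ _) hz
  rw [map_tail] at this
  refine tail_le (fun i h1 h2 => ?_) this
  have := swap_ge i h2 k hk h1
  exact mem_tail this.1 this.2

/-- Collect (u, u) as z · g_{2k+1}^d · g_{2k}^e with z in the next tail. Since σ exchanges x_{2k}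
and x_{2k+1}, equality of the two coordinates forces d = e. If both exponents are 1, multiplication
by `R k` removes them. -/
theorem mem_tail_R_of_mem_tail {k : ℕ} (hk : k ≤ 12) : ∀ u : LieF4 ≃ₗ[ZMod 2] LieF4,
    (u, u) ∈ tail graphGen 24 (2 * k) → u ∈ tail R 12 k := by
  induction hk using Nat.decreasingInduction with
  | self =>
    intro u hu
    rw [show 2 * 12 = 24 from rfl, tail_self, mem_bot] at hu
    rw [show u = 1 from congrArg Prod.fst hu]
    exact one_mem _
  | of_succ k hk ih =>
    intro u hu
    obtain ⟨y, hy, e, he, hu⟩ := isPolycyclic_graphGen.exists_mul_pow (by omega) hu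
    obtain ⟨z, hz, d, hd, rfl⟩ := isPolycyclic_graphGen.exists_mul_pow (by omega) hy
    obtain ⟨hw, hr⟩ := reeWords_eq k hk
    have hR := ev_graphGen_reeWords hk
    have hn := R_notMem_tail hk
    rw [hw, ev_cons, ev_cons] at hR
    have ht : ev graphGen ((reeWords.getD k []).drop 2) ∈ tail graphGen 24 (2 * k + 2) :=
      ev_mem_tail hr
    generalize ev graphGen ((reeWords.getD k []).drop 2) = t at ht hR
    obtain ⟨s1, s2⟩ := swap_two_mul k hk
    have R1 : X (2 * k) * (X (2 * k + 1) * t.1) = R k := congrArg Prod.fst hR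
    have u1 : u = z.1 * X (2 * k + 1) ^ d * X (2 * k) ^ e := congrArg Prod.fst hu
    have u2 : u = z.2 * X (2 * k) ^ d * X (2 * k + 1) ^ e := by
      have := congrArg Prod.snd hu
      simp only [graphGen, Prod.snd_mul, Prod.pow_snd, s1, s2] at this
      exact this
    -- `R k` is this product times an element of the tail, so the two are in the tail
    -- simultaneously. The cases d ≠ e will put the product into the tail.
    have no : X (2 * k) * X (2 * k + 1) ∉ tail X 24 (2 * k + 2) := fun h0 => hn (by
      rw [← R1, ← mul_assoc]
      exact mul_mem h0 (fst_mem_tail ht))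
    have z1 := fst_mem_tail hz
    have z2 := snd_mem_tail hk hz
    interval_cases d <;> interval_cases e
    · rw [pow_zero, pow_zero, mul_one, mul_one] at hu
      exact tail_anti (Nat.le_succ k) (ih u (hu ▸ hz))
    · refine absurd ?_ no
      simp only [pow_zero, pow_one, mul_one] at u1 u2
      have : X (2 * k) * X (2 * k + 1) = z.1⁻¹ * z.2 := by
        rw [eq_inv_mul_iff_mul_eq, ← mul_assoc, ← u1, u2, mul_assoc, X_mul_self, mul_one]
      rw [this]
      exact mul_mem (inv_mem z1) z2
    · refine absurd ?_ no
      simp only [pow_zero, pow_one, mul_one] at u1 u2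
      have : X (2 * k) * X (2 * k + 1) = z.2⁻¹ * z.1 := by
        rw [eq_inv_mul_iff_mul_eq, ← mul_assoc, ← u2, u1, mul_assoc, X_mul_self, mul_one]
      rw [this]
      exact mul_mem (inv_mem z2) z1
    · rw [pow_one, pow_one] at hu
      -- `R k` begins with x_{2k} x_{2k+1}, and these involutions cancel the end of u.
      have key : (u * R k, u * R k) ∈ tail graphGen 24 (2 * (k + 1)) := by
        have : (u * R k, u * R k) = (u, u) * (R k, R k) := rfl
        rw [this, hu, ← hR]
        have : z * graphGen (2 * k + 1) * graphGen (2 * k) *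
          (graphGen (2 * k) * (graphGen (2 * k + 1) * t)) = z * (graphGen (2 * k + 1) *
            (graphGen (2 * k) * graphGen (2 * k)) * graphGen (2 * k + 1)) * t := by group
        rw [this, graphGen_mul_self, mul_one, graphGen_mul_self, mul_one]
        exact mul_mem hz ht
      exact (mul_mem_cancel_right (mem_tail le_rfl hk)).1 (tail_anti (Nat.le_succ k) (ih _ key))

theorem positive_quad : ∀ i < 48, (0 ≤ (quad i).1 ∧ 0 ≤ (quad i).2.1 ∧ 0 ≤ (quad i).2.2.1 ∧
    0 ≤ (quad i).2.2.2) ↔ i < 24 := by decide +kernel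

theorem negative_quad : ∀ i < 48, ((quad i).1 ≤ 0 ∧ (quad i).2.1 ≤ 0 ∧ (quad i).2.2.1 ≤ 0 ∧
    (quad i).2.2.2 ≤ 0) ↔ 24 ≤ i := by decide +kernel

theorem root_mem_positiveRoots (i : Fin 48) : root i ∈ positiveRoots ↔ (i : ℕ) < 24 := by
  rw [← positive_quad i i.2]
  exact Fin.forall_fin_succ.trans (and_congr Iff.rfl (Fin.forall_fin_succ.trans
    (and_congr Iff.rfl (Fin.forall_fin_two.trans Iff.rfl))))

theorem root_mem_negativeRoots (i : Fin 48) : root i ∈ negativeRoots ↔ 24 ≤ (i : ℕ) := by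
  rw [← negative_quad i i.2]
  exact Fin.forall_fin_succ.trans (and_congr Iff.rfl (Fin.forall_fin_succ.trans
    (and_congr Iff.rfl (Fin.forall_fin_two.trans Iff.rfl))))

theorem graphGen_eq (i : Fin 48) : (x (root i), x (bar (root i))) = graphGen i := by
  rw [bar_root, graphGen, X, X, dif_pos i.2, dif_pos (swap_lt i i.2)]

theorem sigmaGraph_eq {S : Set Root} {n k : ℕ} (hn : n ≤ 48)
    (h : ∀ i : Fin 48, root i ∈ S ↔ k ≤ (i : ℕ) ∧ (i : ℕ) < n) :
    sigmaGraph S = tail graphGen n k := by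
  rw [sigmaGraph, tail]
  congr 1
  ext g
  constructor
  · rintro ⟨r, hr, rfl⟩
    obtain ⟨i, rfl⟩ := root_bijective.2 r
    exact ⟨i, (h i).1 hr, (graphGen_eq i).symm⟩
  · rintro ⟨i, hi, rfl⟩
    refine ⟨root ⟨i, hi.2.trans_le hn⟩, (h _).2 hi, graphGen_eq _⟩

theorem sigmaGraph_positiveRoots : sigmaGraph positiveRoots = tail graphGen 24 0 :=
  sigmaGraph_eq (by norm_num) fun i => by rw [root_mem_positiveRoots]; simp

theorem sigmaGraph_negativeRoots : sigmaGraph negativeRoots = tail graphGen 48 24 :=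
  sigmaGraph_eq le_rfl fun i => by
    rw [root_mem_negativeRoots]
    exact ⟨fun h => ⟨h, i.2⟩, fun h => h.1⟩

theorem mem_sigmaFixed {S : Set Root} {u : LieF4 ≃ₗ[ZMod 2] LieF4} :
    u ∈ sigmaFixed S ↔ (u, u) ∈ sigmaGraph S := Iff.rfl

theorem R_mem_sigmaFixed {k : ℕ} (hk : k < 12) : R k ∈ sigmaFixed positiveRoots := by
  rw [mem_sigmaFixed, sigmaGraph_positiveRoots, ← ev_graphGen_reeWords hk, (reeWords_eq k hk).1]
  refine ev_mem_tail fun i hi => ⟨Nat.zero_le i, ?_⟩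
  rcases List.mem_cons.1 hi with rfl | hi
  · omega
  rcases List.mem_cons.1 hi with rfl | hi
  · omega
  exact ((reeWords_eq k hk).2 i hi).2

theorem sigmaFixed_positiveRoots : sigmaFixed positiveRoots = tail R 12 0 := by
  refine le_antisymm (fun u hu => ?_) (tail_le fun k _ hk => R_mem_sigmaFixed hk)
  rw [mem_sigmaFixed, sigmaGraph_positiveRoots] at hu
  exact mem_tail_R_of_mem_tail (k := 0) (by norm_num) u hu

/-- The longest element of the Weyl group. -/
noncomputable def w0 : LieF4 ≃ₗ[ZMod 2] LieF4 := ev R longWord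

theorem swap_add : ∀ i < 24, swap (i + 24) = swap i + 24 ∧ swap i < 24 := by decide

theorem w0_conj_X {i : ℕ} (hi : i < 24) : w0 * X i * w0⁻¹ = X (i + 24) := by
  have h := checks.2.2.2.1
  rw [longCheck, force_eq, List.all_eq_true] at h
  have h := h i (List.mem_range.2 hi)
  rw [Nat.beq_eq] at h
  rw [mul_inv_eq_iff_eq_mul]
  exact (((codesAll_R.ev longWord).mul (codesAll_X i)).eq_iff
    ((codesAll_X _).mul (codesAll_R.ev longWord))).2 h

/-- The longest element acts on the roots as -1, which commutes with `bar`. Conjugation by the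
diagonal pair thus carries one graph to the other, and the negative fixed points need no separate
computation. -/
theorem map_sigmaGraph : (sigmaGraph positiveRoots).map (MulAut.conj (w0, w0)).toMonoidHom =
    sigmaGraph negativeRoots := by
  rw [sigmaGraph_positiveRoots, sigmaGraph_negativeRoots, map_tail]
  have key : ∀ i < 24, (MulAut.conj (w0, w0)).toMonoidHom (graphGen i) = graphGen (i + 24) := by
    intro i hi
    obtain ⟨h1, h2⟩ := swap_add i hi
    refine Prod.ext (w0_conj_X hi) ?_
    rw [graphGen, graphGen, h1]
    exact w0_conj_X h2
  refine le_antisymm (tail_le fun i _ hi => ?_) (tail_le fun i h1 h2 => ?_)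
  · rw [key i hi]
    exact mem_tail (by omega) (by omega)
  · obtain ⟨j, rfl⟩ := Nat.exists_eq_add_of_le' h1
    rw [← key j (by omega)]
    exact mem_tail (a := fun i => (MulAut.conj (w0, w0)).toMonoidHom (graphGen i))
      (Nat.zero_le _) (by omega)

theorem w0_conj_mem_sigmaFixed {u : LieF4 ≃ₗ[ZMod 2] LieF4} :
    w0 * u * w0⁻¹ ∈ sigmaFixed negativeRoots ↔ u ∈ sigmaFixed positiveRoots := by
  rw [mem_sigmaFixed, mem_sigmaFixed, ← map_sigmaGraph]
  exact mem_map_iff_mem (f := (MulAut.conj (w0, w0)).toMonoidHom) (MulAut.conj _).injective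
    (x := (u, u))

/-- The negative fixed points are conjugates of the positive ones under `w0`, a word in the two Weyl
involutions. Conversely, each of these involutions is a product of positive fixed elements and a
`w0`-conjugate of one. -/
theorem reeGroup_eq : reeGroup = tail R 14 0 := by
  have hw : w0 ∈ tail R 14 0 := ev_mem_tail (by decide)
  refine le_antisymm (sup_le ?_ fun u hu => ?_) (tail_le fun k _ hk => ?_)
  · rw [sigmaFixed_positiveRoots]
    exact tail_le fun i _ hi => mem_tail (Nat.zero_le _) (by omega)
  · have : u = w0 * (w0⁻¹ * u * w0) * w0⁻¹ := by group
    rw [this] at hu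
    have h1 := w0_conj_mem_sigmaFixed.1 hu
    rw [sigmaFixed_positiveRoots] at h1
    rw [this]
    refine mul_mem (mul_mem hw ?_) (inv_mem hw)
    exact tail_le (fun i _ hi => mem_tail (Nat.zero_le _) (by omega)) h1
  · have pos : sigmaFixed positiveRoots ≤ reeGroup := le_sup_left
    have neg : sigmaFixed negativeRoots ≤ reeGroup := le_sup_right
    have hf : ∀ k < 12, R k ∈ reeGroup := fun k hk => pos (R_mem_sigmaFixed hk)
    have hv : ∀ k < 12, w0 * R k * w0⁻¹ ∈ reeGroup := fun k hk =>
      neg (w0_conj_mem_sigmaFixed.2 (R_mem_sigmaFixed hk))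
    have r0 : R 0 = ev X [0, 1] := rfl
    have r1 : R 1 = ev X [2, 3, 6] := rfl
    have cw := fun i hi => w0_conj_X (i := i) hi
    by_cases h12 : k < 12
    · exact hf k h12
    obtain rfl | rfl : k = 12 ∨ k = 13 := by omega
    -- The rank one formula n = x y x with opposite root elements x and y.
    · have : R 12 = R 0 * (w0 * R 0 * w0⁻¹) * R 0 := by
        have e1 : w0 * R 0 * w0⁻¹ = X 24 * X 25 := by
          rw [← cw 0 (by norm_num), ← cw 1 (by norm_num), r0]
          simp only [ev_cons, ev_nil]
          group
        rw [e1, r0]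
        change ev X [0, 1, 24, 25, 0, 1] = _
        simp only [ev_cons, ev_nil, mul_one, mul_assoc]
      rw [this]
      exact mul_mem (mul_mem (hf 0 (by norm_num)) (hv 0 (by norm_num))) (hf 0 (by norm_num))
    · have : R 13 = R 1 * R 1 * R 1 * (w0 * R 1 * w0⁻¹) * R 1 * R 1 := by
        have e1 : w0 * R 1 * w0⁻¹ = X 26 * X 27 * X 30 := by
          rw [← cw 2 (by norm_num), ← cw 3 (by norm_num), ← cw 6 (by norm_num), r1]
          simp only [ev_cons, ev_nil]
          group
        rw [e1, r1]
        change ev X [2, 3, 6, 2, 3, 6, 2, 3, 6, 26, 27, 30, 2, 3, 6, 2, 3, 6] = _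
        simp only [ev_cons, ev_nil, mul_one, mul_assoc]
      rw [this]
      have := hf 1 (by norm_num)
      exact mul_mem (mul_mem (mul_mem (mul_mem (mul_mem this this) this)
        (hv 1 (by norm_num))) this) this

end F4

/-! ### Verification of polycyclic presentations -/

namespace WordGroup

variable {G : Type*} [Group G]

/-- The word with the indices `i`, `j` in a table of exceptions, and `[j]` by default. -/
def conjWord (i j : ℕ) : List (ℕ × ℕ × List ℕ) → List ℕ
  | [] => [j]
  | (a, b, w) :: l => bif Nat.beq a i && Nat.beq b j then w else conjWord i j l

/-- Checks the relations `a i ^ p = sq i` and `a i * a j = conj i j * a i` for `i < j < n`, where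
all the words on the right involve only letters after `i`. -/
def pcCheck (eqv : List ℕ → List ℕ → Bool) (n p : ℕ) (sq : List (List ℕ))
    (conj : List (ℕ × ℕ × List ℕ)) : Bool :=
  (List.range n).all fun i => BitMat.force i fun i =>
    (sq.getD i []).all (fun k => Nat.ble (i + 1) k && Nat.ble (k + 1) n) &&
    eqv (List.replicate p i) (sq.getD i []) &&
    (List.range n).all fun j => BitMat.force j fun j => Nat.ble j i ||
      ((conjWord i j conj).all (fun k => Nat.ble (i + 1) k && Nat.ble (k + 1) n) &&
        eqv [i, j] (conjWord i j conj ++ [i]))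

theorem isPolycyclic_of_pcCheck {a : ℕ → G} {eqv : List ℕ → List ℕ → Bool}
    (heqv : ∀ v w, eqv v w = true → ev a v = ev a w) {n p : ℕ} {sq : List (List ℕ)}
    {conj : List (ℕ × ℕ × List ℕ)} (hp : 0 < p) (h : pcCheck eqv n p sq conj = true) :
    IsPolycyclic a n fun _ => p := by
  have range : ∀ {i : ℕ} {w : List ℕ},
      w.all (fun k => Nat.ble (i + 1) k && Nat.ble (k + 1) n) = true →
      ev a w ∈ tail a n (i + 1) := fun h => ev_mem_tail fun k hk => by
    have := List.all_eq_true.1 h k hk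
    rw [Bool.and_eq_true, Nat.ble_eq, Nat.ble_eq] at this
    exact this
  rw [pcCheck, List.all_eq_true] at h
  refine ⟨fun _ _ => hp, fun i hi => ?_, fun i j hij hj => ?_⟩
  · have h := h i (List.mem_range.2 hi)
    rw [BitMat.force_eq, Bool.and_eq_true, Bool.and_eq_true] at h
    have e := heqv _ _ h.1.2
    rw [ev, List.map_replicate, List.prod_replicate] at e
    rw [e]
    exact range h.1.1
  · have h := h i (List.mem_range.2 (hij.trans hj))
    rw [BitMat.force_eq, Bool.and_eq_true, List.all_eq_true] at h
    have h := h.2 j (List.mem_range.2 hj)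
    rw [BitMat.force_eq, Bool.or_eq_true, Nat.ble_eq, Bool.and_eq_true] at h
    obtain ⟨h1, h2⟩ := h.resolve_left (by omega)
    have e := heqv _ _ h2
    rw [ev_append, ev_cons, ev_cons, ev_nil, ev_cons, ev_nil, mul_one, mul_one] at e
    rw [e, mul_inv_cancel_right]
    exact range h1

end WordGroup

namespace F4

open BitMat WordGroup Subgroup

/-! ### An upper bound for the order of the Tits group -/

/-- Parity of a word in the generators of the Ree group. -/
def parity (w : List ℕ) : Bool := w.foldr (fun i b => xor ([1, 2, 4, 5].any (Nat.beq i)) b) false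

/-- The sign of a parity. -/
def sign (b : Bool) : Multiplicative (ZMod 2) := Multiplicative.ofAdd (bif b then 1 else 0)

theorem sign_xor : ∀ b c, sign (xor b c) = sign b * sign c := by decide

/-- The generators of the Ree group, together with their parities. -/
noncomputable def signedR (i : ℕ) : (LieF4 ≃ₗ[ZMod 2] LieF4) × Multiplicative (ZMod 2) :=
  (R i, sign (parity [i]))

theorem ev_signedR (w : List ℕ) : ev signedR w = (ev R w, sign (parity w)) := by
  induction w with
  | nil => rfl
  | cons i w ih =>
    rw [ev_cons, ih, ev_cons]
    refine Prod.ext rfl ?_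
    change sign (parity [i]) * sign (parity w) = _
    rw [← sign_xor]
    simp [parity]

/-- Equality of words in the generators of the Ree group and of their parities. -/
def signedEq (v w : List ℕ) : Bool :=
  Nat.beq (evCode reeCodes v) (evCode reeCodes w) && (parity v == parity w)

theorem ev_signedR_eq {v w : List ℕ} (h : signedEq v w = true) : ev signedR v = ev signedR w := by
  rw [signedEq, Bool.and_eq_true, Nat.beq_eq] at h
  rw [ev_signedR, ev_signedR, codesAll_R.ev_eq h.1, eq_of_beq h.2]

/-- The tables give the squares and the conjugates of the twelve unipotent generators. All relations
are checked together with parities, so they hold in the lift. -/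
theorem pcCheck_signedR : pcCheck signedEq 12 2
    [[], [3], [7], [], [10], [11], [], [], [], [], [], []]
    [(0, 1, [8, 6, 4, 2, 1]), (0, 3, [11, 10, 9, 8, 7, 6, 5, 4, 3]), (0, 4, [8, 7, 4]),
      (0, 5, [7, 5]), (0, 6, [9, 8, 6]), (0, 10, [11, 10]), (1, 2, [11, 5, 4, 2]), (1, 4, [6, 4]),
      (1, 7, [10, 9, 8, 7]), (1, 8, [11, 9, 8]), (1, 9, [10, 9]), (2, 3, [11, 9, 6, 3]),
      (2, 5, [8, 5]), (2, 6, [10, 9, 6]), (2, 9, [11, 9]), (3, 7, [11, 10, 9, 7]), (3, 8, [10, 8]),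
      (4, 5, [9, 5]), (4, 8, [11, 8]), (5, 6, [10, 6]), (6, 7, [11, 7])] = true := by
  decide +kernel

theorem isPolycyclic_signedR : IsPolycyclic signedR 12 fun _ => 2 :=
  isPolycyclic_of_pcCheck (fun _ _ => ev_signedR_eq) two_pos pcCheck_signedR

/-- Another order for the generators of the positive unipotent subgroup. -/
def reorder (i : ℕ) : ℕ := [1, 3, 0, 2].getD i i

/-- Since the square of letter 1 is letter 3, putting 1 and 3 first makes a complement of the cyclic
root group of letter 1 into a tail. -/
theorem pcCheck_reorder : pcCheck (fun v w => signedEq (v.map reorder) (w.map reorder)) 12 2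
    [[1], [], [], [7], [10], [11], [], [], [], [], [], []]
    [(0, 2, [11, 9, 8, 7, 6, 4, 3, 2]), (0, 3, [11, 5, 4, 3]), (0, 4, [6, 4]),
      (0, 7, [10, 9, 8, 7]), (0, 8, [11, 9, 8]), (0, 9, [10, 9]), (1, 2, [10, 8, 7, 6, 5, 4, 2]),
      (1, 3, [11, 9, 6, 3]), (1, 7, [11, 10, 9, 7]), (1, 8, [10, 8]), (2, 4, [8, 7, 4]),
      (2, 5, [7, 5]), (2, 6, [9, 8, 6]), (2, 10, [11, 10]), (3, 5, [8, 5]), (3, 6, [10, 9, 6]),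
      (3, 9, [11, 9]), (4, 5, [9, 5]), (4, 8, [11, 8]), (5, 6, [10, 6]), (6, 7, [11, 7])]
      = true := by
  decide +kernel

theorem isPolycyclic_reorder : IsPolycyclic (fun i => signedR (reorder i)) 12 fun _ => 2 := by
  refine isPolycyclic_of_pcCheck (fun v w h => ?_) two_pos pcCheck_reorder
  have := ev_signedR_eq h
  rw [ev, ev, List.map_map, List.map_map] at this
  exact this

/-- Alternating words in the letters `12` and `13`. -/
def altWord : Bool → ℕ → List ℕ
  | _, 0 => []
  | i, l + 1 => (bif i then 13 else 12) :: altWord (!i) l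

/-- Relations between the generators of the Ree group. -/
def reeRelations : List (List ℕ × List ℕ) :=
  [([12, 12], []), ([13, 13], []), (altWord false 8, altWord true 8),
    ([12, 0, 12], [0, 12, 0]), ([13, 1, 13], [1, 13, 1, 1]), ([13, 1, 1, 13], [1, 1, 1, 13, 1]),
    ([13, 1, 1, 1, 13], [1, 1, 13, 1, 1, 1]), ([0, 0], []), ([1, 1, 1, 1], []), ([1, 1], [3])] ++
  [(1, 2), (2, 1), (3, 7), (4, 5), (5, 4), (6, 8), (7, 3), (8, 6), (9, 9), (10, 11), (11, 10)].map
    (fun q => ([12, q.1], [q.2, 12])) ++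
  [(0, 6), (2, 4), (4, 2), (5, 5), (6, 0), (7, 10), (8, 9), (9, 8), (10, 7), (11, 11)].map
    (fun q => ([13, q.1], [q.2, 13])) ++
  [(0, 0), (1, 6), (2, 8), (3, 9), (4, 9), (5, 8), (6, 6), (7, 0)].map
    (fun q => (0 :: altWord true q.1, altWord true q.1 ++ [q.2])) ++
  [(0, 1), (1, 2), (2, 4), (3, 5), (4, 5), (5, 4), (6, 2), (7, 1)].map
    (fun q => (1 :: altWord false q.1, altWord false q.1 ++ [q.2]))

theorem check_reeRelations : (reeRelations.all fun q => signedEq q.1 q.2) = true := by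
  decide +kernel

theorem signedR_relation {v w : List ℕ} (h : (v, w) ∈ reeRelations) :
    ev signedR v = ev signedR w :=
  ev_signedR_eq (List.all_eq_true.1 check_reeRelations (v, w) h)

/-- The root subgroups of the split BN-pair. -/
noncomputable def rankOne (i : Bool) :
    Subgroup ((LieF4 ≃ₗ[ZMod 2] LieF4) × Multiplicative (ZMod 2)) :=
  zpowers (signedR (bif i then 1 else 0))

/-- The complements of the root subgroups. -/
noncomputable def complement :
    Bool → Subgroup ((LieF4 ≃ₗ[ZMod 2] LieF4) × Multiplicative (ZMod 2))
  | false => tail signedR 12 1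
  | true => tail (fun i => signedR (reorder i)) 12 2

theorem reorder_lt : ∀ i < 12, reorder i < 12 := by decide

theorem reorder_surj : ∀ i < 12, ∃ j < 12, reorder j = i := by decide

theorem tail_reorder : tail (fun i => signedR (reorder i)) 12 0 = tail signedR 12 0 := by
  refine le_antisymm (tail_le fun i _ hi => mem_tail (Nat.zero_le _) (reorder_lt i hi))
    (tail_le fun i _ hi => ?_)
  obtain ⟨j, hj, rfl⟩ := reorder_surj i hi
  exact mem_tail (a := fun i => signedR (reorder i)) (Nat.zero_le _) hj

theorem exists_relation_false : ∀ j < 12, 1 ≤ j →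
    ∃ k < 12, 1 ≤ k ∧ ([12, j], [k, 12]) ∈ reeRelations := by decide

theorem exists_relation_true : ∀ j < 12, 2 ≤ j →
    ∃ k < 12, 2 ≤ k ∧ ([13, reorder j], [reorder k, 13]) ∈ reeRelations := by decide

theorem exists_relation_word : ∀ i : Bool, ∀ l < 8,
    ∃ k < 12, ((bif i then 1 else 0) :: altWord (!i) l, altWord (!i) l ++ [k]) ∈ reeRelations := by
  decide

/-- The generators of the Weyl group. -/
noncomputable def weylGen (i : Bool) : (LieF4 ≃ₗ[ZMod 2] LieF4) × Multiplicative (ZMod 2) :=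
  signedR (bif i then 13 else 12)

theorem weylGen_mul_self (i : Bool) : weylGen i * weylGen i = 1 := by
  have h : ([bif i then 13 else 12, bif i then 13 else 12], []) ∈ reeRelations := by
    revert i; decide
  simpa [weylGen] using signedR_relation h

theorem word_weylGen (i : Bool) (l : ℕ) : DihedralBN.word weylGen i l = ev signedR (altWord i l) := by
  induction l generalizing i with
  | zero => rfl
  | succ l ih => rw [DihedralBN.word, ih, altWord, ev_cons, weylGen]

theorem conj_mem_tail_of {a : ℕ → (LieF4 ≃ₗ[ZMod 2] LieF4) × Multiplicative (ZMod 2)} {m k : ℕ}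
    {i : Bool} (h : ∀ j < m, k ≤ j → ∃ l < m, k ≤ l ∧ weylGen i * a j = a l * weylGen i) :
    ∀ y ∈ tail a m k, weylGen i * y * weylGen i ∈ tail a m k := by
  have hi := inv_eq_of_mul_eq_one_left (weylGen_mul_self i)
  have : tail a m k ≤ (tail a m k).comap (MulAut.conj (weylGen i)).toMonoidHom := by
    refine tail_le fun j h1 h2 => ?_
    obtain ⟨l, l1, l2, h3⟩ := h j h2 h1
    change weylGen i * a j * (weylGen i)⁻¹ ∈ tail a m k
    rw [h3, mul_inv_cancel_right]
    exact mem_tail l2 l1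
  intro y hy
  have : weylGen i * y * (weylGen i)⁻¹ ∈ tail a m k := this hy
  rwa [hi] at this

theorem rankOne_le (i : Bool) : rankOne i ≤ tail signedR 12 0 := by
  rw [rankOne, zpowers_le]
  cases i <;> exact mem_tail (Nat.zero_le _) (by norm_num)

theorem signedR_zero_pow : signedR 0 ^ 2 = 1 := by
  simpa [pow_succ] using signedR_relation (v := [0, 0]) (w := []) (by decide)

theorem signedR_one_pow : signedR 1 ^ 4 = 1 := by
  simpa [pow_succ, mul_assoc] using signedR_relation (v := [1, 1, 1, 1]) (w := []) (by decide)

theorem exists_pow_of_mem_zpowers {G : Type*} [Group G] {g a : G} {n : ℕ} (hn : 0 < n) (hg : g ^ n = 1)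
    (ha : a ∈ zpowers g) : ∃ e < n, a = g ^ e := by
  have fin : IsOfFinOrder g := isOfFinOrder_iff_pow_eq_one.2 ⟨n, hn, hg⟩
  obtain ⟨e, rfl⟩ := (fin.mem_powers_iff_mem_zpowers).2 ha
  exact ⟨e % n, Nat.mod_lt _ hn, by
    change g ^ e = g ^ (e % n)
    conv_lhs => rw [← Nat.div_add_mod e n, pow_add, pow_mul, hg, one_pow, one_mul]⟩

/-- The root groups are generated by letter 0, of order at most 2, and letter 1, of order at most 4.
Factorizations come from the two polycyclic orders; every other axiom reduces to the list of
relations. -/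
theorem bnData : DihedralBN.Data (tail signedR 12 0) rankOne complement weylGen where
  A_le := rankOne_le
  H_le
    | false => tail_anti (Nat.zero_le _)
    | true => by
      rw [← tail_reorder]
      exact tail_anti (Nat.zero_le _)
  factor
    | false, u, hu => by
      -- The normal form has the power of letter 0 on the right; applied to the inverse of u, it
      -- yields it on the left.
      obtain ⟨y, hy, e, -, h⟩ := isPolycyclic_signedR.exists_mul_pow (by norm_num) (inv_mem hu)
      refine ⟨(signedR 0 ^ e)⁻¹, inv_mem (npow_mem_zpowers _ _), y⁻¹, inv_mem hy, ?_⟩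
      rw [← mul_inv_rev, ← h, inv_inv]
    | true, u, hu => by
      rw [← tail_reorder] at hu
      obtain ⟨y, hy, e, -, h⟩ := isPolycyclic_reorder.exists_mul_pow (by norm_num) (inv_mem hu)
      obtain ⟨z, hz, d, -, rfl⟩ := isPolycyclic_reorder.exists_mul_pow (by norm_num) hy
      have h3 : signedR 3 = signedR 1 ^ 2 := by
        simpa [pow_succ] using (signedR_relation (v := [1, 1]) (w := [3]) (by decide)).symm
      refine ⟨(signedR 3 ^ d * signedR 1 ^ e)⁻¹, inv_mem ?_, z⁻¹, inv_mem hz, ?_⟩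
      · rw [h3]
        exact mul_mem (pow_mem (npow_mem_zpowers _ _) _) (npow_mem_zpowers _ _)
      · rw [← mul_inv_rev, ← mul_assoc]
        exact inv_eq_iff_eq_inv.1 h
  mul_self := weylGen_mul_self
  conj_mem
    | false => conj_mem_tail_of fun j hj h1 => by
      obtain ⟨k, hk, h2, h3⟩ := exists_relation_false j hj h1
      exact ⟨k, hk, h2, by simpa [weylGen] using signedR_relation h3⟩
    | true => conj_mem_tail_of fun j hj h1 => by
      obtain ⟨k, hk, h2, h3⟩ := exists_relation_true j hj h1
      exact ⟨k, hk, h2, by simpa [weylGen] using signedR_relation h3⟩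
  rank_one i a ha h1 := by
    have mem : ∀ k, k < 12 → signedR k ∈ tail signedR 12 0 := fun k hk =>
      mem_tail (Nat.zero_le _) hk
    cases i
    · obtain ⟨e, he, rfl⟩ := exists_pow_of_mem_zpowers two_pos signedR_zero_pow ha
      interval_cases e
      · simp at h1
      · refine ⟨signedR 0, mem_zpowers _, signedR 0, mem 0 (by norm_num), ?_⟩
        simpa [mul_assoc, weylGen] using
          signedR_relation (v := [12, 0, 12]) (w := [0, 12, 0]) (by decide)
    · obtain ⟨e, he, rfl⟩ := exists_pow_of_mem_zpowers four_pos signedR_one_pow ha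
      have m1 := mem 1 (by norm_num)
      interval_cases e
      · simp at h1
      · refine ⟨signedR 1, mem_zpowers _, signedR 1 * signedR 1, mul_mem m1 m1, ?_⟩
        simpa [mul_assoc, weylGen] using
          signedR_relation (v := [13, 1, 13]) (w := [1, 13, 1, 1]) (by decide)
      · refine ⟨signedR 1 ^ 3, npow_mem_zpowers _ _, signedR 1, m1, ?_⟩
        simpa [pow_succ, mul_assoc, weylGen] using
          signedR_relation (v := [13, 1, 1, 13]) (w := [1, 1, 1, 13, 1]) (by decide)
      · refine ⟨signedR 1 ^ 2, npow_mem_zpowers _ _, signedR 1 ^ 3, pow_mem m1 3, ?_⟩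
        simpa [pow_succ, mul_assoc, weylGen] using
          signedR_relation (v := [13, 1, 1, 1, 13]) (w := [1, 1, 13, 1, 1, 1]) (by decide)
  longest := by
    have h := signedR_relation (v := altWord false 8) (w := altWord true 8) (by decide)
    intro i
    rw [word_weylGen, word_weylGen]
    cases i
    · exact h
    · exact h.symm
  word_conj i l hl a ha := by
    obtain ⟨k, hk, h⟩ := exists_relation_word i l hl
    have h := signedR_relation h
    rw [ev_cons, ev_append, ← word_weylGen, ev_cons, ev_nil, mul_one] at h
    obtain ⟨z, rfl⟩ := ha
    have h2 := conj_zpow (i := z) (a := (DihedralBN.word weylGen (!i) l)⁻¹)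
      (b := signedR (bif i then 1 else 0))
    rw [inv_inv] at h2
    change _ * _ ^ z * _ ∈ _
    rw [← h2, mul_assoc, h, inv_mul_cancel_left]
    exact zpow_mem (mem_tail (Nat.zero_le _) hk) z

/-- The value is 8775 · 2 ^ 12. -/
theorem finite_card_signedRee :
    Finite (tail signedR 14 0) ∧ Nat.card (tail signedR 14 0) ≤ 35942400 := by
  have fin : Finite (tail signedR 12 0) := isPolycyclic_signedR.finite (Nat.zero_le _)
  have finA : ∀ i, Finite (rankOne i) := fun i =>
    Finite.of_injective _ (inclusion_injective (rankOne_le i))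
  obtain ⟨h1, h2⟩ := bnData.card_le
    (by
      rw [rankOne, Nat.card_zpowers]
      exact Nat.le_of_dvd two_pos (orderOf_dvd_of_pow_eq_one signedR_zero_pow))
    (by
      rw [rankOne, Nat.card_zpowers]
      exact Nat.le_of_dvd four_pos (orderOf_dvd_of_pow_eq_one signedR_one_pow))
  have le : tail signedR 14 0 ≤ closure ((tail signedR 12 0 : Set _) ∪ Set.range weylGen) := by
    refine tail_le fun i _ hi => ?_
    by_cases h12 : i < 12
    · exact subset_closure (Or.inl (mem_tail (Nat.zero_le _) h12))
    · obtain rfl | rfl : i = 12 ∨ i = 13 := by omega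
      · exact subset_closure (Or.inr ⟨false, rfl⟩)
      · exact subset_closure (Or.inr ⟨true, rfl⟩)
  refine ⟨Finite.of_injective _ (inclusion_injective le),
    (Nat.card_le_card_of_injective _ (inclusion_injective le)).trans (h2.trans ?_)⟩
  have := isPolycyclic_signedR.card_le (Nat.zero_le 12)
  rw [Finset.prod_const, Nat.card_Ico] at this
  omega

/-- Parity is a projection of the lifted group, hence a homomorphism there, and it kills commutators
because its values commute. Its kernel is a proper subgroup of the lift, so it has at most half the
order, and its image in the linear group contains the derived subgroup. -/
theorem card_commutator_le : Finite TitsGroup ∧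
    Nat.card TitsGroup ≤ 17971200 := by
  obtain ⟨fin, h⟩ := finite_card_signedRee
  set E := tail signedR 14 0 with hE
  set K := E ⊓ (MonoidHom.snd (LieF4 ≃ₗ[ZMod 2] LieF4) (Multiplicative (ZMod 2))).ker with hK
  have hKE : K ≤ E := inf_le_left
  have finK : Finite K := Finite.of_injective _ (inclusion_injective hKE)
  have e1 : reeGroup = E.map (MonoidHom.fst _ _) := by
    rw [hE, map_tail, reeGroup_eq]
    rfl
  have e2 : ⁅reeGroup, reeGroup⁆ ≤ K.map (MonoidHom.fst _ _) := by
    rw [e1, ← map_commutator]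
    refine map_mono (le_inf (commutator_le_self E) ?_)
    rw [commutator_le]
    intro a _ b _
    rw [MonoidHom.mem_ker, map_commutatorElement, commutatorElement_eq_one_iff_mul_comm, mul_comm]
  have c1 : Nat.card (K.map (MonoidHom.fst (LieF4 ≃ₗ[ZMod 2] LieF4) (Multiplicative (ZMod 2)))) ≤
      Nat.card K := Nat.card_le_card_of_surjective _ (MonoidHom.subgroupMap_surjective _ K)
  have finM : Finite (K.map (MonoidHom.fst (LieF4 ≃ₗ[ZMod 2] LieF4) (Multiplicative (ZMod 2)))) :=
    Finite.of_surjective _ (MonoidHom.subgroupMap_surjective _ K)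
  have c2 : 2 * Nat.card K ≤ Nat.card E := by
    have h1 := (K.subgroupOf E).index_mul_card
    rw [Nat.card_congr (subgroupOfEquivOfLe hKE).toEquiv] at h1
    have h2 : (K.subgroupOf E).index ≠ 1 := by
      rw [Ne, index_eq_one, subgroupOf_eq_top]
      intro h3
      -- Letter 1 is odd, so the kernel is proper.
      have h4 : signedR 1 ∈ K := h3 (mem_tail (Nat.zero_le _) (by norm_num))
      have h5 : sign (parity [1]) = 1 := h4.2
      exact absurd h5 (by decide)
    have h3 : (K.subgroupOf E).index ≠ 0 := by
      intro h3
      rw [h3, zero_mul] at h1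
      exact Nat.card_pos.ne h1
    rw [← h1]
    exact Nat.mul_le_mul_right _ (by omega)
  exact ⟨Finite.of_injective _ (inclusion_injective e2),
    (Nat.card_le_card_of_injective _ (inclusion_injective e2)).trans (by omega)⟩

end F4

namespace BitMat

open WordGroup Subgroup

variable {V : Type*} [AddCommGroup V] [Module (ZMod 2) V] {b : Module.Basis (Fin 52) (ZMod 2) V}

/-! ### Enumeration of polycyclic groups -/

/-- Checks `f` for the products of `M` with the powers of the matrix `c` with exponent below the
bound. -/
def allPowers (c : ℕ) (f : ℕ → Bool) : ℕ → ℕ → Bool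
  | 0, _ => true
  | e + 1, M => f M && force (mul c M) fun N => allPowers c f e N

/-- Checks `f` for all products `⋯ c₂ ^ e₂ * c₁ ^ e₁ * M` with exponents below `p`, where
`c₁, c₂, …` are the entries of the list. -/
def allProducts (p : ℕ) (f : ℕ → Bool) (cs : List ℕ) : ℕ → Bool :=
  cs.foldr (fun c g => allPowers c g p) f

theorem exists_of_allPowers {a : V ≃ₗ[ZMod 2] V} {c : ℕ} (ha : Codes b a c) {f : ℕ → Bool} :
    ∀ {p M : ℕ} {x : V ≃ₗ[ZMod 2] V}, allPowers c f p M = true → Codes b x M →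
      ∀ e < p, ∃ N, Codes b (a ^ e * x) N ∧ f N = true
  | 0, _, _, _, _, e, he => by omega
  | p + 1, M, x, h, hx, e, he => by
    rw [allPowers, force_eq, Bool.and_eq_true] at h
    rcases e with _ | e
    · exact ⟨M, by simpa using hx, h.1⟩
    · obtain ⟨N, hN, hf⟩ := exists_of_allPowers ha h.2 (ha.mul hx) e (by omega)
      refine ⟨N, ?_, hf⟩
      rwa [pow_succ, mul_assoc]

/-- By collection, every element of the tail is one of the enumerated products of powers. A boolean
check thus becomes a statement about all elements of the group. -/
theorem exists_of_allProducts {a : ℕ → V ≃ₗ[ZMod 2] V} {cs : List ℕ} (hcs : CodesAll b a cs) {p : ℕ}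
    (ha : IsPolycyclic a cs.length fun _ => p) {f : ℕ → Bool} {k : ℕ} (hk : k ≤ cs.length) :
    ∀ {M : ℕ} {x : V ≃ₗ[ZMod 2] V}, allProducts p f (cs.drop k) M = true → Codes b x M →
      ∀ y ∈ tail a cs.length k, ∃ N, Codes b (y * x) N ∧ f N = true := by
  induction hk using Nat.decreasingInduction with
  | self =>
    intro M x h hx y hy
    rw [List.drop_length] at h
    rw [tail_self, mem_bot] at hy
    exact ⟨M, by rwa [hy, one_mul], h⟩
  | of_succ k hk ih =>
    intro M x h hx y hy
    rw [List.drop_eq_getElem_cons hk, ← List.getD_eq_getElem _ one] at h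
    obtain ⟨z, hz, e, he, rfl⟩ := ha.exists_mul_pow hk hy
    obtain ⟨N, hN, hf⟩ := exists_of_allPowers (hcs k) h hx e he
    rw [mul_assoc]
    exact ih hf hN z hz

/-- Checks that the matrices in the list are a polycyclic sequence whose members are not in the
groups generated by the later ones. -/
def sylowCheck (p : ℕ) (sq : List (List ℕ)) (conj : List (ℕ × ℕ × List ℕ)) (cs : List ℕ) : Bool :=
  pcCheck (fun v w => Nat.beq (evCode cs v) (evCode cs w)) cs.length p sq conj &&
    (List.range cs.length).all fun k =>
      allProducts p (fun N => !Nat.beq N (cs.getD k one)) (cs.drop (k + 1)) one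

/-- Enumeration of each tail shows that it omits the preceding generator. Hence every step has index
exactly p. -/
theorem isPolycyclic_of_sylowCheck {a : ℕ → V ≃ₗ[ZMod 2] V} {cs : List ℕ} (hcs : CodesAll b a cs)
    {p : ℕ} (hp : p.Prime) {sq : List (List ℕ)} {conj : List (ℕ × ℕ × List ℕ)}
    (h : sylowCheck p sq conj cs = true) : IsPolycyclic a cs.length (fun _ => p) ∧
      Nat.card (tail a cs.length 0) = p ^ cs.length := by
  rw [sylowCheck, Bool.and_eq_true, List.all_eq_true] at h
  have h1 : IsPolycyclic a cs.length fun _ => p := isPolycyclic_of_pcCheck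
    (fun v w e => hcs.ev_eq (Nat.eq_of_beq_eq_true e)) hp.pos h.1
  refine ⟨h1, ?_⟩
  rw [h1.card_eq (fun _ _ => hp) (fun k hk hmem => ?_) (Nat.zero_le _), Finset.prod_const,
    Nat.card_Ico, Nat.sub_zero]
  obtain ⟨N, hN, h2⟩ := exists_of_allProducts hcs h1 (Nat.succ_le_of_lt hk)
    (h.2 k (List.mem_range.2 hk)) Codes.one _ hmem
  rw [mul_one] at hN
  rw [Bool.not_eq_true', ← Bool.not_eq_true, Nat.beq_eq] at h2
  exact h2 ((hN.eq_iff (hcs k)).1 rfl)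

end BitMat

namespace F4

open BitMat WordGroup Subgroup
open scoped commutatorElement

/-! ### Sylow subgroups of the Tits group -/

/-- Generators of the Tits group, as words in the generators of the Ree group. -/
def titsWords : List (List ℕ) := [[12], [13], [0], [1, 2, 2, 2], [2, 1, 1, 1]]

/-- Generators of the Tits group; the last is the inverse of the one before it. -/
noncomputable def T : ℕ → LieF4 ≃ₗ[ZMod 2] LieF4 := derived R titsWords

/-- The codes of the generators of the Tits group. -/
def titsCodes : List ℕ := titsWords.map (evCode reeCodes)

theorem codesAll_T : CodesAll shearedBasis T titsCodes := codesAll_R.derived titsWords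

/-- The group generated by the generators of the Tits group. -/
noncomputable def tits : Subgroup (LieF4 ≃ₗ[ZMod 2] LieF4) := tail T 5 0

theorem T_mem_tits (i : ℕ) : T i ∈ tits := by
  by_cases hi : i < 5
  · exact mem_tail (Nat.zero_le _) hi
  · have : titsWords.getD i [] = [] := List.getD_eq_default _ _ (by simp [titsWords]; omega)
    rw [T, derived, this, ev_nil]
    exact one_mem _

/-- Each generator is reached from commutators by conjugations and products inside the derived
subgroup, which is normal in the Ree group. -/
theorem tits_le : tits ≤ ⁅reeGroup, reeGroup⁆ := by
  set L := ⁅reeGroup, reeGroup⁆ with hL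
  have mem : ∀ i < 14, R i ∈ reeGroup := fun i hi => by
    rw [reeGroup_eq]
    exact mem_tail (Nat.zero_le _) hi
  have comm : ∀ {g h c : LieF4 ≃ₗ[ZMod 2] LieF4}, g ∈ reeGroup → h ∈ reeGroup →
      g * h = c * (h * g) → c ∈ L := by
    intro g h c hg hh e
    have : c = ⁅g, h⁆ := by
      rw [commutatorElement_def, mul_assoc, ← mul_inv_rev, eq_mul_inv_iff_mul_eq, e]
    rw [this]
    exact commutator_mem_commutator hg hh
  have conj : ∀ {g h c : LieF4 ≃ₗ[ZMod 2] LieF4}, g ∈ reeGroup → h ∈ L → g * h = c * g → c ∈ L := by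
    intro g h c hg hh e
    have h1 := commutator_mem_commutator hg (commutator_le_self reeGroup hh)
    have : c = ⁅g, h⁆ * h := by
      rw [commutatorElement_def, inv_mul_cancel_right, eq_mul_inv_iff_mul_eq, e]
    rw [this]
    exact mul_mem h1 hh
  have rel : ∀ {v w : List ℕ}, Nat.beq (evCode reeCodes v) (evCode reeCodes w) = true →
      ev R v = ev R w := fun h => codesAll_R.ev_eq (Nat.eq_of_beq_eq_true h)
  have m0 := mem 0 (by norm_num)
  have m1 := mem 1 (by norm_num)
  have m4 := mem 4 (by norm_num)
  have m6 := mem 6 (by norm_num)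
  have m7 := mem 7 (by norm_num)
  have m12 := mem 12 (by norm_num)
  have m13 := mem 13 (by norm_num)
  -- The commutator of `R 6` and `R 7` is `R 11`, which the Weyl involutions carry to `R 10`, `R 7`
  -- and `R 3`. Likewise the commutator of `R 1` and `R 4` is `R 6`, which is carried to `R 0`.
  have f11 : R 11 ∈ L := comm m6 m7
    (by simpa using rel (v := [6, 7]) (w := [11, 7, 6]) (by decide +kernel))
  have f10 : R 10 ∈ L := conj m12 f11
    (by simpa using rel (v := [12, 11]) (w := [10, 12]) (by decide +kernel))
  have f7 : R 7 ∈ L := conj m13 f10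
    (by simpa using rel (v := [13, 10]) (w := [7, 13]) (by decide +kernel))
  have f3 : R 3 ∈ L := conj m12 f7
    (by simpa using rel (v := [12, 7]) (w := [3, 12]) (by decide +kernel))
  have f6 : R 6 ∈ L := comm m1 m4
    (by simpa using rel (v := [1, 4]) (w := [6, 4, 1]) (by decide +kernel))
  have f0 : R 0 ∈ L := conj m13 f6
    (by simpa using rel (v := [13, 6]) (w := [0, 13]) (by decide +kernel))
  -- The commutator of `(R 1)⁻¹` and `R 13` is `R 13 * R 3`, and `R 3` is known to be in L.
  have n2 : R 13 ∈ L := by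
    have h1 : R 13 * R 3 ∈ L := comm (inv_mem m1) m13 (by
      have : R 13 * R 1 * R 13 = R 1 * R 13 * R 3 := by
        simpa [mul_assoc] using rel (v := [13, 1, 13]) (w := [1, 13, 3]) (by decide +kernel)
      rw [inv_mul_eq_iff_eq_mul]
      have h2 : R 13 * R 13 = 1 := by simpa using rel (v := [13, 13]) (w := []) (by decide +kernel)
      calc R 13 = R 13 * R 1 * (R 13 * R 13) * (R 1)⁻¹ := by rw [h2]; group
        _ = (R 13 * R 1 * R 13) * (R 13 * (R 1)⁻¹) := by group
        _ = _ := by rw [this]; group)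
    simpa using mul_mem h1 (inv_mem f3)
  -- The conjugate of `R 0` under `R 12` is `R 0 * R 12 * R 0`, by the rank one relation.
  have n1 : R 12 ∈ L := by
    have h1 : R 0 * R 12 * R 0 ∈ L := conj m12 f0 (by
      simpa [mul_assoc] using rel (v := [12, 0]) (w := [0, 12, 0, 12]) (by decide +kernel))
    simpa [mul_assoc] using mul_mem (mul_mem (inv_mem f0) h1) (inv_mem f0)
  have g : ev R [1, 2, 2, 2] ∈ L := comm m1 m12
    (by simpa [mul_assoc] using
      rel (v := [1, 12]) (w := [1, 2, 2, 2, 12, 1]) (by decide +kernel))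
  have g' : ev R [2, 1, 1, 1] ∈ L := by
    have : ev R [2, 1, 1, 1] * ev R [1, 2, 2, 2] = 1 := by
      rw [← ev_append]
      exact rel (v := [2, 1, 1, 1] ++ [1, 2, 2, 2]) (w := []) (by decide +kernel)
    rw [eq_inv_of_mul_eq_one_left this]
    exact inv_mem g
  refine tail_le fun i _ hi => ?_
  interval_cases i
  · simpa [T, derived, titsWords] using n1
  · simpa [T, derived, titsWords] using n2
  · simpa [T, derived, titsWords] using f0
  · exact g
  · exact g'

/-- Generators of Sylow subgroups, for the prime numbers `2`, `3`, `5` and `13`, as words in the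
generators of the Tits group. -/
def sylowWords : ℕ → List (List ℕ)
  | 2 => [[2], [3], [0, 2, 3, 1, 2, 1, 2, 0], [1, 4, 1, 3, 1], [1, 4, 2, 3, 1, 2, 1, 2, 1],
      [1, 2, 1], [0, 1, 4, 1, 3, 1, 0], [0, 1, 2, 1, 0], [1, 0, 1, 2, 1, 0, 1],
      [1, 0, 1, 4, 1, 3, 1, 0, 1], [0, 1, 0, 1, 4, 1, 3, 1, 0, 1, 0]]
  | 3 => [[1, 0, 1, 0, 2, 1, 0, 1], [1, 4, 1, 0, 1, 3, 1, 0, 2, 1, 4, 1, 0, 1, 3, 1], [0, 2]]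
  | 5 => [[1, 3, 1, 4], [3, 0, 1, 3, 0, 1, 3, 1, 4, 0, 4, 1, 0, 4]]
  | _ => [[0, 1, 2, 3]]

/-- The values of the powers in the Sylow subgroups. -/
def sylowPowers : ℕ → List (List ℕ)
  | 2 => [[], [10, 8, 7, 6, 5, 4, 3], [9, 6], [], [10, 9, 8]]
  | _ => []

/-- The values of the conjugates in the Sylow subgroups. -/
def sylowConj : ℕ → List (ℕ × ℕ × List ℕ)
  | 2 => [(0, 1, [9, 7, 5, 2, 1]), (0, 2, [10, 7, 6, 2]), (0, 3, [9, 7, 6, 5, 4, 3]),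
      (0, 4, [7, 4]), (0, 5, [8, 7, 5]), (0, 9, [10, 9]), (1, 2, [5, 4, 2]), (1, 3, [10, 9, 5, 3]),
      (1, 4, [8, 7, 5, 4]), (1, 5, [10, 8, 5]), (1, 6, [9, 8, 7, 6]), (1, 7, [10, 8, 7]),
      (1, 8, [10, 9, 8]), (2, 3, [10, 8, 5, 3]), (2, 4, [8, 7, 4]), (2, 5, [9, 8, 5]),
      (2, 7, [10, 7]), (2, 8, [10, 8]), (3, 6, [10, 9, 8, 6]), (3, 7, [9, 7]), (4, 5, [9, 5]),
      (4, 7, [10, 7]), (5, 6, [10, 6])]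
  | 3 => [(0, 1, [2, 1])]
  | _ => []

/-- Generators of a Sylow subgroup. -/
noncomputable def sylowGen (p : ℕ) : ℕ → LieF4 ≃ₗ[ZMod 2] LieF4 := derived T (sylowWords p)

/-- The codes of generators of a Sylow subgroup. -/
def sylowCodes (p : ℕ) : List ℕ := (sylowWords p).map (evCode titsCodes)

/-- Evaluates `f` for the codes of the generators of the Tits group and of a Sylow subgroup. -/
def withCodes (p : ℕ) (f : List ℕ → List ℕ → Bool) : Bool :=
  forceList titsCodes fun cs => forceList ((sylowWords p).map (evCode cs)) (f cs)

theorem withCodes_eq (p : ℕ) (f : List ℕ → List ℕ → Bool) :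
    withCodes p f = f titsCodes (sylowCodes p) := by
  rw [withCodes, forceList_eq, forceList_eq, sylowCodes]

theorem codesAll_sylowGen (p : ℕ) : CodesAll shearedBasis (sylowGen p) (sylowCodes p) :=
  codesAll_T.derived (sylowWords p)

/-- Besides the relations, this verifies that the groups have the full orders 2 ^ 11, 3 ^ 3, 5 ^ 2
and 13, which supplies the lower bound for the order of `tits`. -/
theorem check_sylow : ∀ p ∈ [2, 3, 5, 13],
    withCodes p (fun _ => sylowCheck p (sylowPowers p) (sylowConj p)) = true := by
  decide +kernel

/-- A Sylow subgroup of the Tits group. -/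
noncomputable def syl (p : ℕ) : Subgroup (LieF4 ≃ₗ[ZMod 2] LieF4) :=
  tail (sylowGen p) (sylowCodes p).length 0

theorem syl_le (p : ℕ) : syl p ≤ tits := tail_le fun i _ _ => derived_mem T_mem_tits i

theorem prime_of_mem : ∀ p ∈ [2, 3, 5, 13], p.Prime := by norm_num

theorem isPolycyclic_sylowGen {p : ℕ} (hp : p ∈ [2, 3, 5, 13]) :
    IsPolycyclic (sylowGen p) (sylowCodes p).length fun _ => p := by
  have h := check_sylow p hp
  rw [withCodes_eq] at h
  exact (isPolycyclic_of_sylowCheck (codesAll_sylowGen p) (prime_of_mem p hp) h).1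

theorem card_syl {p : ℕ} (hp : p ∈ [2, 3, 5, 13]) : Nat.card (syl p) = p ^ (sylowWords p).length := by
  have h := check_sylow p hp
  rw [withCodes_eq] at h
  have h2 := (isPolycyclic_of_sylowCheck (codesAll_sylowGen p) (prime_of_mem p hp) h).2
  rw [syl, h2, sylowCodes, List.length_map]

theorem dvd_card_tits : 17971200 ∣ Nat.card tits := by
  have d : ∀ p ∈ [2, 3, 5, 13], p ^ (sylowWords p).length ∣ Nat.card tits := fun p hp => by
    rw [← card_syl hp]
    exact card_dvd_of_le (syl_le p)
  have h : 2 ^ 11 * 3 ^ 3 * 5 ^ 2 * 13 ∣ Nat.card tits :=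
    Nat.Coprime.mul_dvd_of_dvd_of_dvd (by norm_num) (Nat.Coprime.mul_dvd_of_dvd_of_dvd (by norm_num)
      (Nat.Coprime.mul_dvd_of_dvd_of_dvd (by norm_num) (d 2 (by simp)) (d 3 (by simp)))
      (d 5 (by simp))) (d 13 (by simp))
  exact h

/-- The order of the derived subgroup is at most 17971200, and that of its subgroup `tits` is a
multiple of this number. -/
theorem tits_eq : tits = ⁅reeGroup, reeGroup⁆ := by
  obtain ⟨fin, hle⟩ := card_commutator_le
  have finT : Finite tits := Finite.of_injective _ (inclusion_injective tits_le)
  exact eq_of_le_of_card_ge tits_le (hle.trans (Nat.le_of_dvd Nat.card_pos dvd_card_tits))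

theorem card_tits : Nat.card tits = 17971200 := by
  obtain ⟨fin, hle⟩ := card_commutator_le
  have finT : Finite tits := Finite.of_injective _ (inclusion_injective tits_le)
  refine le_antisymm ?_ (Nat.le_of_dvd Nat.card_pos dvd_card_tits)
  rw [tits_eq]
  exact hle

end F4

namespace WordGroup

open Subgroup

variable {G : Type*} [Group G]

/-! ### Generation by conjugates -/

/-- Some `m` conjugates of `x` by elements of `M` generate a group which contains `M`. -/
def GenBy (M : Subgroup G) (m : ℕ) (x : G) : Prop :=
  ∃ h : Fin m → G, (∀ i, h i ∈ M) ∧ M ≤ closure (Set.range fun i => h i * x * (h i)⁻¹)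

theorem GenBy.of_conj {M : Subgroup G} {m : ℕ} {w x : G} (hw : w ∈ M)
    (h : GenBy M m (w * x * w⁻¹)) : GenBy M m x := by
  obtain ⟨g, h1, h2⟩ := h
  refine ⟨fun i => g i * w, fun i => mul_mem (h1 i) hw, ?_⟩
  convert h2 using 4
  group

/-- Conjugates of a power are powers of conjugates. This reduces generation to elements of prime
order or of order 4. -/
theorem GenBy.of_pow {M : Subgroup G} {m j : ℕ} {x : G} (h : GenBy M m (x ^ j)) : GenBy M m x := by
  obtain ⟨g, h1, h2⟩ := h
  refine ⟨g, h1, h2.trans ((closure_le _).2 ?_)⟩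
  rintro _ ⟨i, rfl⟩
  change g i * x ^ j * (g i)⁻¹ ∈ _
  rw [← conj_pow]
  exact pow_mem (subset_closure (Set.mem_range_self i)) j

end WordGroup

namespace F4

open BitMat WordGroup Subgroup

/-- Letters which denote inverse generators of the Tits group. -/
def invLetter (i : ℕ) : ℕ := [0, 1, 2, 4, 3].getD i i

theorem T_invLetter (i : ℕ) : T (invLetter i) = (T i)⁻¹ := by
  by_cases hi : i < 5
  · have h : ∀ i < 5, evCode titsCodes [invLetter i, i] = evCode titsCodes [] := by decide +kernel
    have := codesAll_T.ev_eq (h i hi)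
    rw [ev_cons, ev_cons, ev_nil, mul_one] at this
    exact eq_inv_of_mul_eq_one_left this
  · have h1 : titsWords.getD i [] = [] := List.getD_eq_default _ _ (by simp [titsWords]; omega)
    have h2 : T i = 1 := by rw [T, derived, h1, ev_nil]
    rw [invLetter, List.getD_eq_default _ _ (by simp; omega), h2, inv_one]

/-- The inverse of a word in the generators of the Tits group. -/
def invWord (w : List ℕ) : List ℕ := (w.map invLetter).reverse

theorem ev_invWord (w : List ℕ) : ev T (invWord w) = (ev T w)⁻¹ := by
  induction w with
  | nil => simp [invWord]
  | cons i w ih =>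
    rw [invWord, List.map_cons, List.reverse_cons, ev_append, ← invWord, ih, ev_cons, ev_nil, mul_one,
      T_invLetter, ev_cons, mul_inv_rev]

theorem ev_mem_tits (w : List ℕ) : ev T w ∈ tits := ev_mem fun i _ => T_mem_tits i

/-- A certificate that some conjugates of an element generate the Tits group: the element `x` and
its order, elements `h`, and two words in the conjugates `h x h⁻¹` and their inverses for two
generators of the Tits group. -/
structure Cert where
  word : List ℕ
  order : ℕ
  conj : List (List ℕ)
  wordA : List ℕ
  wordB : List ℕ

/-- The words `h x ^ k h⁻¹`. -/
def Cert.conjugates (c : Cert) (k : ℕ) : List (List ℕ) :=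
  c.conj.map fun h => h ++ (List.replicate k c.word).flatten ++ invWord h

/-- The letters for the two words in a certificate. -/
def Cert.letters (c : Cert) : List (List ℕ) := c.conjugates 1 ++ c.conjugates (c.order - 1)

/-- Checks a certificate. -/
def Cert.check (cs : List ℕ) (c : Cert) : Bool :=
  forceList (c.letters.map (evCode cs)) fun ds =>
    Nat.beq (evCode ds c.wordA) (evCode cs [0, 1]) && Nat.beq (evCode ds c.wordB) (evCode cs [3]) &&
    (Nat.beq c.conj.length 2 ||
      (Nat.beq c.conj.length 3 && Nat.beq (evCode cs (c.word ++ c.word)) one))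

/-- The group generated by the generators of the Tits group is generated by two elements. -/
theorem tits_le_of_mem {K : Subgroup (LieF4 ≃ₗ[ZMod 2] LieF4)} (h1 : T 0 * T 1 ∈ K) (h2 : T 3 ∈ K) :
    tits ≤ K := by
  have h4 : T 4 = (T 3)⁻¹ := T_invLetter 3
  -- The letters for the words below are T 0 T 1, T 3 and their inverses, in this order.
  have hW : ∀ i, derived T [[0, 1], [3], [1, 0], [4]] i ∈ K := by
    intro i
    match i with
    | 0 => simpa [derived] using h1
    | 1 => simpa [derived] using h2
    | 2 =>
      have : T 1 * T 0 = (T 0 * T 1)⁻¹ := by rw [mul_inv_rev, ← T_invLetter, ← T_invLetter]; rfl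
      simpa [derived, this] using inv_mem h1
    | 3 => simpa [derived, h4] using h2
    | i + 4 => simp [derived]
  have rel : ∀ {i : ℕ} {w : List ℕ}, Nat.beq (evCode titsCodes [i])
      (evCode ([[0, 1], [3], [1, 0], [4]].map (evCode titsCodes)) w) = true → T i ∈ K := by
    intro i w h
    have := ((codesAll_T.ev [i]).eq_iff ((codesAll_T.derived [[0, 1], [3], [1, 0], [4]]).ev w)).2
      (Nat.eq_of_beq_eq_true h)
    rw [ev_cons, ev_nil, mul_one] at this
    rw [this]
    exact ev_mem fun i _ => hW i
  refine tail_le fun i _ hi => ?_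
  interval_cases i
  · exact rel (w := [1, 0, 3, 0, 1, 2, 3, 2, 1, 2, 3, 0, 1, 0, 3, 0, 1, 0, 0, 0]) (by decide +kernel)
  · exact rel (w := [1, 0, 3, 0, 1, 0, 0, 0, 3, 2, 1, 2, 3, 0, 1, 0, 3, 0, 1]) (by decide +kernel)
  · exact rel (w := [1, 0, 1, 1, 2, 1, 0, 3, 0, 3, 2, 1, 0, 3, 2]) (by decide +kernel)
  · exact h2
  · rw [h4]
    exact inv_mem h2

theorem Cert.ev_mem_of_mem_conjugates (c : Cert) {k : ℕ} {w : List ℕ} (hw : w ∈ c.conjugates k) :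
    ev T w ∈ closure (Set.range fun i : Fin c.conj.length =>
      ev T (c.conj.get i) * ev T c.word * (ev T (c.conj.get i))⁻¹) := by
  obtain ⟨h, hh, rfl⟩ := List.mem_map.1 hw
  obtain ⟨i, rfl⟩ := List.get_of_mem hh
  have flat : ∀ k, ev T (List.replicate k c.word).flatten = ev T c.word ^ k := fun k => by
    induction k with
    | zero => simp
    | succ k ih => rw [List.replicate_succ, List.flatten_cons, ev_append, ih, pow_succ']
  rw [ev_append, ev_append, ev_invWord, flat, ← conj_pow]
  exact pow_mem (subset_closure (Set.mem_range_self i)) k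

/-- The words exhibit T 0 T 1 and T 3 in the group generated by the conjugates, and these two
elements generate everything. The order stored in a certificate needs no proof: the letters meant as
inverses are powers of the conjugates in any case. -/
theorem Cert.genBy {c : Cert} (hc : c.check titsCodes = true) :
    GenBy tits c.conj.length (ev T c.word) ∧ (c.conj.length = 2 ∨
      (c.conj.length = 3 ∧ ev T c.word ^ 2 = 1)) := by
  rw [Cert.check, forceList_eq, Bool.and_eq_true, Bool.and_eq_true, Bool.or_eq_true, Bool.and_eq_true,
    Nat.beq_eq, Nat.beq_eq, Nat.beq_eq, Nat.beq_eq, Nat.beq_eq] at hc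
  obtain ⟨⟨h1, h2⟩, h3⟩ := hc
  refine ⟨⟨fun i => ev T (c.conj.get i), fun i => ev_mem_tits _, ?_⟩, h3.imp_right fun h => ⟨h.1, ?_⟩⟩
  · set K := closure (Set.range fun i : Fin c.conj.length =>
      ev T (c.conj.get i) * ev T c.word * (ev T (c.conj.get i))⁻¹) with hK
    have mem : ∀ i, derived T c.letters i ∈ K := by
      intro i
      rw [derived]
      by_cases hi : i < c.letters.length
      · rw [List.getD_eq_getElem _ _ hi]
        rcases List.mem_append.1 (List.getElem_mem hi) with h | h
        · exact c.ev_mem_of_mem_conjugates h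
        · exact c.ev_mem_of_mem_conjugates h
      · rw [List.getD_eq_default _ _ (by omega)]
        exact one_mem K
    have e1 := (((codesAll_T.derived c.letters).ev c.wordA).eq_iff (codesAll_T.ev [0, 1])).2 h1
    have e2 := (((codesAll_T.derived c.letters).ev c.wordB).eq_iff (codesAll_T.ev [3])).2 h2
    rw [ev_cons, ev_cons, ev_nil, mul_one] at e1
    rw [ev_cons, ev_nil, mul_one] at e2
    refine tits_le_of_mem ?_ ?_
    · rw [← e1]
      exact ev_mem fun i _ => mem i
    · rw [← e2]
      exact ev_mem fun i _ => mem i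
  · have := codesAll_T.ev_eq (v := c.word ++ c.word) (w := []) (h.2.trans (evCode_nil _).symm)
    rwa [ev_append, ← pow_two] at this

/-- Certificates for representatives of the elements of order `3`, `5`, `13`, `2` and `4`. -/
def certs : List Cert :=
  [
    ⟨[0, 2], 3, [[], [2, 1, 4]], [3, 0, 1, 0, 3, 0, 1, 2, 3, 2, 3, 0, 3, 0, 1, 0, 3, 0, 3, 0, 1, 0],
    [0, 3, 0, 3, 0, 3, 2, 1, 0, 1, 2, 3, 0, 3, 0, 1, 0, 3, 0, 1, 2, 1, 2, 3, 2]⟩,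
    ⟨[1, 3, 1, 4], 5, [[], [2, 2, 4, 0, 3]], [3, 0, 3, 3, 0, 1, 0, 0, 1, 1, 0, 3, 0, 0], [1, 0, 3,
    2, 2, 1, 2, 3, 0, 1, 2, 1, 1, 0, 3, 2]⟩,
    ⟨[0, 1, 2, 3], 13, [[], [2, 4, 2, 4]], [1, 1, 1, 0, 1, 0, 0, 1, 1, 1, 0, 3, 3, 0], [3, 0, 3, 2,
    2, 3, 0, 1, 0, 0, 1, 1, 0, 0, 1]⟩,
    ⟨[1, 4, 1, 3, 1], 2, [[], [1, 2], [2, 0, 3, 1]], [0, 2, 1, 2, 0, 2, 1, 0, 2, 0, 1, 0, 1, 2, 0,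
    1, 2, 1, 0, 2, 1, 0, 1, 2, 0, 2, 1, 2, 0, 1, 0], [1, 0, 2, 1, 2, 0, 1, 0, 1, 2, 0, 1, 2, 1, 0,
    2, 0, 1, 0, 2, 1, 2, 0, 2, 1, 0, 1, 2, 0]⟩,
    ⟨[2], 2, [[], [4, 3, 0], [1, 0, 3, 3, 4]], [0, 1, 2, 1, 0, 2, 1, 2, 1, 2, 1, 2, 1, 0, 2, 0, 1,
    2, 1, 2, 1, 2, 0, 1, 0, 2, 0], [2, 1, 2, 1, 2, 1, 2, 1, 0, 2, 1, 0, 2, 0, 1, 2, 0, 2, 1, 2, 1,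
    2, 1, 2, 0, 1]⟩,
    ⟨[1, 0, 1, 4, 1, 3, 1, 0, 1, 0, 1, 2, 1, 0, 1, 4, 1, 3, 1], 4, [[], [1, 0, 4, 1]], [2, 1, 1, 0,
    1, 2, 1, 0, 1, 0, 3, 2, 1, 2, 1, 1, 2], [3, 2, 1, 2, 1, 0, 1, 1, 2, 3, 2, 1, 1, 2, 1, 0, 3]⟩,
    ⟨[1, 0, 1, 2, 1, 0, 2, 1, 2], 4, [[], [0, 1, 2, 3, 0]], [0, 0, 1, 0, 3, 2, 3, 2, 1, 2, 1, 1, 2,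
    3, 2, 1, 1, 0, 0, 1, 0, 3], [1, 2, 1, 0, 1, 0, 1, 2, 1, 2, 1, 1, 0, 0, 1, 0, 1, 1, 0, 1]⟩,
    ⟨[1, 0, 1, 2, 1, 0, 1, 0, 1, 2, 1, 0, 1, 2, 1, 2], 4, [[], [2, 4, 0, 3, 1, 0, 1, 0]], [0, 1, 1,
    0, 0, 1, 0, 3, 0, 1, 0, 3, 0, 0, 1, 1], [0, 0, 3, 2, 1, 1, 0, 3, 2, 3, 0, 3, 0, 1, 0, 1, 1, 2]⟩]

/-- Certificate number `i`. -/
def cert (i : ℕ) : Cert := certs.getD i ⟨[], 0, [], [], []⟩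

theorem check_certs : forceList titsCodes (fun cs => (List.range 8).all fun i => (cert i).check cs) =
    true := by decide +kernel

theorem genBy_cert {i : ℕ} (hi : i < 8) : GenBy tits (cert i).conj.length (ev T (cert i).word) ∧
    ((cert i).conj.length = 2 ∨ ((cert i).conj.length = 3 ∧ ev T (cert i).word ^ 2 = 1)) := by
  have h := check_certs
  rw [forceList_eq, List.all_eq_true] at h
  exact Cert.genBy (h i (List.mem_range.2 hi))

/-! ### Fusion in the Tits group -/

/-- Pairs of a number of a certificate and a word in the generators of the Tits group, such that
conjugation by this word maps certain elements of the Sylow subgroup to the representative. -/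
def fusionWords : ℕ → List (ℕ × List ℕ)
  | 2 => [(3, []), (3, [0]), (3, [0, 1, 0]), (3, [0, 1, 2]), (4, [1, 0]), (4, [1, 0, 1, 3, 2, 0]), (4,
      [1, 0, 3, 1, 3, 0]), (4, [1, 0, 3, 1, 3, 2]), (4, [1, 0, 4, 4, 2, 0]), (4, [3, 1, 3, 2, 3]),
      (4, [4, 4, 1, 4]), (5, []), (5, [0]), (5, [0, 1, 2]), (5, [0, 2, 3, 2, 1]), (6, [2]), (6, [2,
      4, 1, 3, 3, 0]), (6, [2, 4, 1, 4, 1]), (6, [3, 1, 3, 2]), (6, [4, 1, 3, 3, 0]), (6, [4, 1, 4,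
      2]), (6, [4, 2, 3, 1]), (7, []), (7, [1, 4, 1, 4, 1]), (7, [3, 1, 0, 2]), (7, [3, 1, 4, 0,
      2]), (7, [4, 1, 2, 4]), (7, [4, 2, 3, 1]), (7, [4, 2, 4, 1, 3, 0]), (7, [4, 4, 1, 3, 2, 1,
      0])]
  | 3 => [(0, [1, 0, 1]), (0, [1, 4, 1, 0, 1, 3, 1]), (0, [1, 0, 3, 1, 0, 2, 1, 2, 4, 1, 0, 1]), (0,
      [4, 2, 1, 3, 1, 0, 2, 1, 3, 0, 1]), (0, [1, 0, 2, 1, 4, 4, 1, 4, 2, 3, 0, 1]), (0, [1, 2, 4,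
      1, 3, 0, 1, 0, 1, 3, 1]), (0, []), (0, [1, 2, 0, 1, 0, 1, 2, 1, 2, 1]), (0, [1, 2, 1, 2, 1, 0,
      1, 0, 2, 1, 0]), (0, [4, 4, 1, 0, 4, 1, 2, 3, 0, 1, 3, 3]), (0, [1, 0, 2, 4, 2, 3, 2, 1]), (0,
      [1, 4, 1, 0, 1, 3, 0, 1, 3, 2, 1]), (0, [1, 4, 1, 0, 1, 3, 1, 0])]
  | 5 => [(1, []), (1, [0, 4, 1, 0, 4]), (1, [2, 4, 2, 0, 1, 0, 1, 0]), (1, [0, 1, 0, 1, 0, 2, 3, 2,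
      1]), (1, [0, 1, 0, 1, 0, 2, 3, 2]), (1, [2, 4, 2, 0, 1, 0, 1, 0, 1])]
  | _ => [(2, [])]

/-- Whether one of the first `e` of `P`, `N P`, `N² P`, … satisfies `f`. -/
def anyPower (f : ℕ → Bool) (N : ℕ) : ℕ → ℕ → Bool
  | 0, _ => false
  | e + 1, P => f P || force (mul N P) fun Q => anyPower f N e Q

/-- Evaluates `f` for the function which checks if a matrix is mapped to a representative by one of
the fusion words. -/
def withFusion (p : ℕ) (cs : List ℕ) (f : (ℕ → Bool) → Bool) : Bool :=
  forceList ((fusionWords p).map fun q => evCode cs q.2) fun ws =>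
    forceList ((fusionWords p).map fun q => evCode cs (cert q.1).word) fun rs =>
      f fun P => (List.range (fusionWords p).length).any fun k =>
        Nat.beq (mul (ws.getD k one) P) (mul (rs.getD k one) (ws.getD k one))

/-- A number which determines a matrix, for an order on matrices. -/
def rotate (M : ℕ) : ℕ := Nat.add (Nat.shiftLeft (Nat.mod M (2 ^ 988)) 1716) (Nat.shiftRight M 988)

/-- Whether conjugation by one of the matrices in the first list, with inverses in the second list,
makes a matrix smaller. -/
def descends (cs ds : List ℕ) (N : ℕ) : Bool :=
  force (rotate N) fun r => (List.range cs.length).any fun k =>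
    force (mul (mul (cs.getD k one) N) (ds.getD k one)) fun M => Nat.ble (rotate M + 1) r

/-- For every nontrivial element of the Sylow subgroup, one of its powers with exponent 1, …, p - 1
is carried to a representative. Passing to powers keeps the list of conjugating words short. -/
theorem check_fusion : ∀ p ∈ [3, 5, 13],
    withCodes p (fun cs ds => withFusion p cs fun f =>
      allProducts p (fun N => Nat.beq N one || anyPower f N (p - 1) N) ds one) = true := by
  decide +kernel

/-- Conjugating words are needed only for elements with trivial fourth power whose code cannot be
lowered by a Sylow generator. All others are skipped or conjugated downwards within the Sylow
subgroup. -/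
theorem check_fusion_two : withCodes 2 (fun cs ds => withFusion 2 cs fun f =>
    forceList ((sylowWords 2).map fun w => evCode cs (invWord w)) fun es =>
      allProducts 2 (fun N => Nat.beq N one ||
        force (mul N N) (fun N2 => !Nat.beq (mul N2 N2) one) || descends ds es N || f N) ds one) =
      true := by
  decide +kernel

theorem exists_conj_of_withFusion {p : ℕ} {f : (ℕ → Bool) → Bool}
    (h : withFusion p titsCodes f = true) : ∃ g : ℕ → Bool, f g = true ∧
      ∀ P x, Codes shearedBasis x P → g P = true → ∃ w ∈ tits, ∃ q ∈ fusionWords p,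
        w * x * w⁻¹ = ev T (cert q.1).word := by
  rw [withFusion, forceList_eq, forceList_eq] at h
  refine ⟨_, h, fun P x hx hg => ?_⟩
  obtain ⟨k, hk, h1⟩ := List.any_eq_true.1 hg
  rw [List.mem_range] at hk
  rw [Nat.beq_eq, List.getD_eq_getElem _ _ (by simpa using hk), List.getElem_map,
    List.getD_eq_getElem _ _ (by simpa using hk), List.getElem_map] at h1
  refine ⟨ev T (fusionWords p)[k].2, ev_mem_tits _, _, List.getElem_mem hk, ?_⟩
  rw [mul_inv_eq_iff_eq_mul]
  exact (((codesAll_T.ev _).mul hx).eq_iff ((codesAll_T.ev _).mul (codesAll_T.ev _))).2 h1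

theorem exists_of_anyPower {f : ℕ → Bool} {x : LieF4 ≃ₗ[ZMod 2] LieF4} {N : ℕ}
    (hx : Codes shearedBasis x N) : ∀ {e P j : ℕ}, Codes shearedBasis (x ^ j) P →
      anyPower f N e P = true → ∃ j Q, Codes shearedBasis (x ^ j) Q ∧ f Q = true
  | 0, _, _, _, h => by simp [anyPower] at h
  | e + 1, P, j, hP, h => by
    rw [anyPower, force_eq, Bool.or_eq_true] at h
    rcases h with h | h
    · exact ⟨j, P, hP, h⟩
    · refine exists_of_anyPower hx (j := j + 1) ?_ h
      rw [pow_succ']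
      exact hx.mul hP

theorem fusionWords_lt : ∀ p ∈ [2, 3, 5, 13], ∀ q ∈ fusionWords p, q.1 < 8 := by decide

theorem length_conj_cert : ∀ p ∈ [3, 5, 13], ∀ q ∈ fusionWords p, (cert q.1).conj.length = 2 := by
  decide

theorem genBy_of_mem_syl {p : ℕ} (hp : p ∈ [3, 5, 13]) {x : LieF4 ≃ₗ[ZMod 2] LieF4} (hx : x ∈ syl p)
    (h1 : x ≠ 1) : GenBy tits 2 x := by
  have hp' : p ∈ [2, 3, 5, 13] := List.mem_cons_of_mem _ hp
  have h := check_fusion p hp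
  rw [withCodes_eq] at h
  obtain ⟨g, hg, key⟩ := exists_conj_of_withFusion h
  obtain ⟨N, hN, h2⟩ := exists_of_allProducts (codesAll_sylowGen p) (isPolycyclic_sylowGen hp')
    (Nat.zero_le _) hg Codes.one x hx
  rw [mul_one] at hN
  rw [Bool.or_eq_true, Nat.beq_eq] at h2
  rcases h2 with h2 | h2
  · exact absurd ((hN.eq_iff Codes.one).2 h2) h1
  · obtain ⟨j, Q, hQ, h3⟩ := exists_of_anyPower hN (j := 1) (by rwa [pow_one]) h2
    obtain ⟨w, hw, q, hq, h4⟩ := key Q _ hQ h3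
    refine GenBy.of_pow (j := j) (GenBy.of_conj hw ?_)
    have h5 := (genBy_cert (fusionWords_lt p hp' q hq)).1
    rw [length_conj_cert p hp q hq] at h5
    rwa [h4]

/-- The alternative with three conjugates keeps the condition `x ^ 2 = 1`, so that it can be ruled
out for elements of order 4. -/
theorem genBy_of_mem_syl_two {x : LieF4 ≃ₗ[ZMod 2] LieF4} (hx : x ∈ syl 2) (h1 : x ≠ 1)
    (h4 : x ^ 4 = 1) : GenBy tits 2 x ∨ (x ^ 2 = 1 ∧ GenBy tits 3 x) := by
  have h := check_fusion_two
  rw [withCodes_eq] at h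
  obtain ⟨g, hg, key⟩ := exists_conj_of_withFusion h
  rw [forceList_eq] at hg
  have all := exists_of_allProducts (codesAll_sylowGen 2) (isPolycyclic_sylowGen (by simp))
    (Nat.zero_le _) hg Codes.one
  have conj : ∀ {w x : LieF4 ≃ₗ[ZMod 2] LieF4}, w ∈ tits →
      (GenBy tits 2 (w * x * w⁻¹) ∨ ((w * x * w⁻¹) ^ 2 = 1 ∧ GenBy tits 3 (w * x * w⁻¹))) →
      GenBy tits 2 x ∨ (x ^ 2 = 1 ∧ GenBy tits 3 x) := by
    intro w x hw h
    refine h.imp (GenBy.of_conj hw) fun h => ⟨?_, GenBy.of_conj hw h.2⟩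
    rw [conj_pow, mul_inv_eq_one, mul_eq_left] at h
    exact h.1
  -- Descent on the number `rotate N`; the hypotheses and the conclusion are invariant under
  -- conjugation in the Sylow subgroup.
  have main : ∀ n : ℕ, ∀ x ∈ syl 2, ∀ N, Codes shearedBasis x N → rotate N < n → x ≠ 1 → x ^ 4 = 1 →
      GenBy tits 2 x ∨ (x ^ 2 = 1 ∧ GenBy tits 3 x) := by
    intro n
    induction n with
    | zero => intro x _ N _ hn; exact absurd hn (Nat.not_lt_zero _)
    | succ n ih =>
      intro x hx N hN hn h1 h4
      obtain ⟨N', hN', h2⟩ := all x hx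
      rw [mul_one] at hN'
      obtain rfl : N = N' := (hN.eq_iff hN').1 rfl
      rw [Bool.or_eq_true, Bool.or_eq_true, Bool.or_eq_true, force_eq, Nat.beq_eq,
        Bool.not_eq_true', ← Bool.not_eq_true, Nat.beq_eq] at h2
      rcases h2 with ((h2 | h2) | h2) | h2
      · exact absurd ((hN.eq_iff Codes.one).2 h2) h1
      · refine absurd ((((hN.mul hN).mul (hN.mul hN)).eq_iff Codes.one).1 ?_) h2
        rw [← h4]
        simp only [pow_succ, pow_zero, one_mul, mul_assoc]
      · rw [descends, force_eq] at h2
        obtain ⟨k, hk, h3⟩ := List.any_eq_true.1 h2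
        rw [List.mem_range] at hk
        rw [force_eq, Nat.ble_eq] at h3
        have hs : sylowGen 2 k ∈ syl 2 := mem_tail (Nat.zero_le _) hk
        have hk' : k < (sylowWords 2).length := by rwa [sylowCodes, List.length_map] at hk
        have e1 : Codes shearedBasis (sylowGen 2 k)⁻¹
            (((sylowWords 2).map fun w => evCode titsCodes (invWord w)).getD k one) := by
          rw [List.getD_eq_getElem _ _ (by simpa using hk'), List.getElem_map, sylowGen, derived,
            List.getD_eq_getElem _ _ hk', ← ev_invWord]
          exact codesAll_T.ev _
        refine conj (syl_le 2 hs) (ih _ (mul_mem (mul_mem hs hx) (inv_mem hs)) _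
          (((codesAll_sylowGen 2 k).mul hN).mul e1) (by omega) ?_ ?_)
        · rwa [Ne, mul_inv_eq_one, mul_eq_left]
        · rw [conj_pow, h4, mul_one, mul_inv_cancel]
      · obtain ⟨w, hw, q, hq, h5⟩ := key N _ hN h2
        refine conj hw ?_
        rw [h5]
        obtain ⟨g1, g2⟩ := genBy_cert (fusionWords_lt 2 (by simp) q hq)
        rcases g2 with g2 | ⟨g2, g3⟩
        · rw [g2] at g1
          exact Or.inl g1
        · rw [g2] at g1
          exact Or.inr ⟨g3, g1⟩
  obtain ⟨N, hN, -⟩ := all x hx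
  rw [mul_one] at hN
  exact main _ x hx N hN (Nat.lt_succ_self _) h1 h4

end F4

/-! ### Squares in cyclic and dihedral groups -/

namespace WordGroup

open Subgroup

variable {G : Type*} [Group G]

/-- Every element of a dihedral group is a rotation (a b)^n or a reflection (a b)^n a. Reflections
have trivial squares, so all squares are powers of a b. -/
theorem sq_mul_sq_comm_of_involutions {a b : G} (ha : a * a = 1) (hb : b * b = 1) {s : Set G}
    (hs : s ⊆ {a, b}) {u v : G} (hu : u ∈ closure s) (hv : v ∈ closure s) :
    u ^ 2 * v ^ 2 = v ^ 2 * u ^ 2 := by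
  have ia : a⁻¹ = a := inv_eq_of_mul_eq_one_left ha
  have ib : b⁻¹ = b := inv_eq_of_mul_eq_one_left hb
  have flip : ∀ n : ℤ, a * (a * b) ^ n = (a * b) ^ (-n) * a := by
    intro n
    have h1 : a * (a * b) * a⁻¹ = (a * b)⁻¹ := by
      rw [mul_inv_rev, ia, ib, ← mul_assoc, ha, one_mul]
    rw [← mul_inv_eq_iff_eq_mul, ← conj_zpow, h1, inv_zpow, zpow_neg]
  have key : ∀ w ∈ closure s, ∃ n : ℤ, w = (a * b) ^ n ∨ w = (a * b) ^ n * a := by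
    have mul_a : ∀ w, (∃ n : ℤ, w = (a * b) ^ n ∨ w = (a * b) ^ n * a) →
        ∃ n : ℤ, a * w = (a * b) ^ n ∨ a * w = (a * b) ^ n * a := by
      rintro w ⟨n, rfl | rfl⟩
      · exact ⟨-n, Or.inr (flip n)⟩
      · exact ⟨-n, Or.inl (by rw [← mul_assoc, flip, mul_assoc, ha, mul_one])⟩
    have mul_b : ∀ w, (∃ n : ℤ, w = (a * b) ^ n ∨ w = (a * b) ^ n * a) →
        ∃ n : ℤ, b * w = (a * b) ^ n ∨ b * w = (a * b) ^ n * a := by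
      rintro w hw
      have h1 : ∀ n : ℤ, b * (a * b) ^ n = a * (a * b) ^ (n + 1) := fun n => by
        rw [add_comm, zpow_add, zpow_one, ← mul_assoc, ← mul_assoc a a, ha, one_mul]
      obtain ⟨n, rfl | rfl⟩ := hw
      · rw [h1]
        exact mul_a _ ⟨n + 1, Or.inl rfl⟩
      · rw [← mul_assoc, h1, mul_assoc]
        exact mul_a _ ⟨n + 1, Or.inr rfl⟩
    intro w hw
    induction hw using closure_induction_left with
    | one => exact ⟨0, Or.inl (zpow_zero _).symm⟩
    | mul_left y hy z _ ih =>
      rcases hs hy with rfl | rfl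
      · exact mul_a z ih
      · exact mul_b z ih
    | inv_mul_cancel y hy z _ ih =>
      rcases hs hy with rfl | rfl
      · rw [ia]
        exact mul_a z ih
      · rw [ib]
        exact mul_b z ih
  have sq : ∀ w ∈ closure s, w ^ 2 ∈ zpowers (a * b) := by
    intro w hw
    obtain ⟨n, rfl | rfl⟩ := key w hw
    · exact pow_mem (zpow_mem (mem_zpowers _) n) 2
    · have : ((a * b) ^ n * a) ^ 2 = 1 := by
        rw [pow_two, mul_assoc, ← mul_assoc a, flip, mul_assoc _ a a, ha, mul_one, ← zpow_add,
          add_neg_cancel, zpow_zero]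
      rw [this]
      exact one_mem _
  obtain ⟨m, hm⟩ := sq u hu
  obtain ⟨n, hn⟩ := sq v hv
  rw [← hm, ← hn]
  exact (Commute.refl (a * b)).zpow_zpow m n

theorem sq_mul_sq_comm {m : ℕ} {f : Fin m → G} (hm : m ≤ 1 ∨ (m ≤ 2 ∧ ∀ i, f i * f i = 1)) {u v : G}
    (hu : u ∈ closure (Set.range f)) (hv : v ∈ closure (Set.range f)) :
    u ^ 2 * v ^ 2 = v ^ 2 * u ^ 2 := by
  by_cases h1 : m ≤ 1
  · have : ∃ a, Set.range f ⊆ {a} := by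
      rcases Nat.le_one_iff_eq_zero_or_eq_one.1 h1 with rfl | rfl
      · exact ⟨1, by rintro _ ⟨i, rfl⟩; exact i.elim0⟩
      · exact ⟨f 0, by rintro _ ⟨i, rfl⟩; rw [Subsingleton.elim i 0]; rfl⟩
    obtain ⟨a, ha⟩ := this
    have le := closure_mono ha
    rw [← zpowers_eq_closure] at le
    obtain ⟨i, rfl⟩ := le hu
    obtain ⟨j, rfl⟩ := le hv
    exact (((Commute.refl a).zpow_zpow i j).pow_pow 2 2)
  · obtain ⟨h2, h3⟩ := hm.resolve_left h1
    obtain rfl : m = 2 := by omega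
    refine sq_mul_sq_comm_of_involutions (h3 0) (h3 1) ?_ hu hv
    rintro _ ⟨i, rfl⟩
    fin_cases i
    · exact Or.inl rfl
    · exact Or.inr rfl

end WordGroup

namespace F4

open BitMat WordGroup Subgroup

/-! ### Generation of the Tits group -/

theorem finite_tits : Finite tits :=
  Nat.finite_of_card_ne_zero (by rw [card_tits]; norm_num)

/-- The order of `syl p` is the full p-part of the group order, so it is a Sylow subgroup. The
p-group generated by x is contained in a conjugate of it. -/
theorem exists_conj_mem_syl {p : ℕ} (hp : p ∈ [2, 3, 5, 13]) {x : LieF4 ≃ₗ[ZMod 2] LieF4}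
    (hx : x ∈ tits) {k : ℕ} (hk : x ^ p ^ k = 1) : ∃ g ∈ tits, g * x * g⁻¹ ∈ syl p := by
  have := finite_tits
  have : Fact p.Prime := ⟨prime_of_mem p hp⟩
  have hcard : Nat.card ((syl p).subgroupOf tits) = p ^ (sylowWords p).length := by
    rw [← card_syl hp]
    exact Nat.card_congr (subgroupOfEquivOfLe (syl_le p)).toEquiv
  have hP : IsPGroup p ((syl p).subgroupOf tits) := IsPGroup.of_card hcard
  have hindex : ¬ p ∣ ((syl p).subgroupOf tits).index := by
    intro hd
    have h1 := ((syl p).subgroupOf tits).card_mul_index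
    rw [hcard, card_tits] at h1
    have h2 : p ^ ((sylowWords p).length + 1) ∣ 17971200 := by
      rw [pow_succ, ← h1]
      exact Nat.mul_dvd_mul_left _ hd
    -- With only four primes left, maximality of the exponent is a finite check.
    revert h2
    clear * - hp
    revert p
    decide
  have hx' : IsPGroup p (zpowers (⟨x, hx⟩ : tits)) := by
    refine IsPGroup.of_card (n := (orderOf (⟨x, hx⟩ : tits)).factorization p) ?_
    have h1 : orderOf (⟨x, hx⟩ : tits) ∣ p ^ k := orderOf_dvd_of_pow_eq_one (Subtype.ext hk)
    obtain ⟨j, -, h2⟩ := (Nat.dvd_prime_pow this.out).1 h1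
    rw [Nat.card_zpowers, h2, this.out.factorization_pow, Finsupp.single_eq_same]
  obtain ⟨Q, hQ⟩ := hx'.exists_le_sylow
  obtain ⟨g, hg⟩ := MulAction.exists_smul_eq tits Q (hP.toSylow hindex)
  refine ⟨g, g.2, ?_⟩
  have h1 : (⟨x, hx⟩ : tits) ∈ Q := hQ (mem_zpowers _)
  have h2 : g * ⟨x, hx⟩ * g⁻¹ ∈ g • Q := by
    rw [← MulAut.conj_apply]
    exact smul_mem_pointwise_smul _ (MulAut.conj g) Q.toSubgroup h1
  rw [hg] at h2
  exact h2

/-- If an odd prime divides the order of x, some power of x has order 3, 5 or 13. Otherwise the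
order is a power of two exceeding 2, and some power of x has order 4. -/
theorem genBy_two_of_order {x : LieF4 ≃ₗ[ZMod 2] LieF4} (hx : x ∈ tits) (h : 2 < orderOf x) :
    GenBy tits 2 x := by
  have fin := finite_tits
  have hd : orderOf x ∣ 17971200 := by
    rw [← card_tits, ← orderOf_mk x hx]
    exact orderOf_dvd_natCard _
  by_cases hodd : ∃ p, p.Prime ∧ p ≠ 2 ∧ p ∣ orderOf x
  · obtain ⟨p, hp, hp2, hpd⟩ := hodd
    have mem : p ∈ [3, 5, 13] := by
      have h1 : p ∣ 2 ^ 11 * 3 ^ 3 * 5 ^ 2 * 13 := hpd.trans hd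
      rw [hp.dvd_mul, hp.dvd_mul, hp.dvd_mul] at h1
      have hq : ∀ {q k : ℕ}, q.Prime → p ∣ q ^ k → p = q := fun hq h0 =>
        (Nat.prime_dvd_prime_iff_eq hp hq).1 (hp.dvd_of_dvd_pow h0)
      rcases h1 with ((h1 | h1) | h1) | h1
      · exact absurd (hq Nat.prime_two h1) hp2
      · simp [hq Nat.prime_three h1]
      · simp [hq Nat.prime_five h1]
      · simp [(Nat.prime_dvd_prime_iff_eq hp (by norm_num)).1 h1]
    obtain ⟨j, hj⟩ := hpd
    have hpos : 0 < orderOf x := by omega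
    have o : orderOf (x ^ j) = p := by
      rw [orderOf_pow_of_dvd (by rintro rfl; omega) ⟨p, by rw [hj, mul_comm]⟩, hj,
        Nat.mul_div_cancel _ (Nat.pos_of_ne_zero (by rintro rfl; omega))]
    obtain ⟨g, hg, hm⟩ := exists_conj_mem_syl (List.mem_cons_of_mem _ mem) (pow_mem hx j) (k := 1)
      (by rw [pow_one, ← o, pow_orderOf_eq_one])
    refine GenBy.of_pow (GenBy.of_conj hg (genBy_of_mem_syl mem hm ?_))
    rw [Ne, mul_inv_eq_one, mul_eq_left]
    intro h1
    rw [h1, orderOf_one] at o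
    exact hp.one_lt.ne o
  · push Not at hodd
    have h2 : orderOf x = 2 ^ (orderOf x).primeFactorsList.length :=
      Nat.eq_prime_pow_of_unique_prime_dvd (by omega) fun {q} hq hqd => by
        by_contra h0
        exact hodd q hq h0 hqd
    generalize (orderOf x).primeFactorsList.length = k at h2
    obtain ⟨k, rfl⟩ : ∃ j, k = j + 2 := by
      rcases k with _ | _ | k
      · omega
      · omega
      · exact ⟨k, rfl⟩
    have o : orderOf (x ^ 2 ^ k) = 4 := by
      rw [orderOf_pow_of_dvd (by positivity) (by rw [h2]; exact pow_dvd_pow 2 (by omega)), h2, pow_add,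
        Nat.mul_div_cancel_left _ (by positivity)]
      norm_num
    have p4 : (x ^ 2 ^ k) ^ 4 = 1 := orderOf_dvd_iff_pow_eq_one.1 o.dvd
    obtain ⟨g, hg, hm⟩ := exists_conj_mem_syl (p := 2) (by simp) (pow_mem hx (2 ^ k)) (k := 2)
      p4
    refine GenBy.of_pow (j := 2 ^ k) (GenBy.of_conj hg ?_)
    have ne : ∀ j, 0 < j → j < 4 → (x ^ 2 ^ k) ^ j ≠ 1 := fun j h1 h3 h0 => by
      have := orderOf_le_of_pow_eq_one h1 h0
      omega
    refine (genBy_of_mem_syl_two hm ?_ ?_).resolve_right fun h0 => ?_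
    · rw [Ne, mul_inv_eq_one, mul_eq_left]
      simpa using ne 1 (by norm_num) (by norm_num)
    · rw [conj_pow, p4, mul_one, mul_inv_cancel]
    · have := h0.1
      rw [conj_pow, mul_inv_eq_one, mul_eq_left] at this
      exact ne 2 (by norm_num) (by norm_num) this

theorem genBy_of_sq {x : LieF4 ≃ₗ[ZMod 2] LieF4} (hx : x ∈ tits) (h1 : x ≠ 1) (h2 : x ^ 2 = 1) :
    GenBy tits 2 x ∨ GenBy tits 3 x := by
  obtain ⟨g, hg, hm⟩ := exists_conj_mem_syl (p := 2) (by simp) hx (k := 1) h2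
  have h3 : (g * x * g⁻¹) ^ 2 = 1 := by rw [conj_pow, h2, mul_one, mul_inv_cancel]
  refine (genBy_of_mem_syl_two hm ?_ ?_).imp (GenBy.of_conj hg) fun h => GenBy.of_conj hg h.2
  · rwa [Ne, mul_inv_eq_one, mul_eq_left]
  · exact (pow_mul _ 2 2).trans (by rw [h3, one_pow])

/-- The obstruction is applied to inner automorphisms, where central elements become trivial. It is
therefore not enough that two squares fail to commute: their commutator must be non-central, and T 0
witnesses this without computing the centre. -/
theorem sq_mul_sq_not_central : ¬ ((T 3 ^ 2 * (T 0 * T 1) ^ 2)⁻¹ * ((T 0 * T 1) ^ 2 * T 3 ^ 2)) * T 0 =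
    T 0 * ((T 3 ^ 2 * (T 0 * T 1) ^ 2)⁻¹ * ((T 0 * T 1) ^ 2 * T 3 ^ 2)) := by
  have e : (T 3 ^ 2 * (T 0 * T 1) ^ 2)⁻¹ * ((T 0 * T 1) ^ 2 * T 3 ^ 2) =
      ev T (invWord [3, 3, 0, 1, 0, 1] ++ [0, 1, 0, 1, 3, 3]) := by
    rw [ev_append, ev_invWord]
    simp only [ev_cons, ev_nil, pow_two, mul_one, mul_assoc]
  have h : Nat.beq (evCode titsCodes (invWord [3, 3, 0, 1, 0, 1] ++ [0, 1, 0, 1, 3, 3] ++ [0]))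
      (evCode titsCodes ([0] ++ (invWord [3, 3, 0, 1, 0, 1] ++ [0, 1, 0, 1, 3, 3]))) = false := by
    decide +kernel
  intro h0
  rw [e] at h0
  rw [← Bool.not_eq_true, Nat.beq_eq] at h
  refine h (((codesAll_T.ev _).eq_iff (codesAll_T.ev _)).1 ?_)
  rw [ev_append _ _ [0], ev_append _ [0], ev_cons, ev_nil, mul_one]
  exact h0

theorem coe_mem_tits (x : TitsGroup) : (x : LieF4 ≃ₗ[ZMod 2] LieF4) ∈ tits := by
  rw [tits_eq]
  exact x.2

theorem T_mem (i : ℕ) : T i ∈ ⁅reeGroup, reeGroup⁆ := tits_eq ▸ T_mem_tits i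

/-- For an inner automorphism `x`, the group `⟨Inn L, x⟩` is the group of inner automorphisms. -/
theorem alpha_conj (x : TitsGroup) : alpha (MulAut.conj x) = sInf {m : ℕ |
    ∃ g : Fin m → MulAut TitsGroup, (∀ i, g i ∈ (MulAut.conj : TitsGroup →* MulAut TitsGroup).range) ∧
    closure (Set.range fun i => g i * MulAut.conj x * (g i)⁻¹) =
      (MulAut.conj : TitsGroup →* MulAut TitsGroup).range} := by
  have : (MulAut.conj : TitsGroup →* MulAut TitsGroup).range ⊔ zpowers (MulAut.conj x) =
      (MulAut.conj : TitsGroup →* MulAut TitsGroup).range :=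
    sup_eq_left.2 ((zpowers_le).2 ⟨x, rfl⟩)
  rw [alpha, this]

/-- Generation is transported from the linear group to L and then along the surjection of L onto Inn
L. -/
theorem exists_of_genBy {m : ℕ} {x : TitsGroup} (h : GenBy tits m (x : LieF4 ≃ₗ[ZMod 2] LieF4)) :
    ∃ g : Fin m → MulAut TitsGroup, (∀ i, g i ∈ (MulAut.conj : TitsGroup →* MulAut TitsGroup).range) ∧
    closure (Set.range fun i => g i * MulAut.conj x * (g i)⁻¹) =
      (MulAut.conj : TitsGroup →* MulAut TitsGroup).range := by
  obtain ⟨g, h1, h2⟩ := h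
  rw [tits_eq] at h1 h2
  let g' : Fin m → TitsGroup := fun i => ⟨g i, h1 i⟩
  refine ⟨fun i => MulAut.conj (g' i), fun i => ⟨g' i, rfl⟩, ?_⟩
  have top : closure (Set.range fun i => g' i * x * (g' i)⁻¹) = ⊤ := by
    refine eq_top_iff.2 fun y _ => ?_
    have hy := h2 y.2
    have e : (Set.range fun i => g i * (x : LieF4 ≃ₗ[ZMod 2] LieF4) * (g i)⁻¹) =
        Subgroup.subtype _ '' Set.range fun i => g' i * x * (g' i)⁻¹ := by
      rw [← Set.range_comp]
      rfl
    rw [e, ← MonoidHom.map_closure] at hy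
    obtain ⟨z, hz, hzy⟩ := hy
    rwa [← Subtype.ext hzy]
  have e : (Set.range fun i => MulAut.conj (g' i) * MulAut.conj x * (MulAut.conj (g' i))⁻¹) =
      (MulAut.conj : TitsGroup →* MulAut TitsGroup) '' Set.range fun i => g' i * x * (g' i)⁻¹ := by
    rw [← Set.range_comp]
    rfl
  rw [e, ← MonoidHom.map_closure, top, ← MonoidHom.range_eq_map]

/-- Inn L would be cyclic or generated by two elements with trivial squares, so the images of (T 0 T
1)^2 and T 3 ^ 2 would commute. The conjugating automorphisms may be arbitrary. -/
theorem not_generate {m : ℕ} {x : TitsGroup} (hm : m ≤ 1 ∨ (m ≤ 2 ∧ x ^ 2 = 1))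
    {g : Fin m → MulAut TitsGroup}
    (h : closure (Set.range fun i => g i * MulAut.conj x * (g i)⁻¹) =
      (MulAut.conj : TitsGroup →* MulAut TitsGroup).range) : False := by
  obtain ⟨t, ht⟩ : ∃ t : ℕ → TitsGroup, ∀ i, Subgroup.subtype _ (t i) = T i :=
    ⟨fun i => ⟨T i, T_mem i⟩, fun _ => rfl⟩
  have mem : ∀ y : TitsGroup, MulAut.conj y ∈
      closure (Set.range fun i => g i * MulAut.conj x * (g i)⁻¹) := fun y => by
    rw [h]
    exact ⟨y, rfl⟩
  have key := sq_mul_sq_comm (hm.imp_right fun h0 => ⟨h0.1, fun i => by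
      rw [← pow_two, conj_pow, ← map_pow, h0.2, map_one, mul_one, mul_inv_cancel]⟩)
    (mem (t 0 * t 1)) (mem (t 3))
  rw [← map_pow, ← map_pow, ← map_mul, ← map_mul, eq_comm, ← inv_mul_eq_one, ← map_inv,
    ← map_mul] at key
  have h1 := DFunLike.congr_fun key (t 0)
  rw [MulAut.conj_apply, MulAut.one_apply, mul_inv_eq_iff_eq_mul] at h1
  have h2 := congrArg (Subgroup.subtype _) h1
  simp only [map_mul, map_inv, map_pow, ht] at h2
  exact sq_mul_sq_not_central h2

end F4

theorem mainTheorem7 :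
    Nat.card F4.TitsGroup = 17971200 ∧
    ∀ x : F4.TitsGroup,
      (2 < orderOf x → alpha (MulAut.conj x) = 2) ∧
      (orderOf x = 2 → alpha (MulAut.conj x) = 3) := by
  refine ⟨by rw [F4.TitsGroup, ← F4.tits_eq, F4.card_tits], fun x => ⟨fun hx => ?_, fun hx => ?_⟩⟩
  · have hg := F4.genBy_two_of_order (x := x) (F4.coe_mem_tits x) (by rwa [Subgroup.orderOf_coe])
    rw [F4.alpha_conj]
    have hm := F4.exists_of_genBy hg
    refine le_antisymm (Nat.sInf_le hm) (le_csInf ⟨2, hm⟩ ?_)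
    rintro m ⟨g, -, h⟩
    by_contra hlt
    exact F4.not_generate (Or.inl (by omega)) h
  · have h2 : x ^ 2 = 1 := orderOf_dvd_iff_pow_eq_one.1 hx.dvd
    have h1 : x ≠ 1 := by
      rintro rfl
      rw [orderOf_one] at hx
      omega
    have lower : ∀ m, (∃ g : Fin m → MulAut F4.TitsGroup,
        (∀ i, g i ∈ (MulAut.conj : F4.TitsGroup →* MulAut F4.TitsGroup).range) ∧
        Subgroup.closure (Set.range fun i => g i * MulAut.conj x * (g i)⁻¹) =
          (MulAut.conj : F4.TitsGroup →* MulAut F4.TitsGroup).range) → 3 ≤ m := by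
      rintro m ⟨g, -, h⟩
      by_contra hlt
      exact F4.not_generate (Or.inr ⟨by omega, h2⟩) h
    rw [F4.alpha_conj]
    rcases F4.genBy_of_sq (x := x) (F4.coe_mem_tits x) (fun h => h1 (Subtype.ext h))
      (congrArg Subtype.val h2) with hg | hg
    -- The dihedral obstruction excludes generation by two conjugates of an involution.
    · exact absurd (lower 2 (F4.exists_of_genBy hg)) (by norm_num)
    · have hm := F4.exists_of_genBy hg
      exact le_antisymm (Nat.sInf_le hm) (le_csInf ⟨3, hm⟩ lower)
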